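/- \textbf{Theorem (local well-posedness of the tNLS equation in Gevrey spaces).} For $\alpha,\beta,\gamma\in\mathbb R$ with $\beta\neq 0$ consider, for a complex-valued function $v=v(x,t)$ on $\mathbb R\times\mathbb R$, the initial value problem $$\partial_t v+i\alpha\,\partial_x^2 v+\beta\,\partial_x^3 v+i\gamma |v|^2v=0,\qquad v(x,0)=v_0(x). \tag{1}$$ Write $\langle\xi\rangle=1+|\xi|$, $\phi(\xi)=\alpha\xi^2+\beta\xi^3$, and let $\widehat{\;\cdot\;}$ be the Fourier transform (with kernel $e^{-ix\xi}$, respectively $e^{-i(x\xi+t\tau)}$). For $\sigma>0$, $s\in\mathbb R$, $b>\tfrac12$, $T>0$ put $$G^{\sigma,s}(\mathbb R)=\Big\{f\in L^2(\mathbb R):\ \|f\|_{G^{\sigma,s}}=\big\|\langle\xi\rangle^{s}e^{\sigma|\xi|}\widehat f(\xi)\big\|_{L^2_\xi}<\infty\Big\},$$ $$Z^{\sigma,s,b}=\Big\{w\in L^2(\mathbb R^2):\ \|w\|_{Z^{\sigma,s,b}}=\big\|e^{\sigma|\xi|}\langle\xi\rangle^{s}\langle\tau-\phi(\xi)\rangle^{b}\,\widehat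 w(\xi,\tau)\big\|_{L^2_{\xi,\tau}}<\infty\Big\},$$ and let $Z_T^{\sigma,s,b}$ be the space of restrictions to $\mathbb R\times(-T,T)$ of elements of $Z^{\sigma,s,b}$, with $\|v\|_{Z_T^{\sigma,s,b}}=\inf\{\|w\|_{Z^{\sigma,s,b}}: w=v\text{ on }\mathbb R\times(-T,T)\}$. A solution of (1) on $[-T,T]$ is a $v\in C([-T,T];G^{\sigma,s}(\mathbb R))\cap Z_T^{\sigma,s,b}$ with $v(\cdot,0)=v_0$ in $L^2(\mathbb R)$ that satisfies the equation pointwise on $\mathbb R\times[-T,T]$ (each $v(\cdot,t)$ being identified with its smooth representative, with one-sided time derivatives at $t=\pm T$). Let $s>-\tfrac14$. There is $b\in(\tfrac12,1)$, depending only on $s$, such that for all $\alpha,\beta,\gamma\in\mathbb R$ with $\beta\ne0$ there is a positive function $r\mapsto T_0(r)$, depending only on $s,b,\alpha,\beta,\gamma$, with the following properties for every $\sigma>0$ and every $v_0\in G^{\sigma,s}(\mathbb R)$. Put $T_0=T_0(\|v_0\|_{G^{\sigma,s}})$. (i) The problem (1) has exactly one solution $v$ in $C([-T_0,T_0];G^{\sigma,s}(\mathbb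 R))\cap Z_{T_0}^{\sigma,s,b}$. (ii) The data-to-solution map is locally Lipschitz: there are $\delta>0$ and $L\ge0$ such that for every $u_0$ with $\|u_0-v_0\|_{G^{\sigma,s}}<\delta$ the problem (1) with data $u_0$ has exactly one solution in $C([-T_0,T_0];G^{\sigma,s}(\mathbb R))\cap Z_{T_0}^{\sigma,s,b}$, and for any two such data $u_0,w_0$ the corresponding solutions $u,w$ satisfy $$\sup_{|t|\le T_0}\|u(t)-w(t)\|_{G^{\sigma,s}}\le L\,\|u_0-w_0\|_{G^{\sigma,s}},\qquad \|u-w\|_{Z_{T_0}^{\sigma,s,b}}\le L\,\|u_0-w_0\|_{G^{\sigma,s}}.$$ -/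

import Mathlib

open MeasureTheory Set Filter Topology
open scoped ENNReal NNReal FourierTransform

noncomputable section

namespace TNLS

/-- The `L²(ℝ)` Fourier transform in angular frequency, `f̂(ξ) = ∫ e^{-ixξ} f(x) dx`.
Mathlib's `𝓕` has the kernel `e^{-2πixη}`, whence the rescaling `η = ξ / 2π`. -/
def hat (f : Lp ℂ 2 (volume : Measure ℝ)) (ξ : ℝ) : ℂ :=
  (𝓕 f : Lp ℂ 2 (volume : Measure ℝ)) (ξ / (2 * Real.pi))

/-- The space-time plane; coordinate `0` is the space variable `x` (or frequency `ξ`) and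
coordinate `1` is the time variable `t` (or frequency `τ`). -/
abbrev Plane : Type := EuclideanSpace ℝ (Fin 2)

/-- The `L²(ℝ²)` Fourier transform in angular frequency,
`ŵ(ξ,τ) = ∫∫ e^{-i(xξ + tτ)} w(x,t) dx dt`. -/
def hat₂ (w : Lp ℂ 2 (volume : Measure Plane)) (p : Plane) : ℂ :=
  (𝓕 w : Lp ℂ 2 (volume : Measure Plane)) ((2 * Real.pi)⁻¹ • p)

/-- The Gevrey norm `‖f‖_{G^{σ,s}} = ‖⟨ξ⟩^s e^{σ|ξ|} f̂(ξ)‖_{L²}` with `⟨ξ⟩ = 1 + |ξ|`. It is `∞`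
when `f` is not in `L²(ℝ)` (the infimum is then empty), so that `f ∈ G^{σ,s}(ℝ)` means
`gevreyNorm σ s f < ∞`. -/
def gevreyNorm (σ s : ℝ) (f : ℝ → ℂ) : ℝ≥0∞ :=
  ⨅ hf : MemLp f 2 (volume : Measure ℝ),
    eLpNorm (fun ξ : ℝ ↦ (Real.exp (σ * |ξ|) * (1 + |ξ|) ^ s) • hat (hf.toLp f) ξ) 2 volume

/-- The phase function `φ(ξ) = αξ² + βξ³`. -/
def phase (α β ξ : ℝ) : ℝ := α * ξ ^ 2 + β * ξ ^ 3

/-- The Gevrey-Bourgain norm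
`‖w‖_{Z^{σ,s,b}} = ‖e^{σ|ξ|} ⟨ξ⟩^s ⟨τ - φ(ξ)⟩^b ŵ(ξ,τ)‖_{L²}` of `w ∈ L²(ℝ²)`.
For `σ, b > 0` the weight is bounded below by a positive constant, so that every element of the
completion of the Schwartz functions of finite norm lies in `L²(ℝ²)`, and this completion
consists of exactly the `w ∈ L²(ℝ²)` with `bourgainNorm α β σ s b w < ∞`. -/
def bourgainNorm (α β σ s b : ℝ) (w : Lp ℂ 2 (volume : Measure Plane)) : ℝ≥0∞ :=
  eLpNorm (fun p : Plane ↦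
    (Real.exp (σ * |p 0|) * (1 + |p 0|) ^ s * (1 + |p 1 - phase α β (p 0)|) ^ b) • hat₂ w p)
    2 volume

/-- The restricted norm
`‖v‖_{Z_T^{σ,s,b}} = inf {‖w‖_{Z^{σ,s,b}} : w = v on ℝ × (-T,T)}` of a function `v` of `(t,x)`.
It is `∞` when `v` has no extension in `Z^{σ,s,b}`, so that `v ∈ Z_T^{σ,s,b}` means that it is
finite. -/
def restrictedNorm (α β σ s b T : ℝ) (v : ℝ → ℝ → ℂ) : ℝ≥0∞ :=
  ⨅ (w : Lp ℂ 2 (volume : Measure Plane))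
    (_ : ∀ᵐ p : Plane, p 1 ∈ Ioo (-T) T → w p = v (p 1) (p 0)), bourgainNorm α β σ s b w

/-- `v ∈ C([-T,T]; G^{σ,s}(ℝ))`, where `v t` is the function `x ↦ v(x,t)`. -/
def ContinuousInGevrey (σ s T : ℝ) (v : ℝ → ℝ → ℂ) : Prop :=
  ∀ t ∈ Icc (-T) T, gevreyNorm σ s (v t) < ∞ ∧
    Tendsto (fun t' ↦ gevreyNorm σ s (v t' - v t)) (𝓝[Icc (-T) T] t) (𝓝 0)

/-- `v` solves `∂ₜv + iα∂ₓ²v + β∂ₓ³v + iγ|v|²v = 0` pointwise on `[-T,T] × ℝ` (with one-sided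
time derivatives at `t = ±T`), with `v(x,0) = v₀(x)` as elements of `L²(ℝ)`. The functions `v t`
are the smooth representatives of their `L²` classes. -/
def SolvesIVP (α β γ T : ℝ) (v₀ : ℝ → ℂ) (v : ℝ → ℝ → ℂ) : Prop :=
  (∀ t ∈ Icc (-T) T, ContDiff ℝ 3 (v t)) ∧
  (∀ t ∈ Icc (-T) T, ∀ x : ℝ,
    HasDerivWithinAt (fun t' ↦ v t' x)
      (-(Complex.I * α * iteratedDeriv 2 (v t) x + β * iteratedDeriv 3 (v t) x
        + Complex.I * γ * (‖v t x‖ : ℂ) ^ 2 * v t x)) (Icc (-T) T) t) ∧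
  v 0 =ᵐ[volume] v₀

/-- `v` is a solution of the initial value problem with data `v₀` in the space
`C([-T,T]; G^{σ,s}(ℝ)) ∩ Z_T^{σ,s,b}`. -/
structure IsSolution (α β γ σ s b T : ℝ) (v₀ : ℝ → ℂ) (v : ℝ → ℝ → ℂ) : Prop where
  continuous : ContinuousInGevrey σ s T v
  mem_restricted : restrictedNorm α β σ s b T v < ∞
  solves : SolvesIVP α β γ T v₀ v

/-- There is exactly one solution in `C([-T,T]; G^{σ,s}(ℝ)) ∩ Z_T^{σ,s,b}`; two solutions are the
same when they agree on `[-T,T] × ℝ`. -/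
def ExistsUniqueSolution (α β γ σ s b T : ℝ) (v₀ : ℝ → ℂ) : Prop :=
  ∃ v, IsSolution α β γ σ s b T v₀ v ∧
    ∀ w, IsSolution α β γ σ s b T v₀ w → ∀ t ∈ Icc (-T) T, ∀ x, w t x = v t x

end TNLS

end

/-! Undoing the free flow, that is, writing everything on the Fourier side in the variables `(ξ, τ -
φ(ξ))`, turns the problem into a fixed point equation for a profile `F`: up to constants, `F` is the
time-localised linear evolution `lin h` of the data minus the Duhamel term `duh F` of the cubic
nonlinearity. With `b = 3/4` the weight of the Bourgain space becomes the product `wt`. The linear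
part is cut off at scale one, and only the Duhamel kernel is cut off at scale `T ≤ 1`.

The analytic core is the trilinear estimate `exists_trilinear_le`, with modulation exponent `-ρ` on
the left, where `0 < ρ < 1/4` and `-ρ ≤ s`. The factor `e^{σ|ξ|}` costs nothing, since the output
frequency is at most the sum of the input frequencies in absolute value, so all constants are
uniform in `σ`. Cauchy-Schwarz reduces the estimate to a uniform bound for an integral of the
squared kernel, `exists_lintegral_trilinear_le`. The resonance function factors as `(2α +
3β(ξ₁+ξ₃))(ξ₁ξ₃ - ξξ₂)`, and solving for `ξ₁ξ₃` bounds the frequency weight by the modulations. What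
remains is a quadratic phase in `ξ₁` for fixed `k = ξ₁ + ξ₃` (`exists_lintegral_jb_quadratic_le`)
and then a cubic phase in `k` (`exists_lintegral_cubic_le`); both integrals converge because `ρ <
1/4`, which is where `s > -1/4` enters.

The Duhamel estimate `exists_duhamel_le` raises the modulation exponent from `-ρ` to `3/4` and still
gains `T^{1/4-ρ}`. Hence the nonlinear map is a contraction for `T` small in terms of the size of
the data, and `exists_profile` yields profiles depending Lipschitz continuously on the data.

A profile gives a classical solution (`isSolution_vsol`): as `σ > 0`, all polynomial moments in `ξ`
are finite, Duhamel's formula holds on `[-T, T]`, and it can be differentiated under the integral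
sign.

Uniqueness does not come from the contraction but from an energy argument in `L²`
(`SolvesIVP.unique`): the dispersive part is skew-adjoint, and the cubic term is Lipschitz because
Gevrey curves are bounded. Thus every solution is the one built from a profile, and the Lipschitz
bounds for profiles become bounds for solutions. -/

noncomputable section

namespace TNLS

/-! ### Bracket integrals, change of variables, quadratic phases -/

section

/-- The bracket `⟨x⟩ = 1 + |x|`. -/
def jb (x : ℝ) : ℝ := 1 + |x|

lemma one_le_jb (x : ℝ) : 1 ≤ jb x := by simp [jb]

lemma jb_pos (x : ℝ) : 0 < jb x := lt_of_lt_of_le one_pos (one_le_jb x)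

lemma jb_nonneg (x : ℝ) : 0 ≤ jb x := (jb_pos x).le

lemma abs_le_jb (x : ℝ) : |x| ≤ jb x := by simp [jb]

@[simp] lemma jb_neg (x : ℝ) : jb (-x) = jb x := by simp [jb]

lemma jb_add_le (x y : ℝ) : jb (x + y) ≤ jb x * jb y := by
  unfold jb
  nlinarith [abs_add_le x y, mul_nonneg (abs_nonneg x) (abs_nonneg y)]

lemma jb_sub_le (x y : ℝ) : jb (x - y) ≤ jb x * jb y := by
  simpa [sub_eq_add_neg] using jb_add_le x (-y)

lemma jb_add_le_add (x y : ℝ) : jb (x + y) ≤ jb x + jb y := by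
  unfold jb
  linarith [abs_add_le x y]

lemma continuous_jb : Continuous jb := by unfold jb; fun_prop

@[fun_prop] lemma measurable_jb : Measurable jb := continuous_jb.measurable

lemma jb_rpow_pos (x r : ℝ) : 0 < jb x ^ r := Real.rpow_pos_of_pos (jb_pos x) r

lemma jb_rpow_nonneg (x r : ℝ) : 0 ≤ jb x ^ r := (jb_rpow_pos x r).le

lemma jb_rpow_le_one (x : ℝ) {r : ℝ} (hr : r ≤ 0) : jb x ^ r ≤ 1 :=
  Real.rpow_le_one_of_one_le_of_nonpos (one_le_jb x) hr

lemma one_le_jb_rpow (x : ℝ) {r : ℝ} (hr : 0 ≤ r) : 1 ≤ jb x ^ r :=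
  Real.one_le_rpow (one_le_jb x) hr

lemma jb_rpow_mono (x : ℝ) {r r' : ℝ} (h : r ≤ r') : jb x ^ r ≤ jb x ^ r' :=
  Real.rpow_le_rpow_of_exponent_le (one_le_jb x) h

/-- `∫ ⟨x⟩^{-r} dx`. -/
def jbInt (r : ℝ) : ℝ≥0∞ := ∫⁻ x, ENNReal.ofReal (jb x ^ (-r))

lemma jbInt_lt_top {r : ℝ} (hr : 1 < r) : jbInt r < ∞ := by
  have := finite_integral_one_add_norm (E := ℝ) (μ := volume) (r := r) (by simpa using hr)
  simpa [jbInt, jb, Real.norm_eq_abs] using this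

lemma lintegral_comp_mul_left' (f : ℝ → ℝ≥0∞) (hf : Measurable f) {a : ℝ} (ha : a ≠ 0) :
    ∫⁻ x, f (a * x) = ENNReal.ofReal |a⁻¹| * ∫⁻ x, f x := by
  rw [← lintegral_map (μ := volume) hf (measurable_const_mul a), Real.map_volume_mul_left ha,
    lintegral_smul_measure, smul_eq_mul]

lemma add_rpow_le_two_rpow_mul {x y r : ℝ} (hx : 0 ≤ x) (hy : 0 ≤ y) (hr : 0 ≤ r) :
    (x + y) ^ r ≤ 2 ^ r * (x ^ r + y ^ r) := by
  have h1 : x + y ≤ 2 * max x y := by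
    linarith [le_max_left x y, le_max_right x y]
  calc (x + y) ^ r ≤ (2 * max x y) ^ r := Real.rpow_le_rpow (by positivity) h1 hr
    _ = 2 ^ r * (max x y) ^ r := Real.mul_rpow (by norm_num) (le_max_of_le_left hx)
    _ ≤ 2 ^ r * (x ^ r + y ^ r) := by
      gcongr
      rcases le_total x y with h | h
      · rw [max_eq_right h]; linarith [Real.rpow_nonneg hx r]
      · rw [max_eq_left h]; linarith [Real.rpow_nonneg hy r]

/-- Since `⟨y⟩ ≤ ⟨x⟩ + ⟨y - x⟩`, the power `⟨y⟩^r` splits into two summands; each cancels one of the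
decaying factors and leaves the other to be integrated. -/
lemma lintegral_jb_mul_jb_le {r : ℝ} (hr : 0 ≤ r) (y : ℝ) :
    ∫⁻ x, ENNReal.ofReal (jb x ^ (-r) * jb (y - x) ^ (-r)) ≤
      ENNReal.ofReal (2 ^ r) * (jbInt r + jbInt r) * ENNReal.ofReal (jb y ^ (-r)) := by
  have key : ∀ x, jb x ^ (-r) * jb (y - x) ^ (-r) ≤
      2 ^ r * (jb x ^ (-r) + jb (y - x) ^ (-r)) * jb y ^ (-r) := by
    intro x
    have h1 : jb y ≤ jb x + jb (y - x) := by simpa using jb_add_le_add x (y - x)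
    have h2 : jb y ^ r ≤ 2 ^ r * (jb x ^ r + jb (y - x) ^ r) :=
      (Real.rpow_le_rpow (jb_nonneg y) h1 hr).trans
        (add_rpow_le_two_rpow_mul (jb_nonneg _) (jb_nonneg _) hr)
    simp only [Real.rpow_neg (jb_nonneg _)]
    have px := jb_rpow_pos x r
    have py := jb_rpow_pos y r
    have pz := jb_rpow_pos (y - x) r
    rw [← mul_inv, inv_eq_one_div, div_le_iff₀ (by positivity)]
    have : 2 ^ r * ((jb x ^ r)⁻¹ + (jb (y - x) ^ r)⁻¹) * (jb y ^ r)⁻¹ *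
        (jb x ^ r * jb (y - x) ^ r) = 2 ^ r * (jb x ^ r + jb (y - x) ^ r) / jb y ^ r := by
      field_simp; ring
    rw [this, le_div_iff₀ py]; linarith
  calc _ ≤ ∫⁻ x, ENNReal.ofReal (2 ^ r) * (ENNReal.ofReal (jb x ^ (-r)) +
        ENNReal.ofReal (jb (y - x) ^ (-r))) * ENNReal.ofReal (jb y ^ (-r)) := by
        refine lintegral_mono fun x => ?_
        rw [← ENNReal.ofReal_add (jb_rpow_nonneg _ _) (jb_rpow_nonneg _ _),
          ← ENNReal.ofReal_mul (by positivity), ← ENNReal.ofReal_mul]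
        · exact ENNReal.ofReal_le_ofReal (key x)
        · have := jb_rpow_nonneg x (-r); have := jb_rpow_nonneg (y - x) (-r); positivity
    _ = _ := by
        rw [lintegral_mul_const _ (by fun_prop), lintegral_const_mul _ (by fun_prop),
          lintegral_add_left (by fun_prop)]
        congr 3
        exact lintegral_sub_left_eq_self (fun x => ENNReal.ofReal (jb x ^ (-r))) y

/-- A change of variables for functions with at most two critical points. -/
lemma lintegral_abs_deriv_mul_comp_le {P P' : ℝ → ℝ} (hP : ∀ x, HasDerivAt P (P' x) x)
    {a b : ℝ} (h0 : ∀ x, P' x = 0 → x = a ∨ x = b) (h : ℝ → ℝ≥0∞) :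
    ∫⁻ x, ENNReal.ofReal |P' x| * h (P x) ≤ 3 * ∫⁻ y, h y := by
  wlog hab : a ≤ b generalizing a b
  · exact this (a := b) (b := a) (fun x hx => (h0 x hx).symm) (le_of_not_ge hab)
  have piece : ∀ s : Set ℝ, MeasurableSet s → s.OrdConnected → (∀ x ∈ s, x ≠ a ∧ x ≠ b) →
      ∫⁻ x in s, ENNReal.ofReal |P' x| * h (P x) ≤ ∫⁻ y, h y := by
    intro s hs hc hne
    -- An interval without critical points: by Rolle's theorem `P` is injective there, and the exact
    -- change of variables formula applies.
    have hinj : InjOn P s := by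
      have aux : ∀ x ∈ s, ∀ y ∈ s, x < y → P x ≠ P y := by
        intro x hx y hy hxy he
        obtain ⟨c, hcm, hc0⟩ := exists_hasDerivAt_eq_zero hxy
          (fun z _ => (hP z).continuousAt.continuousWithinAt) he (fun z _ => hP z)
        have hcs : c ∈ s := hc.out hx hy ⟨hcm.1.le, hcm.2.le⟩
        rcases h0 c hc0 with h | h
        · exact (hne c hcs).1 h
        · exact (hne c hcs).2 h
      intro x hx y hy he
      rcases lt_trichotomy x y with h | h | h
      · exact absurd he (aux x hx y hy h)
      · exact h
      · exact absurd he.symm (aux y hy x hx h)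
    rw [← lintegral_image_eq_lintegral_abs_deriv_mul hs
      (fun x _ => (hP x).hasDerivWithinAt) hinj h]
    exact setLIntegral_le_lintegral _ _
  have hcov : (univ : Set ℝ) ⊆ ((Iio a ∪ Ioo a b) ∪ Ioi b) ∪ {a, b} := by
    intro x _
    simp only [mem_union, mem_Iio, mem_Ioo, mem_Ioi, mem_insert_iff, mem_singleton_iff]
    rcases lt_trichotomy x a with h | h | h <;> rcases lt_trichotomy x b with h' | h' | h' <;> tauto
  have hnull : volume ({a, b} : Set ℝ) = 0 := (Set.toFinite {a, b}).measure_zero _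
  calc _ = ∫⁻ x in univ, ENNReal.ofReal |P' x| * h (P x) := by rw [setLIntegral_univ]
    _ ≤ ∫⁻ x in ((Iio a ∪ Ioo a b) ∪ Ioi b) ∪ {a, b}, ENNReal.ofReal |P' x| * h (P x) :=
        lintegral_mono_set hcov
    _ ≤ ((∫⁻ x in Iio a, ENNReal.ofReal |P' x| * h (P x)) +
        (∫⁻ x in Ioo a b, ENNReal.ofReal |P' x| * h (P x)) +
        (∫⁻ x in Ioi b, ENNReal.ofReal |P' x| * h (P x))) +
        (∫⁻ x in {a, b}, ENNReal.ofReal |P' x| * h (P x)) := by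
        refine (lintegral_union_le _ _ _).trans (add_le_add_left ?_ _)
        refine (lintegral_union_le _ _ _).trans (add_le_add_left ?_ _)
        exact lintegral_union_le _ _ _
    _ ≤ ((∫⁻ y, h y) + (∫⁻ y, h y) + (∫⁻ y, h y)) + 0 := by
        refine add_le_add (add_le_add (add_le_add ?_ ?_) ?_) ?_
        · exact piece _ measurableSet_Iio ordConnected_Iio
            fun x hx => ⟨ne_of_lt hx, ne_of_lt (lt_of_lt_of_le hx hab)⟩
        · exact piece _ measurableSet_Ioo ordConnected_Ioo
            fun x hx => ⟨ne_of_gt hx.1, ne_of_lt hx.2⟩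
        · exact piece _ measurableSet_Ioi ordConnected_Ioi
            fun x hx => ⟨ne_of_gt (lt_of_le_of_lt hab hx), ne_of_gt hx⟩
        · exact (setLIntegral_measure_zero _ _ hnull).le
    _ = _ := by ring

/-- The inequality `⟨ν⟩^{1/2} ≤ ⟨ν - d²⟩^{1/2} + |d|` produces two terms. In the first the exponent
drops to `1/2 - c`, but `|ν - d²|` is at least the squared distance from `|d|` to `√(max ν 0)`, and
`2c - 1 > 1` makes this integrable. In the second `|d|` is dominated by the derivative of the phase,
so the change of variables applies. -/
lemma lintegral_jb_quadratic_le_aux (c : ℝ) (hc : 1 < c) (ν : ℝ) :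
    ∫⁻ d, ENNReal.ofReal (jb (ν - d ^ 2) ^ (-c)) ≤
      (ENNReal.ofReal (2 ^ (c - 1 / 2)) * (jbInt (2 * c - 1) + jbInt (2 * c - 1)) + 3 * jbInt c) *
        ENNReal.ofReal (jb ν ^ (-(1 / 2 : ℝ))) := by
  set r := √(max ν 0) with hr
  have hr0 : 0 ≤ r := Real.sqrt_nonneg _
  have hr2 : r ^ 2 = max ν 0 := Real.sq_sqrt (le_max_right _ _)
  have h1 : ∀ d, jb ν ^ (1 / 2 : ℝ) ≤ jb (ν - d ^ 2) ^ (1 / 2 : ℝ) + |d| := by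
    intro d
    have : jb ν ≤ jb (ν - d ^ 2) + |d| ^ 2 := by
      have := abs_add_le (ν - d ^ 2) (d ^ 2)
      rw [sub_add_cancel, abs_of_nonneg (sq_nonneg d)] at this
      unfold jb; rw [sq_abs]; linarith
    rw [← Real.sqrt_eq_rpow, ← Real.sqrt_eq_rpow]
    refine (Real.sqrt_le_sqrt this).trans ?_
    rw [Real.sqrt_le_left (by positivity)]
    nlinarith [Real.sq_sqrt (jb_nonneg (ν - d ^ 2)), Real.sqrt_nonneg (jb (ν - d ^ 2)),
      abs_nonneg d]
  -- the distance of `d²` to `ν` controls the squared distance of `|d|` to `r`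
  have h2 : ∀ d, (|d| - r) ^ 2 ≤ |ν - d ^ 2| := by
    intro d
    rcases le_total ν 0 with h | h
    · rw [max_eq_right h] at hr2
      have : r = 0 := by simpa using hr2
      rw [this, sub_zero, sq_abs, abs_of_nonpos (by nlinarith [sq_nonneg d])]; linarith
    · rw [max_eq_left h] at hr2
      have e : |ν - d ^ 2| = (r + |d|) * |(|d| - r)| := by
        rw [← hr2, ← sq_abs d, sq_sub_sq, abs_mul, abs_sub_comm r,
          abs_of_nonneg (add_nonneg hr0 (abs_nonneg d))]
      rw [e, ← sq_abs (|d| - r), sq]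
      gcongr
      rw [abs_le]; constructor <;> linarith [abs_nonneg d]
  have h3 : ∀ d, jb (ν - d ^ 2) ^ (1 / 2 - c) ≤
      2 ^ (c - 1 / 2) * (jb (d - r) ^ (-(2 * c - 1)) + jb (d + r) ^ (-(2 * c - 1))) := by
    intro d
    have a1 : jb (|d| - r) ^ 2 ≤ 2 * jb (ν - d ^ 2) := by
      have := h2 d
      rw [← sq_abs] at this
      unfold jb
      nlinarith [sq_nonneg (|(|d| - r)| - 1)]
    have a2 : (jb (|d| - r) ^ 2 / 2) ^ (1 / 2 - c) ≥ jb (ν - d ^ 2) ^ (1 / 2 - c) :=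
      Real.rpow_le_rpow_of_nonpos (by have := jb_pos (|d| - r); positivity) (by linarith)
        (by linarith)
    have a3 : (jb (|d| - r) ^ 2 / 2) ^ (1 / 2 - c) =
        2 ^ (c - 1 / 2) * jb (|d| - r) ^ (-(2 * c - 1)) := by
      rw [Real.div_rpow (sq_nonneg _) (by norm_num), ← Real.rpow_natCast,
        ← Real.rpow_mul (jb_nonneg _), div_eq_mul_inv, ← Real.rpow_neg (by norm_num), mul_comm]
      congr 2 <;> push_cast <;> ring
    refine a2.le.trans (a3.le.trans ?_)
    gcongr
    rcases abs_cases d with ⟨h, _⟩ | ⟨h, _⟩ <;> rw [h]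
    · linarith [jb_rpow_nonneg (d + r) (-(2 * c - 1))]
    · rw [show -d - r = -(d + r) by ring, jb_neg]
      linarith [jb_rpow_nonneg (d - r) (-(2 * c - 1))]
  have h4 : ∀ d, jb (ν - d ^ 2) ^ (-c) ≤
      (2 ^ (c - 1 / 2) * (jb (d - r) ^ (-(2 * c - 1)) + jb (d + r) ^ (-(2 * c - 1))) +
        |-(2 * d)| * jb (ν - d ^ 2) ^ (-c)) * jb ν ^ (-(1 / 2 : ℝ)) := by
    intro d
    rw [Real.rpow_neg (jb_nonneg ν), ← div_eq_mul_inv, le_div_iff₀ (jb_rpow_pos _ _)]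
    have e : jb (ν - d ^ 2) ^ (1 / 2 - c) = jb (ν - d ^ 2) ^ (-c) * jb (ν - d ^ 2) ^ (1 / 2 : ℝ) := by
      rw [← Real.rpow_add (jb_pos _)]; ring_nf
    have e2 : |d| ≤ |-(2 * d)| := by
      rw [abs_neg, abs_mul, abs_two]; linarith [abs_nonneg d]
    have p := jb_rpow_nonneg (ν - d ^ 2) (-c)
    calc _ ≤ jb (ν - d ^ 2) ^ (-c) * (jb (ν - d ^ 2) ^ (1 / 2 : ℝ) + |-(2 * d)|) := by
          gcongr; linarith [h1 d]
      _ ≤ _ := by rw [mul_add, ← e, mul_comm _ |_|]; gcongr; exact h3 d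
  have p1 : ∀ d, 0 ≤ jb (d - r) ^ (-(2 * c - 1)) := fun d => jb_rpow_nonneg _ _
  have p2 : ∀ d, 0 ≤ jb (d + r) ^ (-(2 * c - 1)) := fun d => jb_rpow_nonneg _ _
  have p3 : ∀ d, 0 ≤ jb (ν - d ^ 2) ^ (-c) := fun d => jb_rpow_nonneg _ _
  calc _ ≤ ∫⁻ d, (ENNReal.ofReal (2 ^ (c - 1 / 2)) * (ENNReal.ofReal (jb (d - r) ^ (-(2 * c - 1))) +
        ENNReal.ofReal (jb (d + r) ^ (-(2 * c - 1)))) +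
        ENNReal.ofReal |-(2 * d)| * ENNReal.ofReal (jb (ν - d ^ 2) ^ (-c))) *
          ENNReal.ofReal (jb ν ^ (-(1 / 2 : ℝ))) := by
        refine lintegral_mono fun d => ?_
        have := p1 d
        have := p2 d
        have := p3 d
        rw [← ENNReal.ofReal_add (p1 d) (p2 d), ← ENNReal.ofReal_mul (by positivity),
          ← ENNReal.ofReal_mul (abs_nonneg _), ← ENNReal.ofReal_add (by positivity) (by positivity),
          ← ENNReal.ofReal_mul (by positivity)]
        exact ENNReal.ofReal_le_ofReal (h4 d)
    _ = (ENNReal.ofReal (2 ^ (c - 1 / 2)) * (jbInt (2 * c - 1) + jbInt (2 * c - 1)) +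
          ∫⁻ d, ENNReal.ofReal |-(2 * d)| * ENNReal.ofReal (jb (ν - d ^ 2) ^ (-c))) *
        ENNReal.ofReal (jb ν ^ (-(1 / 2 : ℝ))) := by
        rw [lintegral_mul_const _ (by fun_prop), lintegral_add_left (by fun_prop),
          lintegral_const_mul _ (by fun_prop), lintegral_add_left (by fun_prop)]
        congr 4
        · exact lintegral_sub_right_eq_self (fun d => ENNReal.ofReal (jb d ^ (-(2 * c - 1)))) r
        · exact lintegral_add_right_eq_self (fun d => ENNReal.ofReal (jb d ^ (-(2 * c - 1)))) r
    _ ≤ _ := by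
        gcongr
        refine lintegral_abs_deriv_mul_comp_le (P := fun d => ν - d ^ 2) (P' := fun d => -(2 * d))
          (a := 0) (b := 0) (fun x => ?_) (fun x hx => ?_) (fun y => ENNReal.ofReal (jb y ^ (-c)))
        · simpa using (hasDerivAt_pow 2 x).const_sub ν
        · left; linarith

/-- The case `A = 1` implies the rest: the bracket is even, which disposes of the sign of `A`, and
scaling `d` by `√A` gives the factor `|A|^{-1/2}`. -/
lemma exists_lintegral_jb_quadratic_le {c : ℝ} (hc : 1 < c) : ∃ C : ℝ≥0∞, C < ∞ ∧
    ∀ A ν : ℝ, A ≠ 0 → ∫⁻ d, ENNReal.ofReal (jb (ν - A * d ^ 2) ^ (-c)) ≤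
      C * ENNReal.ofReal (|A| ^ (-(1 / 2 : ℝ)) * jb ν ^ (-(1 / 2 : ℝ))) := by
  refine ⟨ENNReal.ofReal (2 ^ (c - 1 / 2)) * (jbInt (2 * c - 1) + jbInt (2 * c - 1)) +
    3 * jbInt c, ?_, ?_⟩
  rotate_left
  · intro A ν hA
    wlog hpos : 0 < A generalizing A ν
    · have := this (-A) (-ν) (neg_ne_zero.2 hA) (by
        rcases lt_or_gt_of_ne hA with h | h
        · linarith
        · exact absurd h hpos)
      rw [abs_neg, jb_neg] at this
      convert! this using 5 with d
      rw [← jb_neg]; ring_nf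
    rw [abs_of_pos hpos, ENNReal.ofReal_mul (by positivity), mul_left_comm]
    have hs : √A ≠ 0 := (Real.sqrt_pos.2 hpos).ne'
    have e := lintegral_comp_mul_left' (fun d => ENNReal.ofReal (jb (ν - d ^ 2) ^ (-c)))
      (by fun_prop) hs
    simp only [mul_pow, Real.sq_sqrt hpos.le] at e
    rw [e, abs_of_nonneg (by positivity), ← Real.sqrt_inv, Real.sqrt_eq_rpow,
      Real.inv_rpow hpos.le, ← Real.rpow_neg hpos.le]
    gcongr
    exact lintegral_jb_quadratic_le_aux c hc ν
  · have h1 := (jbInt_lt_top hc)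
    have h2 := jbInt_lt_top (show 1 < 2 * c - 1 by linarith)
    finiteness

end

/-! ### Singular integrals and the pointwise bound for cubic phases -/

section

lemma lintegral_indicator_Ioc_rpow_lt_top {v : ℝ} (hv : v < 1) :
    ∫⁻ z, (Ioc (0 : ℝ) 1).indicator (fun z => ENNReal.ofReal (|z| ^ (-v))) z < ∞ := by
  rw [lintegral_indicator measurableSet_Ioc]
  have h := (intervalIntegral.intervalIntegrable_rpow' (a := 0) (b := 1)
    (show -1 < -v by linarith)).1
  have h2 := h.2
  rw [hasFiniteIntegral_iff_enorm] at h2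
  refine lt_of_le_of_lt (setLIntegral_mono' measurableSet_Ioc fun z hz => ?_) h2
  rw [abs_of_pos hz.1, Real.enorm_of_nonneg (Real.rpow_nonneg hz.1.le _)]

lemma lintegral_indicator_abs_rpow_lt_top {v : ℝ} (hv : v < 1) :
    ∫⁻ z, (Icc (-1 : ℝ) 1).indicator (fun z => ENNReal.ofReal (|z| ^ (-v))) z < ∞ := by
  set g : ℝ → ℝ≥0∞ := (Ioc (0 : ℝ) 1).indicator (fun z => ENNReal.ofReal (|z| ^ (-v))) with hg
  have hgm : Measurable g := Measurable.indicator (by fun_prop) measurableSet_Ioc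
  have hlt := lintegral_indicator_Ioc_rpow_lt_top hv
  have e : ∫⁻ z, g (0 - z) = ∫⁻ z, g z := lintegral_sub_left_eq_self g 0
  have key : ∫⁻ z, (Icc (-1 : ℝ) 1).indicator (fun z => ENNReal.ofReal (|z| ^ (-v))) z ≤
      ∫⁻ z, (g z + g (0 - z)) := by
    refine lintegral_mono_ae ?_
    have h0 : ∀ᵐ z : ℝ, z ≠ 0 := by simp [ae_iff]
    filter_upwards [h0] with z hz
    by_cases hm : z ∈ Icc (-1 : ℝ) 1
    · rw [indicator_of_mem hm]
      rcases lt_or_gt_of_ne hz with h | h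
      · have : (0 - z) ∈ Ioc (0 : ℝ) 1 := ⟨by linarith, by linarith [hm.1]⟩
        simp only [hg]
        rw [indicator_of_mem this, zero_sub, abs_neg]
        exact le_add_self
      · have : z ∈ Ioc (0 : ℝ) 1 := ⟨h, hm.2⟩
        simp only [hg]
        rw [indicator_of_mem this]
        exact le_self_add
    · simp [indicator_of_notMem hm]
  refine lt_of_le_of_lt key ?_
  rw [lintegral_add_left hgm, e]
  finiteness

/-- On `[-1, 1]` only the singularity matters, and `v < 1`; outside, `|z|` is comparable with `⟨z⟩`
and the total decay is `u + v > 1`. -/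
lemma lintegral_jb_mul_abs_rpow_lt_top {u v : ℝ} (hu : 0 ≤ u) (hv0 : 0 ≤ v) (hv : v < 1)
    (huv : 1 < u + v) : ∫⁻ z, ENNReal.ofReal (jb z ^ (-u) * |z| ^ (-v)) < ∞ := by
  set g : ℝ → ℝ≥0∞ := (Icc (-1 : ℝ) 1).indicator (fun z => ENNReal.ofReal (|z| ^ (-v))) with hg
  have hgm : Measurable g := Measurable.indicator (by fun_prop) measurableSet_Icc
  have key : ∫⁻ z, ENNReal.ofReal (jb z ^ (-u) * |z| ^ (-v)) ≤
      ∫⁻ z, (g z + ENNReal.ofReal (2 ^ v) * ENNReal.ofReal (jb z ^ (-(u + v)))) := by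
    refine lintegral_mono fun z => ?_
    by_cases hm : z ∈ Icc (-1 : ℝ) 1
    · refine le_trans ?_ le_self_add
      simp only [hg]
      rw [indicator_of_mem hm]
      refine ENNReal.ofReal_le_ofReal (mul_le_of_le_one_left (by positivity) ?_)
      exact jb_rpow_le_one z (by linarith)
    · refine le_trans ?_ le_add_self
      rw [← ENNReal.ofReal_mul (by positivity)]
      refine ENNReal.ofReal_le_ofReal ?_
      have h1 : 1 ≤ |z| := by
        by_contra h
        exact hm (abs_le.1 (not_le.1 h).le)
      have h2 : |z| ^ (-v) ≤ 2 ^ v * jb z ^ (-v) := by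
        have : jb z / 2 ≤ |z| := by unfold jb; linarith
        refine (Real.rpow_le_rpow_of_nonpos (by have := jb_pos z; positivity) this
          (by linarith)).trans (le_of_eq ?_)
        rw [Real.div_rpow (jb_nonneg z) (by norm_num), div_eq_mul_inv, ← Real.rpow_neg (by norm_num),
          neg_neg, mul_comm]
      rw [neg_add, Real.rpow_add (jb_pos z), mul_left_comm]
      exact mul_le_mul_of_nonneg_left h2 (jb_rpow_nonneg _ _)
  refine lt_of_le_of_lt key ?_
  rw [lintegral_add_left hgm, lintegral_const_mul _ (by fun_prop)]
  have h1 := lintegral_indicator_abs_rpow_lt_top hv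
  have h2 := jbInt_lt_top huv
  unfold jbInt at h2
  exact ENNReal.add_lt_top.2 ⟨h1, ENNReal.mul_lt_top ENNReal.ofReal_lt_top h2⟩

/-- Lowering the exponents of `b` and `c` from `-p` to `-1/2` costs `S^{1/2-p}` each. Then `abc ≥ Z
S² / 400` turns `(abc)^{-1/2}` into `20 S^{-1} Z^{-1/2}`, and the powers of `S` add up to `θ - 2p`.
-/
lemma rpow_mul_three_le {a b c S Z θ p : ℝ} (ha : 0 < a) (hb : 0 < b) (hc : 0 < c) (hS : 0 < S)
    (hbS : b ≤ S) (hcS : c ≤ S) (hp : p ≤ 1 / 2) (hZ : 0 < Z) (h : Z * S ^ 2 ≤ 400 * (a * b * c)) :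
    S ^ θ * (a ^ (-(1 / 2) : ℝ) * (b ^ (-p) * c ^ (-p))) ≤
      20 * (S ^ (θ - 2 * p) * Z ^ (-(1 / 2) : ℝ)) := by
  have e1 : b ^ (-p) = b ^ (-(1 / 2) : ℝ) * b ^ (1 / 2 - p) := by
    rw [← Real.rpow_add hb]; ring_nf
  have e2 : c ^ (-p) = c ^ (-(1 / 2) : ℝ) * c ^ (1 / 2 - p) := by
    rw [← Real.rpow_add hc]; ring_nf
  have l1 : b ^ (1 / 2 - p) ≤ S ^ (1 / 2 - p) := Real.rpow_le_rpow hb.le hbS (by linarith)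
  have l2 : c ^ (1 / 2 - p) ≤ S ^ (1 / 2 - p) := Real.rpow_le_rpow hc.le hcS (by linarith)
  have l3 : (a * b * c) ^ (-(1 / 2) : ℝ) ≤ 20 * (S ^ (-1 : ℝ) * Z ^ (-(1 / 2) : ℝ)) := by
    have h' : Z * S ^ 2 / 400 ≤ a * b * c := by linarith
    refine (Real.rpow_le_rpow_of_nonpos (by positivity) h' (by norm_num)).trans (le_of_eq ?_)
    rw [Real.div_rpow (by positivity) (by norm_num), Real.mul_rpow hZ.le (by positivity),
      ← Real.rpow_natCast S, ← Real.rpow_mul hS.le,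
      show (400 : ℝ) = 20 ^ (2 : ℝ) by norm_num, ← Real.rpow_mul (by norm_num)]
    norm_num
    ring
  calc _ = S ^ θ * ((a * b * c) ^ (-(1 / 2) : ℝ) * (b ^ (1 / 2 - p) * c ^ (1 / 2 - p))) := by
        rw [e1, e2, Real.mul_rpow (by positivity) hc.le, Real.mul_rpow ha.le hb.le]; ring
    _ ≤ S ^ θ * ((20 * (S ^ (-1 : ℝ) * Z ^ (-(1 / 2) : ℝ))) *
          (S ^ (1 / 2 - p) * S ^ (1 / 2 - p))) := by gcongr
    _ = 20 * ((S ^ θ * (S ^ (-1 : ℝ) * (S ^ (1 / 2 - p) * S ^ (1 / 2 - p)))) *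
          Z ^ (-(1 / 2) : ℝ)) := by ring
    _ = _ := by
        rw [← Real.rpow_add hS, ← Real.rpow_add hS, ← Real.rpow_add hS]; ring_nf

/-- The profile of the singular majorant in the cubic sublevel estimate. -/
def cubicMajorant (θ z : ℝ) : ℝ :=
  (jb z ^ (θ - 2 * ((3 + θ) / 8)) * |z| ^ (-(1 / 2) : ℝ)) ^ ((1 - (3 + θ) / 8)⁻¹)

lemma cubicMajorant_nonneg (θ z : ℝ) : 0 ≤ cubicMajorant θ z := by
  have := jb_rpow_nonneg z (θ - 2 * ((3 + θ) / 8))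
  unfold cubicMajorant; positivity

@[fun_prop] lemma measurable_cubicMajorant (θ : ℝ) : Measurable (cubicMajorant θ) := by
  unfold cubicMajorant; fun_prop

/-- Put `p = (3+θ)/8` and `q = 1/(1-p)`. The singularity has exponent `q/2 < 1` because `p < 1/2`,
and the total decay `(2p-θ)q + q/2` exceeds `1` because `3p > θ + 1/2`. Both inequalities amount to
`θ < 1`. -/
lemma lintegral_cubicMajorant_lt_top {θ : ℝ} (h1 : θ < 1) :
    ∫⁻ z, ENNReal.ofReal (cubicMajorant θ z) < ∞ := by
  set q := (1 - (3 + θ) / 8)⁻¹ with hq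
  have hq0 : 0 < q := by rw [hq]; apply inv_pos.2; linarith
  have hqm : q * (1 - (3 + θ) / 8) = 1 := inv_mul_cancel₀ (by linarith)
  have e : ∀ z, cubicMajorant θ z = jb z ^ (-((2 * ((3 + θ) / 8) - θ) * q)) * |z| ^ (-(q / 2)) := by
    intro z
    unfold cubicMajorant
    rw [← hq, Real.mul_rpow (jb_rpow_nonneg _ _) (by positivity), ← Real.rpow_mul (jb_nonneg z),
      ← Real.rpow_mul (abs_nonneg z)]
    ring_nf
  simp only [e]
  apply lintegral_jb_mul_abs_rpow_lt_top
  · apply mul_nonneg _ hq0.le; linarith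
  · positivity
  · nlinarith
  · nlinarith

/-- Young's inequality with exponents `1/p` and `1/(1-p)`, `p = (3+θ)/8`, trades the bracket of `P`
for the factor `D`, which is the size of the derivative of `κ ↦ Bκ(κ-m)²`. The first summand is then
ready for a change of variables, with bracket exponent `1/(2p) > 1`. The second is free of `P` and
is singular only at the points `0`, `m`, `m/3`. -/
lemma cubic_pointwise_le {θ : ℝ} (h0 : 0 ≤ θ) (h1 : θ < 1) {B : ℝ} (hB : B ≠ 0) :
    ∃ K : ℝ, 0 ≤ K ∧ ∀ P m κ : ℝ, κ ≠ 0 → κ ≠ m → 3 * κ ≠ m → 1 ≤ |κ| + |κ - m| →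
      (1 + |κ| + |κ - m|) ^ θ * |κ| ^ (-(1 / 2) : ℝ) * jb P ^ (-(1 / 2) : ℝ) ≤
        |B * ((κ - m) * (3 * κ - m))| * jb P ^ (-((3 + θ) / 8)⁻¹ / 2) +
        K * (cubicMajorant θ κ + cubicMajorant θ (κ - m) + cubicMajorant θ (κ - m / 3)) := by
  set p := (3 + θ) / 8 with hp
  have hp0 : 0 < p := by rw [hp]; linarith
  have hp1 : p < 1 / 2 := by rw [hp]; linarith
  have hpθ : θ - 2 * p ≤ 0 := by rw [hp]; linarith
  set q := (1 - p)⁻¹ with hq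
  have hq0 : 0 < q := by rw [hq]; apply inv_pos.2; linarith
  refine ⟨((3 * |B|) ^ (-p) * 20) ^ q, by positivity, ?_⟩
  intro P m κ hκ0 hκm hκ3 hS1
  set a := |κ| with ha
  set b := |κ - m| with hb
  set c := |κ - m / 3| with hc
  set S := 1 + a + b with hS
  have ha0 : 0 < a := abs_pos.2 hκ0
  have hb0 : 0 < b := abs_pos.2 (sub_ne_zero.2 hκm)
  have hc0 : 0 < c := abs_pos.2 (fun h => hκ3 (by linarith))
  have hS0 : 0 < S := by positivity
  have hB0 : 0 < |B| := abs_pos.2 hB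
  have hcab : 3 * c ≤ 2 * a + b := by
    have : 3 * c = |2 * κ + (κ - m)| := by
      rw [show 2 * κ + (κ - m) = 3 * (κ - m / 3) by ring, abs_mul,
        abs_of_pos (show (0 : ℝ) < 3 by norm_num)]
    rw [this]
    refine (abs_add_le _ _).trans ?_
    rw [abs_mul, abs_two]
  have hacb : 2 * a ≤ 3 * c + b := by
    have : 2 * a = |3 * (κ - m / 3) - (κ - m)| := by
      rw [show 3 * (κ - m / 3) - (κ - m) = 2 * κ by ring, abs_mul, abs_two]
    rw [this]
    refine (abs_sub _ _).trans ?_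
    rw [abs_mul, abs_of_pos (show (0 : ℝ) < 3 by norm_num)]
  have hbac : b ≤ 3 * c + 2 * a := by
    have : b = |3 * (κ - m / 3) - 2 * κ| := by rw [hb]; ring_nf
    rw [this]
    refine (abs_sub _ _).trans ?_
    rw [abs_mul, abs_mul, abs_two, abs_of_pos (show (0 : ℝ) < 3 by norm_num)]
  have hPd : |B * ((κ - m) * (3 * κ - m))| = 3 * |B| * (b * c) := by
    rw [abs_mul, abs_mul, show 3 * κ - m = 3 * (κ - m / 3) by ring, abs_mul,
      abs_of_pos (show (0 : ℝ) < 3 by norm_num)]; ring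
  have hPd0 : 0 < |B * ((κ - m) * (3 * κ - m))| := by rw [hPd]; positivity
  set D := |B * ((κ - m) * (3 * κ - m))| with hD
  -- Young's inequality
  have hY : S ^ θ * a ^ (-(1 / 2) : ℝ) * jb P ^ (-(1 / 2) : ℝ) ≤ D * jb P ^ (-p⁻¹ / 2) +
      (S ^ θ * a ^ (-(1 / 2) : ℝ) * D ^ (-p)) ^ q := by
    have hpq : (p⁻¹).HolderConjugate q := Real.HolderConjugate.inv_inv hp0 (by linarith) (by ring)
    have := Real.young_inequality_of_nonneg (a := D ^ p * jb P ^ (-(1 / 2) : ℝ))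
      (b := S ^ θ * a ^ (-(1 / 2) : ℝ) * D ^ (-p))
      (mul_nonneg (by positivity) (jb_rpow_nonneg _ _)) (by positivity) hpq
    have e1 : D ^ p * jb P ^ (-(1 / 2) : ℝ) * (S ^ θ * a ^ (-(1 / 2) : ℝ) * D ^ (-p)) =
        S ^ θ * a ^ (-(1 / 2) : ℝ) * jb P ^ (-(1 / 2) : ℝ) := by
      rw [Real.rpow_neg hPd0.le]
      have : D ^ p ≠ 0 := (Real.rpow_pos_of_pos hPd0 p).ne'
      field_simp
    have e2 : (D ^ p * jb P ^ (-(1 / 2) : ℝ)) ^ p⁻¹ = D * jb P ^ (-p⁻¹ / 2) := by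
      rw [Real.mul_rpow (by positivity) (jb_rpow_nonneg _ _), ← Real.rpow_mul hPd0.le,
        ← Real.rpow_mul (jb_nonneg P), mul_inv_cancel₀ hp0.ne', Real.rpow_one]
      ring_nf
    rw [e1, e2] at this
    refine this.trans (add_le_add (div_le_self ?_ hpq.lt.le) (div_le_self ?_ hpq.symm.lt.le))
    · exact mul_nonneg hPd0.le (jb_rpow_nonneg _ _)
    · positivity
  refine hY.trans (add_le_add le_rfl ?_)
  have e3 : S ^ θ * a ^ (-(1 / 2) : ℝ) * D ^ (-p) =
      (3 * |B|) ^ (-p) * (S ^ θ * (a ^ (-(1 / 2) : ℝ) * (b ^ (-p) * c ^ (-p)))) := by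
    rw [hPd, Real.mul_rpow (by positivity) (by positivity), Real.mul_rpow hb0.le hc0.le]; ring
  have main : ∀ z : ℝ, 0 < |z| → jb z ≤ S → |z| * S ^ 2 ≤ 400 * (a * b * c) →
      (S ^ θ * a ^ (-(1 / 2) : ℝ) * D ^ (-p)) ^ q ≤
        ((3 * |B|) ^ (-p) * 20) ^ q * cubicMajorant θ z := by
    intro z hz hzS hz3
    have h := rpow_mul_three_le (θ := θ) (p := p) ha0 hb0 hc0 hS0 (by rw [hS]; linarith)
      (by rw [hS]; linarith) hp1.le hz hz3
    have h2 : S ^ (θ - 2 * p) ≤ jb z ^ (θ - 2 * p) :=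
      Real.rpow_le_rpow_of_nonpos (jb_pos z) hzS hpθ
    unfold cubicMajorant
    rw [← hp, ← hq, ← Real.mul_rpow (by positivity)
      (mul_nonneg (jb_rpow_nonneg _ _) (by positivity)), e3, mul_assoc (_ ^ (-p))]
    refine Real.rpow_le_rpow (by positivity) ?_ hq0.le
    refine mul_le_mul_of_nonneg_left (h.trans ?_) (by positivity)
    gcongr
  have n1 := cubicMajorant_nonneg θ κ
  have n2 := cubicMajorant_nonneg θ (κ - m)
  have n3 := cubicMajorant_nonneg θ (κ - m / 3)
  have hKn : 0 ≤ ((3 * |B|) ^ (-p) * 20) ^ q := by positivity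
  have prod : ∀ x y : ℝ, S ≤ 20 * x → S ≤ 20 * y → S ^ 2 ≤ 400 * (x * y) := by
    intro x y hx hy
    nlinarith [mul_le_mul hx hy hS0.le (by linarith)]
  have hS2 : S ≤ 2 * (a + b) := by rw [hS]; linarith
  -- The smallest of the three distances serves as `Z`; the linear relations between `a`, `b`, `c`
  -- together with `S ≤ 2(a + b)` bound the other two below by `S / 20`.
  rcases le_total a b with hab | hab
  · rcases le_total a c with hac | hac
    · refine (main κ ha0 (by rw [hS, jb]; linarith) ?_).trans (by gcongr; linarith)
      have := mul_le_mul_of_nonneg_left (prod b c (by linarith) (by linarith)) ha0.le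
      linarith
    · refine (main (κ - m / 3) hc0 (by rw [hS, jb]; linarith) ?_).trans (by gcongr; linarith)
      have := mul_le_mul_of_nonneg_left (prod a b (by linarith) (by linarith)) hc0.le
      linarith
  · rcases le_total b c with hbc | hbc
    · refine (main (κ - m) hb0 (by rw [hS, jb]; linarith) ?_).trans (by gcongr; linarith)
      have := mul_le_mul_of_nonneg_left (prod a c (by linarith) (by linarith)) hb0.le
      linarith
    · refine (main (κ - m / 3) hc0 (by rw [hS, jb]; linarith) ?_).trans (by gcongr; linarith)
      have := mul_le_mul_of_nonneg_left (prod a b (by linarith) (by linarith)) hc0.le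
      linarith

end

/-! ### The cubic integral and the resonance analysis -/

section

lemma ae_real_ne (a : ℝ) : ∀ᵐ x : ℝ, x ≠ a := by simp [ae_iff]

/-- `cubic_pointwise_le` requires `|κ| + |κ-m| ≥ 1` and lacks the term `|κ|^{-θ/2}`. On the excluded
region, and for that term when `|κ| ≤ 1`, the function `|κ|^{-(1+θ)/2}` on `[-1, 1]` is a majorant,
integrable as `θ < 1`. For `|κ| ≥ 1` the extra term is at most the main weight. -/
lemma cubic_integrand_le {θ : ℝ} (h0 : 0 ≤ θ) (h1 : θ < 1) {B : ℝ} (hB : B ≠ 0) :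
    ∃ K : ℝ, 0 ≤ K ∧ ∀ P m κ : ℝ, κ ≠ 0 → κ ≠ m → 3 * κ ≠ m →
      ENNReal.ofReal (((1 + |κ| + |κ - m|) ^ θ + |κ| ^ (-(θ / 2))) * |κ| ^ (-(1 / 2) : ℝ) *
        jb P ^ (-(1 / 2) : ℝ)) ≤
      3 * (Icc (-1 : ℝ) 1).indicator (fun z => ENNReal.ofReal (|z| ^ (-((1 + θ) / 2)))) κ +
      2 * (ENNReal.ofReal |B * ((κ - m) * (3 * κ - m))| *
          ENNReal.ofReal (jb P ^ (-((3 + θ) / 8)⁻¹ / 2)) +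
        ENNReal.ofReal K * (ENNReal.ofReal (cubicMajorant θ κ) +
          ENNReal.ofReal (cubicMajorant θ (κ - m)) +
          ENNReal.ofReal (cubicMajorant θ (κ - m / 3)))) := by
  obtain ⟨K, hK, h⟩ := cubic_pointwise_le h0 h1 hB
  refine ⟨K, hK, fun P m κ hκ0 hκm hκ3 => ?_⟩
  have n1 := cubicMajorant_nonneg θ κ
  have n2 := cubicMajorant_nonneg θ (κ - m)
  have n3 := cubicMajorant_nonneg θ (κ - m / 3)
  have nj := jb_rpow_nonneg P (-((3 + θ) / 8)⁻¹ / 2)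
  have hk : 0 < |κ| := abs_pos.2 hκ0
  rw [← ENNReal.ofReal_add n1 n2, ← ENNReal.ofReal_add (by positivity) n3,
    ← ENNReal.ofReal_mul hK, ← ENNReal.ofReal_mul (abs_nonneg _),
    ← ENNReal.ofReal_add (by positivity) (by positivity)]
  set R := |B * ((κ - m) * (3 * κ - m))| * jb P ^ (-((3 + θ) / 8)⁻¹ / 2) +
    K * (cubicMajorant θ κ + cubicMajorant θ (κ - m) + cubicMajorant θ (κ - m / 3)) with hR
  have hj1 : jb P ^ (-(1 / 2) : ℝ) ≤ 1 := jb_rpow_le_one P (by norm_num)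
  have hj0 := jb_rpow_nonneg P (-(1 / 2) : ℝ)
  have hsmall : |κ| ≤ 1 → (Icc (-1 : ℝ) 1).indicator
      (fun z => ENNReal.ofReal (|z| ^ (-((1 + θ) / 2)))) κ =
      ENNReal.ofReal (|κ| ^ (-((1 + θ) / 2))) := fun h =>
    indicator_of_mem (show κ ∈ Icc (-1 : ℝ) 1 from abs_le.1 h) _
  have hexp : |κ| ^ (-(θ / 2)) * |κ| ^ (-(1 / 2) : ℝ) = |κ| ^ (-((1 + θ) / 2)) := by
    rw [← Real.rpow_add hk]; ring_nf
  have h3 : (3 : ℝ≥0∞) = ENNReal.ofReal 3 := by simp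
  have h2 : (2 : ℝ≥0∞) = ENNReal.ofReal 2 := by simp
  have hR0 : 0 ≤ R := by positivity
  rcases lt_or_ge (|κ| + |κ - m|) 1 with hS | hS
  · have hκ1 : |κ| ≤ 1 := by linarith [abs_nonneg (κ - m)]
    rw [hsmall hκ1, h3, ← ENNReal.ofReal_mul (by norm_num)]
    refine le_trans (ENNReal.ofReal_le_ofReal ?_) le_self_add
    have e1 : (1 + |κ| + |κ - m|) ^ θ ≤ 2 := by
      calc (1 + |κ| + |κ - m|) ^ θ ≤ 2 ^ θ :=
            Real.rpow_le_rpow (by positivity) (by linarith) h0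
        _ ≤ 2 ^ (1 : ℝ) := Real.rpow_le_rpow_of_exponent_le (by norm_num) h1.le
        _ = 2 := by norm_num
    have e2 : 1 ≤ |κ| ^ (-(θ / 2)) :=
      Real.one_le_rpow_of_pos_of_le_one_of_nonpos hk hκ1 (by linarith)
    calc _ ≤ (3 * |κ| ^ (-(θ / 2))) * |κ| ^ (-(1 / 2) : ℝ) * 1 := by gcongr; linarith
      _ = _ := by rw [mul_one, mul_assoc, hexp]
  · have hc := h P m κ hκ0 hκm hκ3 hS
    rw [← hR] at hc
    rcases le_total |κ| 1 with hκ1 | hκ1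
    · rw [hsmall hκ1, h3, h2, ← ENNReal.ofReal_mul (by norm_num),
        ← ENNReal.ofReal_mul (by norm_num), ← ENNReal.ofReal_add (by positivity) (by positivity)]
      refine ENNReal.ofReal_le_ofReal ?_
      have : |κ| ^ (-(θ / 2)) * |κ| ^ (-(1 / 2) : ℝ) * jb P ^ (-(1 / 2) : ℝ) ≤
          |κ| ^ (-((1 + θ) / 2)) := by
        rw [hexp]; exact mul_le_of_le_one_right (by positivity) hj1
      have p : 0 ≤ |κ| ^ (-((1 + θ) / 2)) := by positivity
      rw [add_mul, add_mul]; linarith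
    · rw [h2, ← ENNReal.ofReal_mul (by norm_num)]
      refine le_trans (ENNReal.ofReal_le_ofReal ?_) le_add_self
      have e1 : |κ| ^ (-(θ / 2)) ≤ (1 + |κ| + |κ - m|) ^ θ :=
        (Real.rpow_le_one_of_one_le_of_nonpos hκ1 (by linarith)).trans
          (Real.one_le_rpow (by linarith [abs_nonneg (κ - m)]) h0)
      calc _ ≤ ((1 + |κ| + |κ - m|) ^ θ + (1 + |κ| + |κ - m|) ^ θ) * |κ| ^ (-(1 / 2) : ℝ) *
            jb P ^ (-(1 / 2) : ℝ) := by gcongr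
        _ = 2 * ((1 + |κ| + |κ - m|) ^ θ * |κ| ^ (-(1 / 2) : ℝ) * jb P ^ (-(1 / 2) : ℝ)) := by
          ring
        _ ≤ _ := by gcongr

/-- Uniformity in `μ` and `m`: the singular majorants are integrated by translation invariance, and
the remaining term by the change of variables to the phase, whose only critical points are `m` and
`m/3`. -/
lemma exists_lintegral_cubic_le {θ : ℝ} (h0 : 0 ≤ θ) (h1 : θ < 1) {B : ℝ} (hB : B ≠ 0) :
    ∃ C : ℝ≥0∞, C < ∞ ∧ ∀ μ m : ℝ, ∫⁻ κ, ENNReal.ofReal (((1 + |κ| + |κ - m|) ^ θ +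
      |κ| ^ (-(θ / 2))) * |κ| ^ (-(1 / 2) : ℝ) *
        jb (μ + B * (κ * (κ - m) ^ 2)) ^ (-(1 / 2) : ℝ)) ≤ C := by
  obtain ⟨K, hK, h⟩ := cubic_integrand_le h0 h1 hB
  set H := ∫⁻ z, ENNReal.ofReal (cubicMajorant θ z) with hH
  have hHlt : H < ∞ := lintegral_cubicMajorant_lt_top h1
  set I := ∫⁻ z, (Icc (-1 : ℝ) 1).indicator
    (fun z => ENNReal.ofReal (|z| ^ (-((1 + θ) / 2)))) z with hI
  have hIlt : I < ∞ := lintegral_indicator_abs_rpow_lt_top (by linarith)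
  set r := ((3 + θ) / 8)⁻¹ / 2 with hr
  have hr1 : 1 < r := by
    rw [hr, inv_eq_one_div, lt_div_iff₀ (by norm_num), lt_div_iff₀ (by linarith)]; linarith
  have hJ := jbInt_lt_top hr1
  refine ⟨3 * I + 2 * (3 * jbInt r + ENNReal.ofReal K * (H + H + H)), by finiteness, ?_⟩
  intro μ m
  have hmI : Measurable ((Icc (-1 : ℝ) 1).indicator
    (fun z => ENNReal.ofReal (|z| ^ (-((1 + θ) / 2))))) :=
    Measurable.indicator (by fun_prop) measurableSet_Icc
  calc _ ≤ ∫⁻ κ, (3 * (Icc (-1 : ℝ) 1).indicator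
          (fun z => ENNReal.ofReal (|z| ^ (-((1 + θ) / 2)))) κ +
        2 * (ENNReal.ofReal |B * ((κ - m) * (3 * κ - m))| *
          ENNReal.ofReal (jb (μ + B * (κ * (κ - m) ^ 2)) ^ (-r)) +
        ENNReal.ofReal K * (ENNReal.ofReal (cubicMajorant θ κ) +
          ENNReal.ofReal (cubicMajorant θ (κ - m)) +
          ENNReal.ofReal (cubicMajorant θ (κ - m / 3))))) := by
        refine lintegral_mono_ae ?_
        filter_upwards [ae_real_ne 0, ae_real_ne m, ae_real_ne (m / 3)] with κ k0 k1 k2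
        have := h (μ + B * (κ * (κ - m) ^ 2)) m κ k0 k1 (fun hh => k2 (by linarith))
        rwa [neg_div, ← hr] at this
    _ = 3 * I + 2 * ((∫⁻ κ, ENNReal.ofReal |B * ((κ - m) * (3 * κ - m))| *
          ENNReal.ofReal (jb (μ + B * (κ * (κ - m) ^ 2)) ^ (-r))) +
          ENNReal.ofReal K * (H + H + H)) := by
        rw [lintegral_add_left (by fun_prop), lintegral_const_mul _ hmI,
          lintegral_const_mul _ (by fun_prop), lintegral_add_left (by fun_prop),
          lintegral_const_mul _ (by fun_prop), lintegral_add_left (by fun_prop),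
          lintegral_add_left (by fun_prop),
          lintegral_sub_right_eq_self (fun z => ENNReal.ofReal (cubicMajorant θ z)) m,
          lintegral_sub_right_eq_self (fun z => ENNReal.ofReal (cubicMajorant θ z)) (m / 3)]
    _ ≤ _ := by
        gcongr
        refine lintegral_abs_deriv_mul_comp_le (P := fun κ => μ + B * (κ * (κ - m) ^ 2))
          (P' := fun κ => B * ((κ - m) * (3 * κ - m))) (a := m) (b := m / 3)
          (fun x => ?_) (fun x hx => ?_) (fun y => ENNReal.ofReal (jb y ^ (-r)))
        · have h1 := ((hasDerivAt_id x).sub_const m).pow 2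
          have h2 := (((hasDerivAt_id x).mul h1).const_mul B).const_add μ
          refine h2.congr_deriv ?_
          simp only [Pi.pow_apply, id]; push_cast; ring
        · rcases mul_eq_zero.1 hx with h | h
          · exact absurd h hB
          · rcases mul_eq_zero.1 h with h | h
            · left; linarith
            · right; linarith

/-- The resonance function of the cubic nonlinearity. -/
def resonance (α β ξ ξ₁ ξ₃ : ℝ) : ℝ :=
  phase α β ξ - phase α β ξ₁ + phase α β (ξ₁ + ξ₃ - ξ) - phase α β ξ₃

/-- The last factor is `(ξ - ξ₁)(ξ - ξ₃)`; in the form given here the identity can be solved for the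
product `ξ₁ξ₃`. -/
lemma resonance_eq (α β ξ ξ₁ ξ₃ : ℝ) : resonance α β ξ ξ₁ ξ₃ =
    (2 * α + 3 * β * (ξ₁ + ξ₃)) * (ξ₁ * ξ₃ - ξ * (ξ₁ + ξ₃ - ξ)) := by
  unfold resonance phase; ring

@[fun_prop] lemma continuous_phase (α β : ℝ) : Continuous (phase α β) := by
  unfold phase; fun_prop

@[fun_prop] lemma measurable_phase (α β : ℝ) : Measurable (phase α β) :=
  (continuous_phase α β).measurable

/-- Cancellation in `x + y` is harmless because `(|x| + |y|)² ≤ |x + y|² + 4|xy|`. -/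
lemma jb_mul_jb_le (x y : ℝ) : jb x * jb y ≤ 2 * (jb (x + y) + |x * y|) := by
  have h1 : (|x| + |y|) ≤ |x + y| + 1 + |x * y| := by
    have h : (|x| + |y|) ^ 2 ≤ |x + y| ^ 2 + 4 * |x * y| := by
      rw [sq_abs, add_sq, sq_abs, sq_abs, mul_assoc, ← abs_mul]
      rcases abs_cases (x * y) with ⟨h, _⟩ | ⟨h, _⟩ <;> rw [h] <;> nlinarith
    refine abs_le_of_sq_le_sq' (h.trans ?_) (by positivity) |>.2
    nlinarith [abs_nonneg (x + y), abs_nonneg (x * y), sq_nonneg (|x * y| - 1),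
      mul_nonneg (abs_nonneg (x + y)) (abs_nonneg (x * y))]
  have h2 : |x| * |y| = |x * y| := (abs_mul x y).symm
  unfold jb
  nlinarith [abs_nonneg (x + y)]

/-- Let `z = ξ₁ + ξ₃ - ξ`, let `A` be the linear factor of the resonance, and let `lam` be `μ` plus
the resonance. Then `ξ₁ξ₃ = ξz + (lam - μ)/A`, so that large `⟨ξ₁⟩⟨ξ₃⟩` is paid for either by
`⟨ξ⟩⟨z⟩` or by the modulations at the price `1/|A|`. The condition `β ≠ 0` enters through `⟨ξ₁ + ξ₃⟩
≲ 1 + |A|`. -/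
lemma frequency_weight_le (α : ℝ) {β : ℝ} (hβ : β ≠ 0) : ∃ M : ℝ, 0 ≤ M ∧
    ∀ ξ μ ξ₁ ξ₃ : ℝ, 2 * α + 3 * β * (ξ₁ + ξ₃) ≠ 0 →
      jb ξ₁ * jb ξ₃ * jb (ξ₁ + ξ₃ - ξ) / jb ξ ≤ M *
        (jb (ξ₁ + ξ₃ - ξ) ^ 2 + |2 * α + 3 * β * (ξ₁ + ξ₃)|⁻¹) *
          (jb (μ + resonance α β ξ ξ₁ ξ₃) * jb μ) := by
  have hβ' : 0 < |β| := abs_pos.2 hβ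
  set M₀ := 1 + (1 + 2 * |α|) / (3 * |β|) with hM
  have hM0 : 0 ≤ M₀ := by positivity
  refine ⟨4 + 2 * M₀, by positivity, ?_⟩
  intro ξ μ ξ₁ ξ₃ hA
  rw [resonance_eq]
  set A := 2 * α + 3 * β * (ξ₁ + ξ₃) with hAdef
  set k := ξ₁ + ξ₃ with hk
  set z := k - ξ with hz
  set lam := μ + A * (ξ₁ * ξ₃ - ξ * z) with hlam
  have hA0 : 0 < |A| := abs_pos.2 hA
  have hkM : jb k ≤ M₀ * (1 + |A|) := by
    have h1 : 3 * |β| * |k| ≤ |A| + 2 * |α| := by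
      have : 3 * β * k = A - 2 * α := by rw [hAdef]; ring
      calc 3 * |β| * |k| = |3 * β * k| := by rw [abs_mul, abs_mul]; norm_num
        _ ≤ |A| + |2 * α| := by rw [this]; exact abs_sub _ _
        _ = _ := by rw [abs_mul, abs_two]
    have h2 : |k| ≤ (|A| + 2 * |α|) / (3 * |β|) := by
      rw [le_div_iff₀ (by positivity)]; linarith
    have h3 : M₀ * (1 + |A|) = 1 + |A| + (1 + 2 * |α|) * (1 + |A|) / (3 * |β|) := by
      rw [hM]; ring
    have h4 : (|A| + 2 * |α|) / (3 * |β|) ≤ (1 + 2 * |α|) * (1 + |A|) / (3 * |β|) := by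
      gcongr; nlinarith [abs_nonneg α]
    unfold jb; linarith
  have hprod : |ξ₁ * ξ₃| ≤ jb ξ * jb z - 1 - |k| + 1 + |k| + (|lam| + |μ|) * |A|⁻¹ := by
    have e : ξ₁ * ξ₃ = ξ * z + (lam - μ) * A⁻¹ := by rw [hlam]; field_simp; ring
    rw [e]
    refine (abs_add_le _ _).trans ?_
    rw [abs_mul (lam - μ), abs_inv, abs_mul ξ]
    have h1 : |lam - μ| ≤ |lam| + |μ| := abs_sub _ _
    have h2 : |ξ| * |z| ≤ jb ξ * jb z := by
      exact mul_le_mul (abs_le_jb ξ) (abs_le_jb z) (abs_nonneg z) (jb_nonneg ξ)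
    have h3 : |lam - μ| * |A|⁻¹ ≤ (|lam| + |μ|) * |A|⁻¹ := by gcongr
    linarith
  have hkz : jb k ≤ jb ξ * jb z := by
    have := jb_add_le ξ z; rwa [show ξ + z = k by rw [hz]; ring] at this
  have h13 := jb_mul_jb_le ξ₁ ξ₃
  rw [← hk] at h13
  have hlm : |lam| + |μ| ≤ jb lam * jb μ := by
    unfold jb; nlinarith [mul_nonneg (abs_nonneg lam) (abs_nonneg μ)]
  have hjj : 1 ≤ jb lam * jb μ := one_le_mul_of_one_le_of_one_le (one_le_jb _) (one_le_jb _)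
  have hzk : jb z ≤ jb k * jb ξ := jb_sub_le k ξ
  have hz0 := jb_pos z
  have hξ0 := jb_pos ξ
  have hz1 := one_le_jb z
  rw [div_le_iff₀ hξ0]
  have hAi : 0 < |A|⁻¹ := by positivity
  have hAA : |A| * |A|⁻¹ = 1 := mul_inv_cancel₀ hA0.ne'
  set J := jb lam * jb μ with hJ
  have s1 : jb ξ₁ * jb ξ₃ ≤ 4 * (jb ξ * jb z) + 2 * (J * |A|⁻¹) := by
    have : (|lam| + |μ|) * |A|⁻¹ ≤ J * |A|⁻¹ := by gcongr
    linarith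
  have s2 : jb z * |A|⁻¹ ≤ M₀ * (|A|⁻¹ + 1) * jb ξ := by
    calc jb z * |A|⁻¹ ≤ (M₀ * (1 + |A|) * jb ξ) * |A|⁻¹ := by
          gcongr; exact hzk.trans (by gcongr)
      _ = M₀ * (|A|⁻¹ + |A| * |A|⁻¹) * jb ξ := by ring
      _ = _ := by rw [hAA]
  have hz2 : 1 ≤ jb z ^ 2 := one_le_pow₀ hz1
  calc jb ξ₁ * jb ξ₃ * jb z ≤ (4 * (jb ξ * jb z) + 2 * (J * |A|⁻¹)) * jb z := by gcongr
    _ = 4 * jb z ^ 2 * jb ξ * 1 + 2 * J * (jb z * |A|⁻¹) := by ring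
    _ ≤ 4 * jb z ^ 2 * jb ξ * J + 2 * J * (M₀ * (|A|⁻¹ + jb z ^ 2) * jb ξ) := by
        have s3 : jb z * |A|⁻¹ ≤ M₀ * (|A|⁻¹ + jb z ^ 2) * jb ξ := s2.trans (by gcongr)
        exact add_le_add (by gcongr) (mul_le_mul_of_nonneg_left s3 (by linarith))
    _ ≤ (4 * (jb z ^ 2 + |A|⁻¹)) * jb ξ * J + 2 * J * (M₀ * (|A|⁻¹ + jb z ^ 2) * jb ξ) := by
        gcongr
        linarith
    _ = _ := by ring

/-- The power `2ρ` of `frequency_weight_le` brings in `⟨μ⟩^{2ρ}`, which cancels exactly, and the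
power `2ρ` of the other modulation, which lowers its decay from `3/2` to `3/2 - 2ρ`. -/
lemma trilinear_integrand_le {ρ : ℝ} (h0 : 0 < ρ) (α : ℝ) {β : ℝ} (hβ : β ≠ 0) :
    ∃ M : ℝ, 0 ≤ M ∧ ∀ ξ μ ξ₁ ξ₃ : ℝ, 2 * α + 3 * β * (ξ₁ + ξ₃) ≠ 0 →
      (jb ξ₁ * jb ξ₃ * jb (ξ₁ + ξ₃ - ξ) / jb ξ) ^ (2 * ρ) * jb μ ^ (-(2 * ρ)) *
        jb (μ + resonance α β ξ ξ₁ ξ₃) ^ (-(3 / 2) : ℝ) ≤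
      M * ((jb (ξ₁ + ξ₃ - ξ) ^ (4 * ρ) + |2 * α + 3 * β * (ξ₁ + ξ₃)| ^ (-(2 * ρ))) *
        jb (μ + resonance α β ξ ξ₁ ξ₃) ^ (-(3 / 2 - 2 * ρ))) := by
  obtain ⟨M, hM, h⟩ := frequency_weight_le α hβ
  refine ⟨M ^ (2 * ρ) * 2 ^ (2 * ρ), by positivity, fun ξ μ ξ₁ ξ₃ hA => ?_⟩
  have hw := h ξ μ ξ₁ ξ₃ hA
  set A := 2 * α + 3 * β * (ξ₁ + ξ₃)
  set z := jb (ξ₁ + ξ₃ - ξ) with hz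
  set l := jb (μ + resonance α β ξ ξ₁ ξ₃) with hl
  have hz0 : 0 < z := jb_pos _
  have hl0 : 0 < l := jb_pos _
  have hm0 : 0 < jb μ := jb_pos _
  have hA0 : 0 < |A| := abs_pos.2 hA
  have hW0 : 0 ≤ jb ξ₁ * jb ξ₃ * z / jb ξ := by
    have := jb_pos ξ₁; have := jb_pos ξ₃; have := jb_pos ξ; positivity
  have s1 := Real.rpow_le_rpow hW0 hw (show 0 ≤ 2 * ρ by positivity)
  rw [Real.mul_rpow (by positivity) (by positivity), Real.mul_rpow hM (by positivity),
    Real.mul_rpow hl0.le hm0.le] at s1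
  have s2 := add_rpow_le_two_rpow_mul (x := z ^ 2) (y := |A|⁻¹) (r := 2 * ρ) (by positivity)
    (by positivity) (by positivity)
  rw [← Real.rpow_natCast z, ← Real.rpow_mul hz0.le, Real.inv_rpow hA0.le,
    ← Real.rpow_neg hA0.le, show ((2 : ℕ) : ℝ) * (2 * ρ) = 4 * ρ by push_cast; ring] at s2
  rw [← Real.rpow_natCast z] at s1
  have em : jb μ ^ (2 * ρ) * jb μ ^ (-(2 * ρ)) = 1 := by
    rw [← Real.rpow_add hm0]; simp
  have el : l ^ (2 * ρ) * l ^ (-(3 / 2) : ℝ) = l ^ (-(3 / 2 - 2 * ρ)) := by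
    rw [← Real.rpow_add hl0]; ring_nf
  calc _ ≤ (M ^ (2 * ρ) * (2 ^ (2 * ρ) * (z ^ (4 * ρ) + |A| ^ (-(2 * ρ)))) *
        (l ^ (2 * ρ) * jb μ ^ (2 * ρ))) * jb μ ^ (-(2 * ρ)) * l ^ (-(3 / 2) : ℝ) := by
        gcongr
        refine s1.trans ?_
        gcongr
    _ = M ^ (2 * ρ) * 2 ^ (2 * ρ) * (z ^ (4 * ρ) + |A| ^ (-(2 * ρ))) *
        (l ^ (2 * ρ) * l ^ (-(3 / 2) : ℝ)) * (jb μ ^ (2 * ρ) * jb μ ^ (-(2 * ρ))) := by ring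
    _ = _ := by rw [em, el]; ring

/-- In the variable `κ = ξ₁ + ξ₃ + 2α/(3β)` the linear factor of the resonance is `3βκ`; the weight
then has the shape needed for `exists_lintegral_cubic_le` with `θ = 4ρ`. -/
lemma outer_weight_le {ρ : ℝ} (h0 : 0 < ρ) (α : ℝ) {β : ℝ} (hβ : β ≠ 0) :
    ∃ M : ℝ, 0 ≤ M ∧ ∀ ξ κ : ℝ, κ ≠ 0 →
      (jb (κ - 2 * α / (3 * β) - ξ) ^ (4 * ρ) + |3 * β * κ| ^ (-(2 * ρ))) *
        |3 * β * κ| ^ (-(1 / 2) : ℝ) ≤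
      M * (((1 + |κ| + |κ - (2 * α / (3 * β) + 2 * ξ)|) ^ (4 * ρ) + |κ| ^ (-(4 * ρ / 2))) *
        |κ| ^ (-(1 / 2) : ℝ)) := by
  set k₀ := 2 * α / (3 * β) with hk
  have hb : 0 < |3 * β| := abs_pos.2 (by simpa using hβ)
  refine ⟨((1 + |k₀|) ^ (4 * ρ) + |3 * β| ^ (-(2 * ρ))) * |3 * β| ^ (-(1 / 2) : ℝ),
    by positivity, fun ξ κ hκ => ?_⟩
  have hκ0 : 0 < |κ| := abs_pos.2 hκ
  set S := 1 + |κ| + |κ - (k₀ + 2 * ξ)| with hS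
  have hj : jb (κ - k₀ - ξ) ≤ (1 + |k₀|) * S := by
    have e : 2 * (κ - k₀ - ξ) = κ + (κ - (k₀ + 2 * ξ)) - k₀ := by ring
    have h2 : 2 * |κ - k₀ - ξ| ≤ |κ| + |κ - (k₀ + 2 * ξ)| + |k₀| := by
      rw [← abs_two, ← abs_mul, abs_two, e]
      exact (abs_sub _ _).trans (by gcongr; exact abs_add_le _ _)
    have p1 := abs_nonneg κ
    have p2 := abs_nonneg (κ - (k₀ + 2 * ξ))
    have p3 := abs_nonneg k₀
    unfold jb
    rw [hS]
    nlinarith [mul_nonneg p3 p1, mul_nonneg p3 p2]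
  have h1 : jb (κ - k₀ - ξ) ^ (4 * ρ) ≤ (1 + |k₀|) ^ (4 * ρ) * S ^ (4 * ρ) := by
    rw [← Real.mul_rpow (by positivity) (by positivity)]
    exact Real.rpow_le_rpow (jb_nonneg _) hj (by positivity)
  rw [abs_mul (3 * β) κ, Real.mul_rpow hb.le hκ0.le, Real.mul_rpow hb.le hκ0.le,
    show 4 * ρ / 2 = 2 * ρ by ring]
  have pS : 0 ≤ S ^ (4 * ρ) := by positivity
  have pκ : 0 ≤ |κ| ^ (-(2 * ρ)) := by positivity
  have pa : 0 ≤ (1 + |k₀|) ^ (4 * ρ) := by positivity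
  have pb : 0 ≤ |3 * β| ^ (-(2 * ρ)) := by positivity
  calc _ ≤ (((1 + |k₀|) ^ (4 * ρ) + |3 * β| ^ (-(2 * ρ))) * (S ^ (4 * ρ) + |κ| ^ (-(2 * ρ)))) *
        (|3 * β| ^ (-(1 / 2) : ℝ) * |κ| ^ (-(1 / 2) : ℝ)) := by
        gcongr
        nlinarith [mul_nonneg pa pκ, mul_nonneg pb pS]
    _ = _ := by ring

/-- The uniform bound behind the trilinear estimate. -/
theorem exists_lintegral_trilinear_le {ρ : ℝ} (h0 : 0 < ρ) (h1 : ρ < 1 / 4) (α : ℝ) {β : ℝ}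
    (hβ : β ≠ 0) : ∃ C : ℝ≥0∞, C < ∞ ∧ ∀ ξ μ : ℝ, ∫⁻ ξ₁, ∫⁻ ξ₃,
      ENNReal.ofReal ((jb ξ₁ * jb ξ₃ * jb (ξ₁ + ξ₃ - ξ) / jb ξ) ^ (2 * ρ) * jb μ ^ (-(2 * ρ)) *
        jb (μ + resonance α β ξ ξ₁ ξ₃) ^ (-(3 / 2) : ℝ)) ≤ C := by
  obtain ⟨M₁, hM₁, hint⟩ := trilinear_integrand_le h0 α hβ
  obtain ⟨M₂, hM₂, hout⟩ := outer_weight_le h0 α hβ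
  -- The two integral bounds need `3/2 - 2ρ > 1` and `4ρ < 1`; both hold because `ρ < 1/4`.
  obtain ⟨C₁, hC₁, hquad⟩ := exists_lintegral_jb_quadratic_le (c := 3 / 2 - 2 * ρ) (by linarith)
  have hB : 3 * β / 4 ≠ 0 := by simpa using hβ
  obtain ⟨C₂, hC₂, hcub⟩ := exists_lintegral_cubic_le (θ := 4 * ρ) (by linarith) (by linarith) hB
  refine ⟨ENNReal.ofReal M₁ * (C₁ * (ENNReal.ofReal M₂ * C₂)), by finiteness, fun ξ μ => ?_⟩
  set A : ℝ → ℝ := fun k => 2 * α + 3 * β * k with hA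
  set lam : ℝ → ℝ → ℝ := fun k x => μ + A k * (x * (k - x) - ξ * (k - ξ)) with hlam
  set w : ℝ → ℝ := fun k => jb (k - ξ) ^ (4 * ρ) + |A k| ^ (-(2 * ρ)) with hw
  set k₀ := 2 * α / (3 * β) with hk₀
  have hw0 : ∀ k, 0 ≤ w k := fun k => add_nonneg (jb_rpow_nonneg _ _) (by positivity)
  have hAne : ∀ k, k ≠ -k₀ → A k ≠ 0 := by
    intro k hk hAk
    apply hk
    rw [hk₀]; field_simp; simp only [hA] at hAk; linarith
  set H : ℝ → ℝ → ℝ≥0∞ := fun k x =>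
    ENNReal.ofReal (w k) * ENNReal.ofReal (jb (lam k x) ^ (-(3 / 2 - 2 * ρ))) with hH
  have hHm : Measurable (Function.uncurry H) := by
    simp only [hH, hw, hA, hlam, Function.uncurry_def]; fun_prop
  calc _ ≤ ∫⁻ ξ₁, ∫⁻ ξ₃, ENNReal.ofReal M₁ * H (ξ₁ + ξ₃) ξ₁ := by
        refine lintegral_mono fun ξ₁ => lintegral_mono_ae ?_
        filter_upwards [ae_real_ne (-k₀ - ξ₁)] with ξ₃ h3
        have := hint ξ μ ξ₁ ξ₃ (hAne (ξ₁ + ξ₃) (fun h => h3 (by linarith)))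
        simp only [hH]
        rw [← ENNReal.ofReal_mul (hw0 _), ← ENNReal.ofReal_mul hM₁]
        refine ENNReal.ofReal_le_ofReal (this.trans (le_of_eq ?_))
        simp only [hw, hlam, hA, resonance_eq]
        rw [show ξ₁ + ξ₃ - ξ₁ = ξ₃ by ring]
    _ = ENNReal.ofReal M₁ * ∫⁻ ξ₁, ∫⁻ ξ₃, H (ξ₁ + ξ₃) ξ₁ := by
        simp_rw [lintegral_const_mul' _ _ ENNReal.ofReal_ne_top]
    _ = ENNReal.ofReal M₁ * ∫⁻ ξ₁, ∫⁻ k, H k ξ₁ := by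
        congr 1
        refine lintegral_congr fun ξ₁ => ?_
        exact lintegral_add_left_eq_self (fun k => H k ξ₁) ξ₁
    _ = ENNReal.ofReal M₁ * ∫⁻ k, ∫⁻ x, H k x := by
        congr 1
        exact lintegral_lintegral_swap (f := fun x k => H k x)
          (hHm.comp measurable_swap).aemeasurable
    -- For a fixed sum `k` the phase is quadratic in `x`: centred at `k/2` it reads `μ + A(k/2 - ξ)²
    -- - Ax²`.
    _ ≤ ENNReal.ofReal M₁ * ∫⁻ k, ENNReal.ofReal (w k) * (C₁ * ENNReal.ofReal
          (|A k| ^ (-(1 / 2 : ℝ)) * jb (μ + A k * (k / 2 - ξ) ^ 2) ^ (-(1 / 2 : ℝ)))) := by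
        gcongr ENNReal.ofReal M₁ * ?_
        refine lintegral_mono_ae ?_
        filter_upwards [ae_real_ne (-k₀)] with k hk
        simp only [hH]
        rw [lintegral_const_mul' _ _ ENNReal.ofReal_ne_top]
        gcongr ENNReal.ofReal (w k) * ?_
        rw [← lintegral_add_right_eq_self _ (k / 2)]
        refine le_trans (le_of_eq ?_) (hquad (A k) (μ + A k * (k / 2 - ξ) ^ 2) (hAne k hk))
        refine lintegral_congr fun x => ?_
        simp only [hlam]
        congr 3
        ring
    _ = ENNReal.ofReal M₁ * ∫⁻ κ, ENNReal.ofReal (w (κ - k₀)) * (C₁ * ENNReal.ofReal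
          (|A (κ - k₀)| ^ (-(1 / 2 : ℝ)) *
            jb (μ + A (κ - k₀) * ((κ - k₀) / 2 - ξ) ^ 2) ^ (-(1 / 2 : ℝ)))) := by
        congr 1
        exact (lintegral_sub_right_eq_self _ k₀).symm
    -- With `κ = k + k₀` the remaining phase is `μ + (3β/4) κ (κ - m)²` with the double root `m = k₀
    -- + 2ξ`.
    _ ≤ ENNReal.ofReal M₁ * ∫⁻ κ, C₁ * (ENNReal.ofReal M₂ * ENNReal.ofReal
          (((1 + |κ| + |κ - (k₀ + 2 * ξ)|) ^ (4 * ρ) + |κ| ^ (-(4 * ρ / 2))) *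
            |κ| ^ (-(1 / 2) : ℝ) *
            jb (μ + 3 * β / 4 * (κ * (κ - (k₀ + 2 * ξ)) ^ 2)) ^ (-(1 / 2) : ℝ))) := by
        gcongr ENNReal.ofReal M₁ * ?_
        refine lintegral_mono_ae ?_
        filter_upwards [ae_real_ne 0] with κ hκ
        rw [mul_left_comm, ← ENNReal.ofReal_mul (hw0 _), ← ENNReal.ofReal_mul hM₂]
        gcongr C₁ * ENNReal.ofReal ?_
        have hAκ : A (κ - k₀) = 3 * β * κ := by
          simp only [hA, hk₀]; field_simp; ring
        have hsq : A (κ - k₀) * ((κ - k₀) / 2 - ξ) ^ 2 =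
            3 * β / 4 * (κ * (κ - (k₀ + 2 * ξ)) ^ 2) := by rw [hAκ]; ring
        rw [hsq]
        simp only [hw]
        rw [hAκ]
        have hJ := jb_rpow_nonneg (μ + 3 * β / 4 * (κ * (κ - (k₀ + 2 * ξ)) ^ 2)) (-(1 / 2) : ℝ)
        set J := jb (μ + 3 * β / 4 * (κ * (κ - (k₀ + 2 * ξ)) ^ 2)) ^ (-(1 / 2) : ℝ)
        exact le_trans (le_of_eq (by ring)) ((mul_le_mul_of_nonneg_right (hout ξ κ hκ) hJ).trans
          (le_of_eq (by ring)))
    _ ≤ _ := by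
        rw [lintegral_const_mul' _ _ hC₁.ne, lintegral_const_mul' _ _ ENNReal.ofReal_ne_top]
        gcongr
        exact hcub μ _

end

/-! ### The trilinear estimate -/

section

lemma sq_lintegral_mul_le {X : Type*} [MeasurableSpace X] {μ : Measure X} {f g : X → ℝ≥0∞}
    (hf : AEMeasurable f μ) (hg : AEMeasurable g μ) :
    (∫⁻ x, f x * g x ∂μ) ^ 2 ≤ (∫⁻ x, f x ^ 2 ∂μ) * ∫⁻ x, g x ^ 2 ∂μ := by
  have h := ENNReal.lintegral_mul_le_Lp_mul_Lq μ Real.HolderConjugate.two_two hf hg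
  have h2 := pow_le_pow_left' h 2
  refine h2.trans (le_of_eq ?_)
  rw [mul_pow, ← ENNReal.rpow_natCast, ← ENNReal.rpow_natCast, ← ENNReal.rpow_mul,
    ← ENNReal.rpow_mul]
  norm_num

/-- The Gevrey weight `e^{σ|ξ|} ⟨ξ⟩^s`. -/
def gw (σ s ξ : ℝ) : ℝ := Real.exp (σ * |ξ|) * jb ξ ^ s

lemma gw_pos (σ s ξ : ℝ) : 0 < gw σ s ξ := mul_pos (Real.exp_pos _) (jb_rpow_pos _ _)

@[fun_prop] lemma measurable_gw (σ s : ℝ) : Measurable (gw σ s) := by unfold gw; fun_prop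

/-- The exponentials obey the inequality without loss by the triangle inequality. Since `s + ρ ≥ 0`,
the power `⟨ξ⟩^{s+ρ}` is at most the product of the same powers of the inputs; dividing by `⟨ξ⟩^ρ`
leaves the stated loss. -/
lemma gw_le {σ s ρ : ℝ} (hσ : 0 ≤ σ) (hs : -ρ ≤ s) (ξ ξ₁ ξ₃ : ℝ) :
    gw σ s ξ ≤ gw σ s ξ₁ * gw σ s (ξ₁ + ξ₃ - ξ) * gw σ s ξ₃ *
      (jb ξ₁ * jb ξ₃ * jb (ξ₁ + ξ₃ - ξ) / jb ξ) ^ ρ := by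
  set ξ₂ := ξ₁ + ξ₃ - ξ with h2
  have e : ξ = ξ₁ - ξ₂ + ξ₃ := by rw [h2]; ring
  have habs : |ξ| ≤ |ξ₁| + |ξ₂| + |ξ₃| := by
    rw [e]; exact (abs_add_le _ _).trans (by gcongr; exact abs_sub _ _)
  have hjb : jb ξ ≤ jb ξ₁ * jb ξ₃ * jb ξ₂ := by
    calc jb ξ ≤ jb ξ₁ * jb ξ₂ * jb ξ₃ := by
          rw [e]; exact (jb_add_le _ _).trans
            (mul_le_mul_of_nonneg_right (jb_sub_le _ _) (jb_nonneg _))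
      _ = _ := by ring
  have p1 := jb_pos ξ₁
  have p2 := jb_pos ξ₂
  have p3 := jb_pos ξ₃
  have p := jb_pos ξ
  have h3 := Real.rpow_le_rpow p.le hjb (show 0 ≤ s + ρ by linarith)
  have hexp : Real.exp (σ * |ξ|) ≤
      Real.exp (σ * |ξ₁|) * Real.exp (σ * |ξ₂|) * Real.exp (σ * |ξ₃|) := by
    rw [← Real.exp_add, ← Real.exp_add]
    refine Real.exp_le_exp.2 ?_
    nlinarith
  have hj : jb ξ ^ s ≤ jb ξ₁ ^ s * jb ξ₂ ^ s * jb ξ₃ ^ s *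
      (jb ξ₁ * jb ξ₃ * jb ξ₂ / jb ξ) ^ ρ := by
    rw [Real.div_rpow (by positivity) p.le, ← mul_div_assoc, le_div_iff₀ (jb_rpow_pos _ _),
      ← Real.rpow_add p]
    refine h3.trans (le_of_eq ?_)
    rw [Real.rpow_add (by positivity)]
    congr 1
    rw [Real.mul_rpow (by positivity) p2.le, Real.mul_rpow p1.le p3.le]; ring
  unfold gw
  calc _ ≤ (Real.exp (σ * |ξ₁|) * Real.exp (σ * |ξ₂|) * Real.exp (σ * |ξ₃|)) *
        (jb ξ₁ ^ s * jb ξ₂ ^ s * jb ξ₃ ^ s * (jb ξ₁ * jb ξ₃ * jb ξ₂ / jb ξ) ^ ρ) :=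
        mul_le_mul hexp hj (jb_rpow_nonneg _ _) (by positivity)
    _ = _ := by ring

/-- The space-time frequency of the conjugated factor in the cubic nonlinearity, in terms of the
output `q` and the two other inputs `z`. -/
def shp (α β : ℝ) (q : ℝ × ℝ) (z : (ℝ × ℝ) × (ℝ × ℝ)) : ℝ × ℝ :=
  (z.1.1 + z.2.1 - q.1, z.1.2 + z.2.2 - q.2 - resonance α β q.1 z.1.1 z.2.1)

lemma continuous_shp (α β : ℝ) : Continuous (Function.uncurry (shp α β)) := by
  unfold shp resonance Function.uncurry; fun_prop

@[fun_prop] lemma measurable_shp (α β : ℝ) : Measurable (Function.uncurry (shp α β)) :=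
  (continuous_shp α β).measurable

/-- A reflection in the space frequency combined, on each fibre, with a reflection in the time
frequency. -/
lemma measurePreserving_shp (α β : ℝ) (z : (ℝ × ℝ) × (ℝ × ℝ)) :
    MeasurePreserving (fun q : ℝ × ℝ => shp α β q z) volume volume := by
  have h := (Measure.measurePreserving_sub_left (volume : Measure ℝ) (z.1.1 + z.2.1)).skew_product
    (μc := (volume : Measure ℝ)) (μd := (volume : Measure ℝ))
    (g := fun ξ τ => z.1.2 + z.2.2 - τ - resonance α β ξ z.1.1 z.2.1)
    (by unfold resonance; fun_prop) (ae_of_all _ fun ξ => by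
      have := (Measure.measurePreserving_sub_left (volume : Measure ℝ)
        (z.1.2 + z.2.2 - resonance α β ξ z.1.1 z.2.1)).map_eq
      convert! this using 3 with τ
      ring)
  exact h

lemma lintegral_comp_shp (α β : ℝ) (z : (ℝ × ℝ) × (ℝ × ℝ)) {f : ℝ × ℝ → ℝ≥0∞}
    (hf : Measurable f) : ∫⁻ q, f (shp α β q z) = ∫⁻ q, f q :=
  (measurePreserving_shp α β z).lintegral_comp hf

/-- The product of three functions at interacting frequencies. -/
def tri (α β : ℝ) (f₁ f₂ f₃ : ℝ × ℝ → ℝ≥0∞) (q : ℝ × ℝ) (z : (ℝ × ℝ) × (ℝ × ℝ)) : ℝ≥0∞ :=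
  f₁ z.1 * f₂ (shp α β q z) * f₃ z.2

lemma measurable_tri (α β : ℝ) {f₁ f₂ f₃ : ℝ × ℝ → ℝ≥0∞} (h₁ : Measurable f₁)
    (h₂ : Measurable f₂) (h₃ : Measurable f₃) :
    Measurable (Function.uncurry (tri α β f₁ f₂ f₃)) := by
  have := measurable_shp α β
  unfold tri Function.uncurry at *
  fun_prop

lemma lintegral_prod_mul_eq {f g : ℝ × ℝ → ℝ≥0∞} (hf : Measurable f) (hg : Measurable g) :
    ∫⁻ z : (ℝ × ℝ) × (ℝ × ℝ), f z.1 * g z.2 = (∫⁻ p, f p) * ∫⁻ p, g p :=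
  lintegral_prod_mul hf.aemeasurable hg.aemeasurable

/-- Integrating the product over all interacting frequencies. -/
lemma lintegral_tri (α β : ℝ) {f₁ f₂ f₃ : ℝ × ℝ → ℝ≥0∞} (h₁ : Measurable f₁)
    (h₂ : Measurable f₂) (h₃ : Measurable f₃) :
    ∫⁻ q, ∫⁻ z, tri α β f₁ f₂ f₃ q z = (∫⁻ p, f₁ p) * (∫⁻ p, f₂ p) * ∫⁻ p, f₃ p := by
  rw [lintegral_lintegral_swap (measurable_tri α β h₁ h₂ h₃).aemeasurable]
  have : ∀ z, ∫⁻ q, tri α β f₁ f₂ f₃ q z = (∫⁻ p, f₂ p) * (f₁ z.1 * f₃ z.2) := by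
    intro z
    unfold tri
    have hm : Measurable (fun q => f₂ (shp α β q z)) :=
      h₂.comp (measurePreserving_shp α β z).measurable
    rw [lintegral_mul_const _ (by fun_prop), lintegral_const_mul _ hm, lintegral_comp_shp α β z h₂]
    ring
  simp_rw [this]
  rw [lintegral_const_mul _ (by fun_prop), lintegral_prod_mul_eq h₁ h₃]
  ring

/-- The weight of the space `Z^{σ,s,3/4}` in the variables `(ξ, τ - φ(ξ))`. -/
def wt (σ s : ℝ) (p : ℝ × ℝ) : ℝ := gw σ s p.1 * jb p.2 ^ (3 / 4 : ℝ)

lemma wt_pos (σ s : ℝ) (p : ℝ × ℝ) : 0 < wt σ s p := mul_pos (gw_pos _ _ _) (jb_rpow_pos _ _)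

@[fun_prop] lemma measurable_wt (σ s : ℝ) : Measurable (wt σ s) := by unfold wt; fun_prop

/-- The kernel left after dividing by the weights. -/
def triKernel (α β ρ : ℝ) (q : ℝ × ℝ) (z : (ℝ × ℝ) × (ℝ × ℝ)) : ℝ :=
  (jb z.1.1 * jb z.2.1 * jb (z.1.1 + z.2.1 - q.1) / jb q.1) ^ ρ * jb q.2 ^ (-ρ) *
    (jb z.1.2 ^ (-(3 / 4) : ℝ) * jb z.2.2 ^ (-(3 / 4) : ℝ) *
      jb (z.1.2 + z.2.2 - q.2 - resonance α β q.1 z.1.1 z.2.1) ^ (-(3 / 4) : ℝ))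

lemma triKernel_nonneg (α β ρ : ℝ) (q z) : 0 ≤ triKernel α β ρ q z := by
  unfold triKernel
  have h := fun x => jb_pos x
  have h' := fun x r => jb_rpow_pos x r
  have := h z.1.1; have := h z.2.1; have := h (z.1.1 + z.2.1 - q.1); have := h q.1
  have := h' q.2 (-ρ); have := h' z.1.2 (-(3 / 4) : ℝ); have := h' z.2.2 (-(3 / 4) : ℝ)
  have := h' (z.1.2 + z.2.2 - q.2 - resonance α β q.1 z.1.1 z.2.1) (-(3 / 4) : ℝ)
  positivity

lemma measurable_triKernel (α β ρ : ℝ) : Measurable (Function.uncurry (triKernel α β ρ)) := by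
  unfold triKernel resonance Function.uncurry; fun_prop

/-- The factors `⟨·⟩^{3/4}` in `wt` cancel the powers `-3/4` in the kernel, and `gw_le` remains. -/
lemma gw_mul_tri_le {σ s ρ : ℝ} (hσ : 0 ≤ σ) (hs : -ρ ≤ s) (α β : ℝ)
    (f₁ f₂ f₃ : ℝ × ℝ → ℝ≥0∞) (q : ℝ × ℝ) (z : (ℝ × ℝ) × (ℝ × ℝ)) :
    ENNReal.ofReal (gw σ s q.1 * jb q.2 ^ (-ρ)) * tri α β f₁ f₂ f₃ q z ≤
      ENNReal.ofReal (triKernel α β ρ q z) * tri α β (fun p => ENNReal.ofReal (wt σ s p) * f₁ p)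
        (fun p => ENNReal.ofReal (wt σ s p) * f₂ p) (fun p => ENNReal.ofReal (wt σ s p) * f₃ p)
        q z := by
  have hg := gw_le (σ := σ) hσ hs q.1 z.1.1 z.2.1
  have e : ENNReal.ofReal (triKernel α β ρ q z) *
      tri α β (fun p => ENNReal.ofReal (wt σ s p) * f₁ p)
        (fun p => ENNReal.ofReal (wt σ s p) * f₂ p) (fun p => ENNReal.ofReal (wt σ s p) * f₃ p)
        q z = ENNReal.ofReal (triKernel α β ρ q z * (wt σ s z.1 * wt σ s (shp α β q z) *
          wt σ s z.2)) * tri α β f₁ f₂ f₃ q z := by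
    rw [ENNReal.ofReal_mul (triKernel_nonneg _ _ _ _ _), ENNReal.ofReal_mul
      (mul_nonneg (wt_pos _ _ _).le (wt_pos _ _ _).le), ENNReal.ofReal_mul (wt_pos _ _ _).le]
    unfold tri; ring
  rw [e]
  gcongr ENNReal.ofReal ?_ * _
  have c : ∀ x : ℝ, jb x ^ (-(3 / 4) : ℝ) * jb x ^ (3 / 4 : ℝ) = 1 := fun x => by
    rw [← Real.rpow_add (jb_pos x)]; simp
  have e2 : triKernel α β ρ q z * (wt σ s z.1 * wt σ s (shp α β q z) * wt σ s z.2) =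
      (gw σ s z.1.1 * gw σ s (z.1.1 + z.2.1 - q.1) * gw σ s z.2.1 *
      (jb z.1.1 * jb z.2.1 * jb (z.1.1 + z.2.1 - q.1) / jb q.1) ^ ρ) * jb q.2 ^ (-ρ) *
      ((jb z.1.2 ^ (-(3 / 4) : ℝ) * jb z.1.2 ^ (3 / 4 : ℝ)) *
        (jb z.2.2 ^ (-(3 / 4) : ℝ) * jb z.2.2 ^ (3 / 4 : ℝ)) *
        (jb (shp α β q z).2 ^ (-(3 / 4) : ℝ) * jb (shp α β q z).2 ^ (3 / 4 : ℝ))) := by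
    unfold triKernel wt shp; ring
  rw [e2, c, c, c]
  simp only [mul_one]
  exact mul_le_mul_of_nonneg_right hg (jb_rpow_nonneg _ _)

/-- Two convolution bounds integrate out the input time frequencies and leave the bracket of `q.2`
plus the resonance to the power `-3/2`. The rest is `exists_lintegral_trilinear_le` with `μ = q.2`.
-/
lemma exists_lintegral_triKernel_sq_le {ρ : ℝ} (h0 : 0 < ρ) (h1 : ρ < 1 / 4) (α : ℝ) {β : ℝ}
    (hβ : β ≠ 0) : ∃ C : ℝ≥0∞, C < ∞ ∧ ∀ q,
      ∫⁻ z, ENNReal.ofReal (triKernel α β ρ q z) ^ 2 ≤ C := by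
  obtain ⟨C, hC, h⟩ := exists_lintegral_trilinear_le h0 h1 α hβ
  set D := ENNReal.ofReal (2 ^ (3 / 2 : ℝ)) * (jbInt (3 / 2) + jbInt (3 / 2)) with hD
  have hDlt : D < ∞ := by
    have := jbInt_lt_top (show (1 : ℝ) < 3 / 2 by norm_num)
    rw [hD]; finiteness
  refine ⟨D * D * C, by finiteness, fun q => ?_⟩
  set lam : ℝ → ℝ → ℝ := fun ξ₁ ξ₃ => q.2 + resonance α β q.1 ξ₁ ξ₃ with hlam
  set V : ℝ → ℝ → ℝ := fun ξ₁ ξ₃ =>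
    (jb ξ₁ * jb ξ₃ * jb (ξ₁ + ξ₃ - q.1) / jb q.1) ^ (2 * ρ) * jb q.2 ^ (-(2 * ρ)) with hV
  have hV0 : ∀ x y, 0 ≤ V x y := by
    intro x y
    have := jb_pos x; have := jb_pos y; have := jb_pos (x + y - q.1); have := jb_pos q.1
    have := jb_rpow_pos q.2 (-(2 * ρ))
    simp only [hV]; positivity
  have esq : ∀ z, ENNReal.ofReal (triKernel α β ρ q z) ^ 2 = ENNReal.ofReal (V z.1.1 z.2.1) *
      (ENNReal.ofReal (jb z.1.2 ^ (-(3 / 2) : ℝ)) * ENNReal.ofReal (jb z.2.2 ^ (-(3 / 2) : ℝ) *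
        jb (lam z.1.1 z.2.1 - z.1.2 - z.2.2) ^ (-(3 / 2) : ℝ))) := by
    intro z
    have hsq : ∀ x : ℝ, (jb x ^ (-(3 / 4) : ℝ)) ^ 2 = jb x ^ (-(3 / 2) : ℝ) := fun x => by
      rw [← Real.rpow_natCast, ← Real.rpow_mul (jb_nonneg x)]; norm_num
    have hsq2 : ∀ (x : ℝ), 0 ≤ x → ∀ r : ℝ, (x ^ r) ^ 2 = x ^ (2 * r) := fun x hx r => by
      rw [← Real.rpow_natCast, ← Real.rpow_mul hx]; ring_nf
    rw [← ENNReal.ofReal_pow (triKernel_nonneg _ _ _ _ _),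
      ← ENNReal.ofReal_mul (jb_rpow_nonneg _ _), ← ENNReal.ofReal_mul (hV0 _ _)]
    congr 1
    unfold triKernel
    rw [mul_pow, mul_pow, mul_pow, mul_pow, hsq, hsq, hsq, hsq2 _ (jb_nonneg _), hsq2]
    · rw [show z.1.2 + z.2.2 - q.2 - resonance α β q.1 z.1.1 z.2.1 =
        -(lam z.1.1 z.2.1 - z.1.2 - z.2.2) by simp only [hlam]; ring, jb_neg]
      simp only [hV]
      rw [mul_neg]; ring
    · have := jb_pos z.1.1; have := jb_pos z.2.1; have := jb_pos (z.1.1 + z.2.1 - q.1)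
      have := jb_pos q.1; positivity
  have hlm : Measurable (Function.uncurry lam) := by
    simp only [hlam, Function.uncurry_def]; unfold resonance; fun_prop
  have hVm : Measurable (Function.uncurry V) := by
    simp only [hV, Function.uncurry_def]; fun_prop
  have hτ : ∀ y : ℝ, ∫⁻ τ₁, ∫⁻ τ₃, (ENNReal.ofReal (jb τ₁ ^ (-(3 / 2) : ℝ)) *
      ENNReal.ofReal (jb τ₃ ^ (-(3 / 2) : ℝ) * jb (y - τ₁ - τ₃) ^ (-(3 / 2) : ℝ))) ≤
      D * D * ENNReal.ofReal (jb y ^ (-(3 / 2) : ℝ)) := by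
    intro y
    calc _ ≤ ∫⁻ τ₁, D * ENNReal.ofReal (jb τ₁ ^ (-(3 / 2) : ℝ) *
          jb (y - τ₁) ^ (-(3 / 2) : ℝ)) := by
          refine lintegral_mono fun τ₁ => ?_
          simp only
          rw [lintegral_const_mul' _ _ ENNReal.ofReal_ne_top,
            ENNReal.ofReal_mul (jb_rpow_nonneg _ _), mul_left_comm]
          exact mul_le_mul' le_rfl (lintegral_jb_mul_jb_le (r := 3 / 2) (by norm_num) _)
      _ ≤ _ := by
          rw [lintegral_const_mul' _ _ hDlt.ne, mul_assoc D D]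
          exact mul_le_mul' le_rfl (lintegral_jb_mul_jb_le (r := 3 / 2) (by norm_num) _)
  simp_rw [esq]
  have m1 : Measurable (fun z : (ℝ × ℝ) × (ℝ × ℝ) => ENNReal.ofReal (V z.1.1 z.2.1) *
      (ENNReal.ofReal (jb z.1.2 ^ (-(3 / 2) : ℝ)) * ENNReal.ofReal (jb z.2.2 ^ (-(3 / 2) : ℝ) *
        jb (lam z.1.1 z.2.1 - z.1.2 - z.2.2) ^ (-(3 / 2) : ℝ)))) := by
    simp only [hV, hlam]; unfold resonance; fun_prop
  calc _ = ∫⁻ ξ₁, ∫⁻ τ₁, ∫⁻ ξ₃, ∫⁻ τ₃, ENNReal.ofReal (V ξ₁ ξ₃) *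
      (ENNReal.ofReal (jb τ₁ ^ (-(3 / 2) : ℝ)) * ENNReal.ofReal (jb τ₃ ^ (-(3 / 2) : ℝ) *
        jb (lam ξ₁ ξ₃ - τ₁ - τ₃) ^ (-(3 / 2) : ℝ))) := by
        rw [Measure.volume_eq_prod, lintegral_prod _ m1.aemeasurable, Measure.volume_eq_prod,
          lintegral_prod _ (m1.lintegral_prod_right').aemeasurable]
        refine lintegral_congr fun ξ₁ => lintegral_congr fun τ₁ => ?_
        rw [lintegral_prod]
        exact (m1.comp (measurable_prodMk_left (x := (ξ₁, τ₁)))).aemeasurable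
    _ = ∫⁻ ξ₁, ∫⁻ ξ₃, ∫⁻ τ₁, ∫⁻ τ₃, ENNReal.ofReal (V ξ₁ ξ₃) *
      (ENNReal.ofReal (jb τ₁ ^ (-(3 / 2) : ℝ)) * ENNReal.ofReal (jb τ₃ ^ (-(3 / 2) : ℝ) *
        jb (lam ξ₁ ξ₃ - τ₁ - τ₃) ^ (-(3 / 2) : ℝ))) := by
        refine lintegral_congr fun ξ₁ => ?_
        rw [lintegral_lintegral_swap]
        refine Measurable.aemeasurable ?_
        refine Measurable.lintegral_prod_right' (f := fun p : (ℝ × ℝ) × ℝ =>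
          ENNReal.ofReal (V ξ₁ p.1.2) * (ENNReal.ofReal (jb p.1.1 ^ (-(3 / 2) : ℝ)) *
          ENNReal.ofReal (jb p.2 ^ (-(3 / 2) : ℝ) *
          jb (lam ξ₁ p.1.2 - p.1.1 - p.2) ^ (-(3 / 2) : ℝ)))) ?_
        simp only [hV, hlam]; unfold resonance; fun_prop
    _ ≤ ∫⁻ ξ₁, ∫⁻ ξ₃, D * D * ENNReal.ofReal (V ξ₁ ξ₃ * jb (lam ξ₁ ξ₃) ^ (-(3 / 2) : ℝ)) := by
        refine lintegral_mono fun ξ₁ => lintegral_mono fun ξ₃ => ?_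
        simp_rw [lintegral_const_mul' _ _ (ENNReal.ofReal_ne_top (r := V ξ₁ ξ₃))]
        rw [ENNReal.ofReal_mul (hV0 _ _), mul_left_comm]
        gcongr
        exact hτ _
    _ ≤ _ := by
        simp_rw [lintegral_const_mul' _ _ (show D * D ≠ ∞ by finiteness)]
        gcongr
        exact h q.1 q.2

/-- Cauchy-Schwarz over the interacting frequencies separates the kernel, whose `L²` norm is bounded
uniformly in `q`, from the weighted functions, whose squares integrate in `q` to a product by
`lintegral_tri`. -/
lemma sq_lintegral_tri_le {σ s ρ : ℝ} (hσ : 0 ≤ σ) (hs : -ρ ≤ s) (α β : ℝ)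
    {f₁ f₂ f₃ : ℝ × ℝ → ℝ≥0∞} (m₁ : Measurable f₁) (m₂ : Measurable f₂) (m₃ : Measurable f₃)
    (q : ℝ × ℝ) :
    (ENNReal.ofReal (gw σ s q.1 * jb q.2 ^ (-ρ)) * ∫⁻ z, tri α β f₁ f₂ f₃ q z) ^ 2 ≤
      (∫⁻ z, ENNReal.ofReal (triKernel α β ρ q z) ^ 2) *
        ∫⁻ z, tri α β (fun p => (ENNReal.ofReal (wt σ s p) * f₁ p) ^ 2)
          (fun p => (ENNReal.ofReal (wt σ s p) * f₂ p) ^ 2)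
          (fun p => (ENNReal.ofReal (wt σ s p) * f₃ p) ^ 2) q z := by
  have mt := ((measurable_tri α β (f₁ := fun p => ENNReal.ofReal (wt σ s p) * f₁ p)
    (f₂ := fun p => ENNReal.ofReal (wt σ s p) * f₂ p)
    (f₃ := fun p => ENNReal.ofReal (wt σ s p) * f₃ p) (by fun_prop) (by fun_prop)
    (by fun_prop)).comp (measurable_prodMk_left (x := q)))
  have mk : Measurable (fun z => ENNReal.ofReal (triKernel α β ρ q z)) :=
    ((measurable_triKernel α β ρ).comp measurable_prodMk_left).ennreal_ofReal
  rw [← lintegral_const_mul' _ _ ENNReal.ofReal_ne_top]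
  refine (pow_le_pow_left' (lintegral_mono fun z =>
    gw_mul_tri_le hσ hs α β f₁ f₂ f₃ q z) 2).trans ?_
  refine (sq_lintegral_mul_le mk.aemeasurable mt.aemeasurable).trans (le_of_eq ?_)
  congr 1
  refine lintegral_congr fun z => ?_
  simp only [tri, mul_pow, Function.comp, Function.uncurry]

/-- The trilinear estimate. -/
theorem exists_trilinear_le {ρ : ℝ} (h0 : 0 < ρ) (h1 : ρ < 1 / 4) (α : ℝ) {β : ℝ}
    (hβ : β ≠ 0) : ∃ C : ℝ≥0∞, C < ∞ ∧ ∀ σ s : ℝ, 0 ≤ σ → -ρ ≤ s →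
      ∀ f₁ f₂ f₃ : ℝ × ℝ → ℝ≥0∞, Measurable f₁ → Measurable f₂ → Measurable f₃ →
      ∫⁻ q : ℝ × ℝ, (ENNReal.ofReal (gw σ s q.1 * jb q.2 ^ (-ρ)) *
        ∫⁻ z, tri α β f₁ f₂ f₃ q z) ^ 2 ≤
      C * ((∫⁻ p, (ENNReal.ofReal (wt σ s p) * f₁ p) ^ 2) *
        (∫⁻ p, (ENNReal.ofReal (wt σ s p) * f₂ p) ^ 2) *
        ∫⁻ p, (ENNReal.ofReal (wt σ s p) * f₃ p) ^ 2) := by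
  obtain ⟨C, hC, h⟩ := exists_lintegral_triKernel_sq_le h0 h1 α hβ
  refine ⟨C, hC, fun σ s hσ hs f₁ f₂ f₃ m₁ m₂ m₃ => ?_⟩
  rw [← lintegral_tri α β (by fun_prop) (by fun_prop) (by fun_prop),
    ← lintegral_const_mul' _ _ hC.ne]
  exact lintegral_mono fun q =>
    (sq_lintegral_tri_le hσ hs α β m₁ m₂ m₃ q).trans (mul_le_mul' (h q) le_rfl)

end

/-! ### The time cutoff and the Duhamel estimate -/

section

lemma exists_contDiff_cutoff : ∃ f : ℝ → ℝ, HasCompactSupport f ∧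
    ContDiff ℝ ((⊤ : ℕ∞) : WithTop ℕ∞) f ∧ ∀ t : ℝ, |t| ≤ 1 → f t = 1 := by
  let f : ContDiffBump (0 : ℝ) := ⟨1, 2, by norm_num, by norm_num⟩
  exact ⟨f, f.hasCompactSupport, f.contDiff,
    fun t ht => f.one_of_mem_closedBall (by simpa [f] using ht)⟩

open SchwartzMap in
lemma exists_schwartz_coe_eq {f : ℝ → ℂ} (hc : HasCompactSupport f)
    (hd : ContDiff ℝ ((⊤ : ℕ∞) : WithTop ℕ∞) f) : ∃ ψ : 𝓢(ℝ, ℂ), ⇑ψ = f :=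
  ⟨hc.toSchwartzMap hd, rfl⟩

open SchwartzMap in
lemma exists_schwartz_fourierInv_eq_one : ∃ g : 𝓢(ℝ, ℂ), ∀ t : ℝ, |t| ≤ 1 →
    𝓕⁻ (g : ℝ → ℂ) t = 1 := by
  obtain ⟨f, hfs, hfc, hf1⟩ := exists_contDiff_cutoff
  obtain ⟨ψ, hψ⟩ := exists_schwartz_coe_eq (f := fun x => (f x : ℂ))
    (HasCompactSupport.comp_left (g := fun x : ℝ => (x : ℂ)) hfs Complex.ofReal_zero)
    (Complex.ofRealCLM.contDiff.comp hfc)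
  refine ⟨𝓕 ψ, fun t ht => ?_⟩
  rw [← SchwartzMap.fourierInv_coe, FourierTransform.fourierInv_fourier_eq, hψ]
  simp [hf1 t ht]

open SchwartzMap in
-- A Schwartz function with inverse transform `1` on `[-1, 1]`, rescaled by `2π` to pass to the
-- character `e^{itτ}`. Of its rapid decay only order four is recorded, for it and its derivative,
-- which is all that the kernel bounds use.
lemma exists_cutoff : ∃ Ψ : ℝ → ℂ, Differentiable ℝ Ψ ∧ ∃ C : ℝ, 0 ≤ C ∧
    (∀ x, ‖Ψ x‖ ≤ C * jb x ^ (-4 : ℝ)) ∧ (∀ x, ‖deriv Ψ x‖ ≤ C * jb x ^ (-4 : ℝ)) ∧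
    ∀ t : ℝ, |t| ≤ 1 → ∫ τ : ℝ, Complex.exp (Complex.I * (t * τ)) * Ψ τ = 1 := by
  obtain ⟨g, hg⟩ := exists_schwartz_fourierInv_eq_one
  have hπ : 0 < 2 * Real.pi := by positivity
  have hsm := g.differentiable
  have hd : ∀ x, HasDerivAt (fun τ : ℝ => ((2 * Real.pi)⁻¹ : ℂ) * g (τ / (2 * Real.pi)))
      (((2 * Real.pi)⁻¹ : ℂ) * ((2 * Real.pi)⁻¹ * deriv g (x / (2 * Real.pi)))) x := by
    intro x
    have h1 : HasDerivAt (fun τ : ℝ => τ / (2 * Real.pi)) ((2 * Real.pi)⁻¹) x := by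
      simpa using (hasDerivAt_id x).div_const (2 * Real.pi)
    have h2 := ((hsm (x / (2 * Real.pi))).hasDerivAt.scomp x h1).const_mul
      ((2 * Real.pi)⁻¹ : ℂ)
    simpa using h2
  have hbound : ∀ n : ℕ, ∃ C : ℝ, 0 ≤ C ∧ ∀ x, ‖iteratedFDeriv ℝ n g (x / (2 * Real.pi))‖ ≤
      C * jb x ^ (-4 : ℝ) := by
    intro n
    refine ⟨(2 * Real.pi) ^ 4 * (2 ^ 4 *
      (Finset.Iic (4, n)).sup (fun m => SchwartzMap.seminorm ℝ m.1 m.2) g), by positivity, ?_⟩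
    intro x
    have h := SchwartzMap.one_add_le_sup_seminorm_apply (𝕜 := ℝ) (m := (4, n)) (k := 4) (n := n)
      le_rfl le_rfl g (x / (2 * Real.pi))
    have hj : jb x ≤ 2 * Real.pi * (1 + ‖x / (2 * Real.pi)‖) := by
      have : 1 ≤ 2 * Real.pi := by linarith [Real.pi_gt_three]
      rw [Real.norm_eq_abs, abs_div, abs_of_pos hπ, mul_add, mul_div_cancel₀ _ hπ.ne']
      unfold jb; linarith
    have hj4 : jb x ^ 4 ≤ (2 * Real.pi) ^ 4 * (1 + ‖x / (2 * Real.pi)‖) ^ 4 := by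
      rw [← mul_pow]; exact pow_le_pow_left₀ (jb_nonneg x) hj 4
    rw [Real.rpow_neg (jb_nonneg x), show (4 : ℝ) = ((4 : ℕ) : ℝ) by norm_num, Real.rpow_natCast,
      ← div_eq_mul_inv, le_div_iff₀ (pow_pos (jb_pos x) 4)]
    calc _ ≤ ‖iteratedFDeriv ℝ n g (x / (2 * Real.pi))‖ *
          ((2 * Real.pi) ^ 4 * (1 + ‖x / (2 * Real.pi)‖) ^ 4) := by gcongr
      _ = (2 * Real.pi) ^ 4 * ((1 + ‖x / (2 * Real.pi)‖) ^ 4 *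
          ‖iteratedFDeriv ℝ n g (x / (2 * Real.pi))‖) := by ring
      _ ≤ _ := by gcongr
  obtain ⟨C₀, hC₀, hb0⟩ := hbound 0
  obtain ⟨C₁, hC₁, hb1⟩ := hbound 1
  have hinv : ‖((2 * Real.pi)⁻¹ : ℂ)‖ ≤ 1 := by
    rw [norm_inv]
    apply inv_le_one_of_one_le₀
    rw [norm_mul, Complex.norm_real, Real.norm_of_nonneg Real.pi_pos.le]
    norm_num; linarith [Real.pi_gt_three]
  refine ⟨fun τ => ((2 * Real.pi)⁻¹ : ℂ) * g (τ / (2 * Real.pi)),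
    fun x => (hd x).differentiableAt, C₀ + C₁, by positivity, fun x => ?_, fun x => ?_, ?_⟩
  · have h := hb0 x
    rw [norm_iteratedFDeriv_zero] at h
    rw [norm_mul]
    calc _ ≤ 1 * (C₀ * jb x ^ (-4 : ℝ)) := by gcongr
      _ ≤ _ := by rw [one_mul]; gcongr; · exact jb_rpow_nonneg _ _
                  · linarith
  · have h := hb1 x
    rw [norm_iteratedFDeriv_eq_norm_iteratedDeriv, iteratedDeriv_one] at h
    rw [(hd x).deriv, norm_mul, norm_mul]
    have hinv' : ‖(((2 * Real.pi)⁻¹ : ℝ) : ℂ)‖ ≤ 1 := by push_cast; exact hinv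
    calc _ ≤ 1 * (1 * (C₁ * jb x ^ (-4 : ℝ))) := by gcongr
      _ ≤ _ := by rw [one_mul, one_mul]; gcongr; · exact jb_rpow_nonneg _ _
                  · linarith
  · intro t ht
    have h1 := hg t ht
    rw [Real.fourierInv_eq'] at h1
    have h2 := Measure.integral_comp_div
      (fun v : ℝ => Complex.exp (↑(2 * Real.pi * inner ℝ v t) * Complex.I) • g v) (2 * Real.pi)
    rw [h1] at h2
    calc _ = ∫ τ : ℝ, ((2 * Real.pi)⁻¹ : ℂ) *
        (Complex.exp (↑(2 * Real.pi * inner ℝ (τ / (2 * Real.pi)) t) * Complex.I) •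
          g (τ / (2 * Real.pi))) := by
          refine integral_congr_ae (ae_of_all _ fun τ => ?_)
          simp only [smul_eq_mul]
          have : 2 * Real.pi * inner ℝ (τ / (2 * Real.pi)) t = t * τ := by
            simp
            field_simp
          rw [this]; push_cast; ring_nf
      _ = 1 := by
          have : (Real.pi : ℂ) ≠ 0 := by exact_mod_cast Real.pi_ne_zero
          rw [integral_const_mul, h2, abs_of_pos hπ, Complex.real_smul]
          push_cast
          field_simp

/-- The Fourier transform of a smooth cutoff that equals `1` on `[-1,1]`. -/
def cutoff : ℝ → ℂ := Classical.choose exists_cutoff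

lemma differentiable_cutoff : Differentiable ℝ cutoff := (Classical.choose_spec exists_cutoff).1

lemma integral_exp_mul_cutoff {t : ℝ} (ht : |t| ≤ 1) :
    ∫ τ : ℝ, Complex.exp (Complex.I * (t * τ)) * cutoff τ = 1 :=
  (Classical.choose_spec (Classical.choose_spec exists_cutoff).2).2.2.2 t ht

lemma exists_cutoff_le : ∃ C : ℝ, 0 ≤ C ∧ (∀ x, ‖cutoff x‖ ≤ C * jb x ^ (-4 : ℝ)) ∧
    ∀ x, ‖deriv cutoff x‖ ≤ C * jb x ^ (-4 : ℝ) := by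
  obtain ⟨C, h0, h1, h2, _⟩ := (Classical.choose_spec exists_cutoff).2
  exact ⟨C, h0, h1, h2⟩

@[fun_prop] lemma continuous_cutoff : Continuous cutoff := differentiable_cutoff.continuous

@[fun_prop] lemma measurable_cutoff : Measurable cutoff := continuous_cutoff.measurable

/-- For `|y| ≥ 1` the two terms are bounded separately; for `|y| ≤ 1` the mean value theorem
applies, the bracket varying by at most a factor two along the segment. The factor `|y|⟨y⟩^{-1}`
covers both regimes, and its `|y|` will cancel the denominator of the Duhamel kernel. -/
lemma exists_norm_cutoff_sub_le : ∃ C : ℝ, 0 ≤ C ∧ ∀ x y : ℝ,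
    ‖cutoff (x - y) - cutoff x‖ ≤
      C * (|y| * (jb y ^ (-1 : ℝ) * (jb (x - y) ^ (-4 : ℝ) + jb x ^ (-4 : ℝ)))) := by
  obtain ⟨C, h0, h1, h2⟩ := exists_cutoff_le
  refine ⟨32 * C, by positivity, fun x y => ?_⟩
  have p1 := jb_rpow_pos (x - y) (-4 : ℝ)
  have p2 := jb_rpow_pos x (-4 : ℝ)
  rw [Real.rpow_neg_one]
  rcases le_total 1 |y| with hy | hy
  · have hh : 1 ≤ 2 * (|y| * (jb y)⁻¹) := by
      rw [← div_eq_mul_inv, ← mul_div_assoc, le_div_iff₀ (jb_pos y)]; unfold jb; linarith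
    calc _ ≤ C * jb (x - y) ^ (-4 : ℝ) + C * jb x ^ (-4 : ℝ) :=
          (norm_sub_le _ _).trans (add_le_add (h1 _) (h1 _))
      _ = C * (jb (x - y) ^ (-4 : ℝ) + jb x ^ (-4 : ℝ)) * 1 := by ring
      _ ≤ C * (jb (x - y) ^ (-4 : ℝ) + jb x ^ (-4 : ℝ)) * (32 * (|y| * (jb y)⁻¹)) := by
          gcongr; linarith
      _ = _ := by ring
  · have hmv : ‖cutoff (x - y) - cutoff x‖ ≤ (C * (16 * jb x ^ (-4 : ℝ))) * ‖(x - y) - x‖ := by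
      refine (convex_uIcc x (x - y)).norm_image_sub_le_of_norm_deriv_le
        (fun z _ => differentiable_cutoff z) (fun z hz => ?_) left_mem_uIcc right_mem_uIcc
      refine (h2 z).trans ?_
      gcongr
      have hzx : |x - z| ≤ 1 := by
        have := abs_sub_left_of_mem_uIcc hz
        rw [abs_sub_comm]
        refine this.trans ?_
        simpa using hy
      have hj : jb x / 2 ≤ jb z := by
        have : |x| ≤ |x - z| + |z| := by simpa using abs_add_le (x - z) z
        unfold jb; linarith [abs_nonneg z]
      refine (Real.rpow_le_rpow_of_nonpos (by have := jb_pos x; positivity) hj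
        (by norm_num)).trans (le_of_eq ?_)
      rw [Real.div_rpow (jb_nonneg x) (by norm_num), show (2 : ℝ) ^ (-4 : ℝ) = 1 / 16 by
        rw [Real.rpow_neg (by norm_num)]; norm_num]
      ring
    have hh : 1 ≤ 2 * (jb y)⁻¹ := by
      rw [← div_eq_mul_inv, le_div_iff₀ (jb_pos y)]; unfold jb; linarith
    rw [sub_sub_cancel_left, norm_neg, Real.norm_eq_abs] at hmv
    calc _ ≤ _ := hmv
      _ = C * (16 * jb x ^ (-4 : ℝ)) * |y| * 1 := by ring
      _ ≤ C * (16 * jb x ^ (-4 : ℝ)) * |y| * (2 * (jb y)⁻¹) := by gcongr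
      _ = 32 * C * (|y| * ((jb y)⁻¹ * (0 + jb x ^ (-4 : ℝ)))) := by ring
      _ ≤ _ := by have := jb_pos y; gcongr

/-- The kernel of `g ↦ ψ(t/T) ∫₀ᵗ g` on the Fourier side. -/
def duhamelKernel (T τ' τ : ℝ) : ℂ :=
  T * (cutoff (T * (τ' - τ)) - cutoff (T * τ')) / (Complex.I * τ)

@[fun_prop] lemma measurable_duhamelKernel (T : ℝ) :
    Measurable (Function.uncurry (duhamelKernel T)) := by
  unfold duhamelKernel Function.uncurry; fun_prop

lemma exists_norm_duhamelKernel_le : ∃ C : ℝ, 0 ≤ C ∧ ∀ T : ℝ, 0 < T → ∀ τ' τ : ℝ,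
    ‖duhamelKernel T τ' τ‖ ≤ C * (T ^ 2 * (jb (T * τ) ^ (-1 : ℝ) *
      (jb (T * (τ' - τ)) ^ (-4 : ℝ) + jb (T * τ') ^ (-4 : ℝ)))) := by
  obtain ⟨C, h0, h⟩ := exists_norm_cutoff_sub_le
  refine ⟨C, h0, fun T hT τ' τ => ?_⟩
  have p1 := jb_rpow_pos (T * (τ' - τ)) (-4 : ℝ)
  have p2 := jb_rpow_pos (T * τ') (-4 : ℝ)
  have p3 := jb_rpow_pos (T * τ) (-1 : ℝ)
  -- At `τ = 0` numerator and denominator both vanish, and the quotient is `0` by convention.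
  rcases eq_or_ne τ 0 with rfl | hτ
  · have : duhamelKernel T τ' 0 = 0 := by unfold duhamelKernel; simp
    rw [this, norm_zero]; positivity
  have hτ0 : 0 < |τ| := abs_pos.2 hτ
  have := h (T * τ') (T * τ)
  rw [← mul_sub, abs_mul, abs_of_pos hT] at this
  unfold duhamelKernel
  rw [norm_div, norm_mul, norm_mul, Complex.norm_I, one_mul, Complex.norm_real, Complex.norm_real,
    Real.norm_of_nonneg hT.le, Real.norm_eq_abs, div_le_iff₀ hτ0]
  calc _ ≤ T * _ := mul_le_mul_of_nonneg_left this hT.le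
    _ = _ := by ring

lemma lintegral_jb_comp_mul {r T : ℝ} (hT : 0 < T) :
    ∫⁻ x, ENNReal.ofReal (jb (T * x) ^ (-r)) = ENNReal.ofReal T⁻¹ * jbInt r := by
  rw [lintegral_comp_mul_left' (fun x => ENNReal.ofReal (jb x ^ (-r))) (by fun_prop) hT.ne',
    abs_of_pos (inv_pos.2 hT)]
  rfl

lemma jb_le_inv_mul {T : ℝ} (hT : 0 < T) (hT1 : T ≤ 1) (x : ℝ) : jb x ≤ T⁻¹ * jb (T * x) := by
  rw [inv_mul_eq_div, le_div_iff₀ hT]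
  unfold jb
  rw [abs_mul, abs_of_pos hT]; nlinarith [abs_nonneg x]

/-- The two parts of the weighted Duhamel kernel. -/
lemma exists_weighted_duhamelKernel_le : ∃ C : ℝ, 0 ≤ C ∧ ∀ ρ T : ℝ, 0 ≤ ρ → ρ ≤ 1 / 4 →
    0 < T → T ≤ 1 → ∀ τ' τ : ℝ,
    jb τ' ^ (3 / 4 : ℝ) * ‖duhamelKernel T τ' τ‖ ≤ C * T ^ (1 / 4 - ρ) *
      ((T * jb (T * (τ' - τ)) ^ (-3 : ℝ) +
        T * jb (T * τ') ^ (-3 : ℝ) * jb (T * τ) ^ (-(3 / 4) : ℝ)) * jb τ ^ (-ρ)) := by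
  obtain ⟨C, h0, h⟩ := exists_norm_duhamelKernel_le
  refine ⟨C, h0, fun ρ T hρ hρ1 hT hT1 τ' τ => ?_⟩
  set x := jb (T * τ) with hx
  set y := jb (T * τ') with hy
  set d := jb (T * (τ' - τ)) with hd
  have px : 0 < x := jb_pos _
  have py : 0 < y := jb_pos _
  have pd : 0 < d := jb_pos _
  have hyx : y ≤ x * d := by
    have := jb_add_le (T * τ) (T * (τ' - τ))
    rwa [show T * τ + T * (τ' - τ) = T * τ' by ring] at this
  have w1 : jb τ' ^ (3 / 4 : ℝ) ≤ T ^ (-(3 / 4) : ℝ) * y ^ (3 / 4 : ℝ) := by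
    rw [Real.rpow_neg hT.le, ← Real.inv_rpow hT.le, ← Real.mul_rpow (by positivity) py.le]
    exact Real.rpow_le_rpow (jb_nonneg _) (jb_le_inv_mul hT hT1 _) (by norm_num)
  -- The weight `⟨τ⟩^{-ρ}` is inserted at the cost of `T^{-ρ} x^ρ`. As `ρ ≤ 1/4`, the factor
  -- `x^{-1}` of the kernel absorbs `x^ρ` together with `x^{3/4}`.
  have w2 : 1 ≤ T ^ (-ρ) * x ^ ρ * jb τ ^ (-ρ) := by
    rw [Real.rpow_neg (jb_nonneg τ), ← div_eq_mul_inv, le_div_iff₀ (jb_rpow_pos _ _), one_mul,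
      Real.rpow_neg hT.le, ← Real.inv_rpow hT.le, ← Real.mul_rpow (by positivity) px.le]
    exact Real.rpow_le_rpow (jb_nonneg _) (jb_le_inv_mul hT hT1 _) hρ
  have k1 : y ^ (3 / 4 : ℝ) * x ^ ρ * (x ^ (-1 : ℝ) * d ^ (-4 : ℝ)) ≤ d ^ (-3 : ℝ) := by
    have a1 : y ^ (3 / 4 : ℝ) ≤ x ^ (3 / 4 : ℝ) * d ^ (3 / 4 : ℝ) := by
      rw [← Real.mul_rpow px.le pd.le]; exact Real.rpow_le_rpow py.le hyx (by norm_num)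
    calc _ ≤ (x ^ (3 / 4 : ℝ) * d ^ (3 / 4 : ℝ)) * x ^ ρ * (x ^ (-1 : ℝ) * d ^ (-4 : ℝ)) := by
          gcongr
      _ = (x ^ (3 / 4 : ℝ) * x ^ ρ * x ^ (-1 : ℝ)) * (d ^ (3 / 4 : ℝ) * d ^ (-4 : ℝ)) := by ring
      _ = x ^ (3 / 4 + ρ + -1) * d ^ (3 / 4 + -4 : ℝ) := by
          rw [Real.rpow_add px, Real.rpow_add px, Real.rpow_add pd]
      _ ≤ 1 * d ^ (-3 : ℝ) := by
          exact mul_le_mul (jb_rpow_le_one _ (by linarith)) (jb_rpow_mono _ (by norm_num))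
            (by positivity) zero_le_one
      _ = _ := one_mul _
  have k2 : y ^ (3 / 4 : ℝ) * x ^ ρ * (x ^ (-1 : ℝ) * y ^ (-4 : ℝ)) ≤
      y ^ (-3 : ℝ) * x ^ (-(3 / 4) : ℝ) := by
    calc _ = (y ^ (3 / 4 : ℝ) * y ^ (-4 : ℝ)) * (x ^ ρ * x ^ (-1 : ℝ)) := by ring
      _ = y ^ (3 / 4 + -4 : ℝ) * x ^ (ρ + -1) := by rw [Real.rpow_add px, Real.rpow_add py]
      _ ≤ _ := by
          exact mul_le_mul (jb_rpow_mono _ (by norm_num)) (jb_rpow_mono _ (by linarith))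
            (by positivity) (by positivity)
  -- The powers `-3/4` and `-ρ` come from rescaling the two brackets and `2` from the kernel; one
  -- factor `T` is set aside to normalise the kernels below.
  have hTe : T ^ (-(3 / 4) : ℝ) * T ^ (-ρ) * T ^ 2 = T ^ (1 / 4 - ρ) * T := by
    rw [← Real.rpow_natCast, ← Real.rpow_add hT, ← Real.rpow_add hT, ← Real.rpow_add_one hT.ne']
    congr 1; push_cast; ring
  have hτρ := jb_rpow_pos τ (-ρ)
  have hk := h T hT τ' τ
  rw [← hx, ← hy, ← hd] at hk
  calc _ ≤ (T ^ (-(3 / 4) : ℝ) * y ^ (3 / 4 : ℝ)) *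
        ((C * (T ^ 2 * (x ^ (-1 : ℝ) * (d ^ (-4 : ℝ) + y ^ (-4 : ℝ))))) * 1) := by
        rw [mul_one]; gcongr
    _ ≤ (T ^ (-(3 / 4) : ℝ) * y ^ (3 / 4 : ℝ)) *
        ((C * (T ^ 2 * (x ^ (-1 : ℝ) * (d ^ (-4 : ℝ) + y ^ (-4 : ℝ))))) *
          (T ^ (-ρ) * x ^ ρ * jb τ ^ (-ρ))) := by gcongr
    _ = C * (T ^ (-(3 / 4) : ℝ) * T ^ (-ρ) * T ^ 2) *
        ((y ^ (3 / 4 : ℝ) * x ^ ρ * (x ^ (-1 : ℝ) * d ^ (-4 : ℝ)) +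
          y ^ (3 / 4 : ℝ) * x ^ ρ * (x ^ (-1 : ℝ) * y ^ (-4 : ℝ))) * jb τ ^ (-ρ)) := by ring
    _ ≤ C * (T ^ (1 / 4 - ρ) * T) * ((d ^ (-3 : ℝ) + y ^ (-3 : ℝ) * x ^ (-(3 / 4) : ℝ)) *
          jb τ ^ (-ρ)) := by
        rw [hTe]; gcongr
    _ = _ := by ring

lemma add_sq_le_two_mul (a b : ℝ≥0∞) : (a + b) ^ 2 ≤ 2 * (a ^ 2 + b ^ 2) := by
  have := ENNReal.rpow_add_le_mul_rpow_add_rpow a b (p := 2) (by norm_num)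
  norm_num at this
  exact_mod_cast this

/-- Young's inequality for convolution with a kernel whose mass `jbInt 3` does not depend on `T`, by
splitting the kernel into two square roots. -/
lemma lintegral_sq_conv_le {T : ℝ} (hT : 0 < T) {g : ℝ → ℝ≥0∞} (hg : Measurable g) :
    ∫⁻ τ', (∫⁻ τ, ENNReal.ofReal (T * jb (T * (τ' - τ)) ^ (-3 : ℝ)) * g τ) ^ 2 ≤
      jbInt 3 ^ 2 * ∫⁻ τ, g τ ^ 2 := by
  have hJ : jbInt 3 ≠ ∞ := (jbInt_lt_top (by norm_num)).ne
  set k : ℝ → ℝ≥0∞ := fun x => ENNReal.ofReal (T * jb (T * x) ^ (-3 : ℝ)) with hk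
  have hkm : Measurable k := by simp only [hk]; fun_prop
  have hki : ∫⁻ x, k x = jbInt 3 := by
    simp only [hk, ENNReal.ofReal_mul hT.le]
    rw [lintegral_const_mul' _ _ ENNReal.ofReal_ne_top, lintegral_jb_comp_mul hT, ← mul_assoc,
      ← ENNReal.ofReal_mul hT.le, mul_inv_cancel₀ hT.ne', ENNReal.ofReal_one, one_mul]
  have hsq : ∀ x, (k x ^ (1 / 2 : ℝ)) ^ 2 = k x := fun x => by
    rw [← ENNReal.rpow_natCast, ← ENNReal.rpow_mul]; norm_num
  calc _ = ∫⁻ τ', (∫⁻ τ, k (τ' - τ) ^ (1 / 2 : ℝ) * (k (τ' - τ) ^ (1 / 2 : ℝ) * g τ)) ^ 2 := by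
        refine lintegral_congr fun τ' => ?_
        congr 1
        refine lintegral_congr fun τ => ?_
        rw [← mul_assoc, ← sq, hsq]
    _ ≤ ∫⁻ τ', jbInt 3 * ∫⁻ τ, k (τ' - τ) * g τ ^ 2 := by
        refine lintegral_mono fun τ' => ?_
        refine (sq_lintegral_mul_le (by fun_prop) (by fun_prop)).trans (le_of_eq ?_)
        simp only [mul_pow, hsq]
        rw [lintegral_sub_left_eq_self k τ', hki]
    _ = jbInt 3 * ∫⁻ τ, ∫⁻ τ', k (τ' - τ) * g τ ^ 2 := by
        rw [lintegral_const_mul' _ _ hJ, lintegral_lintegral_swap]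
        unfold Function.uncurry; fun_prop
    _ = _ := by
        have : ∀ τ, ∫⁻ τ', k (τ' - τ) * g τ ^ 2 = jbInt 3 * g τ ^ 2 := fun τ => by
          rw [lintegral_mul_const _ (by fun_prop), lintegral_sub_right_eq_self k τ, hki]
        simp_rw [this]
        rw [lintegral_const_mul _ (by fun_prop), sq, mul_assoc]

/-- This majorant stems from the subtracted term `cutoff (T * τ')` of the kernel. It is a product of
functions of `τ'` and `τ`, so Cauchy-Schwarz suffices; the factor `T²` is cancelled by the two
rescaled integrals. -/
lemma lintegral_sq_rankOne_le {T : ℝ} (hT : 0 < T) {g : ℝ → ℝ≥0∞} (hg : Measurable g) :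
    ∫⁻ τ', (∫⁻ τ, ENNReal.ofReal (T * jb (T * τ') ^ (-3 : ℝ) * jb (T * τ) ^ (-(3 / 4) : ℝ)) *
      g τ) ^ 2 ≤ jbInt 6 * jbInt (3 / 2) * ∫⁻ τ, g τ ^ 2 := by
  have e1 : ∀ x r : ℝ, ENNReal.ofReal (jb x ^ r) ^ 2 = ENNReal.ofReal (jb x ^ (2 * r)) :=
    fun x r => by
      rw [← ENNReal.ofReal_pow (jb_rpow_nonneg _ _), ← Real.rpow_natCast,
        ← Real.rpow_mul (jb_nonneg x)]
      ring_nf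
  have hcs : (∫⁻ τ, ENNReal.ofReal (jb (T * τ) ^ (-(3 / 4) : ℝ)) * g τ) ^ 2 ≤
      ENNReal.ofReal T⁻¹ * jbInt (3 / 2) * ∫⁻ τ, g τ ^ 2 := by
    refine (sq_lintegral_mul_le (by fun_prop) (by fun_prop)).trans (le_of_eq ?_)
    simp only [e1]
    rw [← lintegral_jb_comp_mul hT]
    norm_num
  calc _ = ∫⁻ τ', ENNReal.ofReal (T ^ 2) * ENNReal.ofReal (jb (T * τ') ^ (-6 : ℝ)) *
        (∫⁻ τ, ENNReal.ofReal (jb (T * τ) ^ (-(3 / 4) : ℝ)) * g τ) ^ 2 := by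
        refine lintegral_congr fun τ' => ?_
        have : (-6 : ℝ) = 2 * (-3) := by norm_num
        rw [this, ← e1, ENNReal.ofReal_pow hT.le, ← mul_pow, ← mul_pow,
          ← ENNReal.ofReal_mul hT.le, ← lintegral_const_mul' _ _ ENNReal.ofReal_ne_top]
        congr 1
        refine lintegral_congr fun τ => ?_
        rw [← mul_assoc, ← ENNReal.ofReal_mul]
        exact mul_nonneg hT.le (jb_rpow_nonneg _ _)
    _ ≤ ∫⁻ τ', ENNReal.ofReal (T ^ 2) * ENNReal.ofReal (jb (T * τ') ^ (-6 : ℝ)) *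
        (ENNReal.ofReal T⁻¹ * jbInt (3 / 2) * ∫⁻ τ, g τ ^ 2) := by gcongr
    _ = (ENNReal.ofReal (T ^ 2) * ENNReal.ofReal T⁻¹ * ENNReal.ofReal T⁻¹) *
        (jbInt 6 * jbInt (3 / 2) * ∫⁻ τ, g τ ^ 2) := by
        rw [lintegral_mul_const _ (by fun_prop), lintegral_const_mul _ (by fun_prop),
          lintegral_jb_comp_mul hT]
        ring
    _ = _ := by
        rw [← ENNReal.ofReal_mul (by positivity), ← ENNReal.ofReal_mul (by positivity),
          show T ^ 2 * T⁻¹ * T⁻¹ = 1 by field_simp, ENNReal.ofReal_one, one_mul]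

/-- The Duhamel estimate, with a positive power of the length of the time interval. -/
theorem exists_duhamel_le : ∃ C : ℝ≥0∞, C < ∞ ∧ ∀ ρ T : ℝ, 0 ≤ ρ → ρ ≤ 1 / 4 →
    0 < T → T ≤ 1 → ∀ g : ℝ → ℝ≥0∞, Measurable g →
    ∫⁻ τ', (ENNReal.ofReal (jb τ' ^ (3 / 4 : ℝ)) * ∫⁻ τ, ‖duhamelKernel T τ' τ‖ₑ * g τ) ^ 2 ≤
      C * ENNReal.ofReal (T ^ (1 / 4 - ρ)) ^ 2 *
        ∫⁻ τ, (ENNReal.ofReal (jb τ ^ (-ρ)) * g τ) ^ 2 := by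
  obtain ⟨C, h0, h⟩ := exists_weighted_duhamelKernel_le
  have j3 := jbInt_lt_top (show (1 : ℝ) < 3 by norm_num)
  have j6 := jbInt_lt_top (show (1 : ℝ) < 6 by norm_num)
  have j32 := jbInt_lt_top (show (1 : ℝ) < 3 / 2 by norm_num)
  refine ⟨ENNReal.ofReal C ^ 2 * (2 * (jbInt 3 ^ 2 + jbInt 6 * jbInt (3 / 2))), by finiteness,
    fun ρ T hρ hρ1 hT hT1 g hg => ?_⟩
  set G : ℝ → ℝ≥0∞ := fun τ => ENNReal.ofReal (jb τ ^ (-ρ)) * g τ with hG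
  have hGm : Measurable G := by fun_prop
  set K : ℝ≥0∞ := ENNReal.ofReal (C * T ^ (1 / 4 - ρ)) with hK
  have step : ∀ τ', ENNReal.ofReal (jb τ' ^ (3 / 4 : ℝ)) *
      ∫⁻ τ, ‖duhamelKernel T τ' τ‖ₑ * g τ ≤
      K * ((∫⁻ τ, ENNReal.ofReal (T * jb (T * (τ' - τ)) ^ (-3 : ℝ)) * G τ) +
        ∫⁻ τ, ENNReal.ofReal (T * jb (T * τ') ^ (-3 : ℝ) * jb (T * τ) ^ (-(3 / 4) : ℝ)) *
          G τ) := by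
    intro τ'
    rw [← lintegral_add_left (by fun_prop), ← lintegral_const_mul' _ _ ENNReal.ofReal_ne_top,
      ← lintegral_const_mul' _ _ ENNReal.ofReal_ne_top]
    refine lintegral_mono fun τ => ?_
    have n1 : 0 ≤ T * jb (T * (τ' - τ)) ^ (-3 : ℝ) := mul_nonneg hT.le (jb_rpow_nonneg _ _)
    have n2 : 0 ≤ T * jb (T * τ') ^ (-3 : ℝ) * jb (T * τ) ^ (-(3 / 4) : ℝ) :=
      mul_nonneg (mul_nonneg hT.le (jb_rpow_nonneg _ _)) (jb_rpow_nonneg _ _)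
    have := ENNReal.ofReal_le_ofReal (h ρ T hρ hρ1 hT hT1 τ' τ)
    rw [ENNReal.ofReal_mul (jb_rpow_nonneg _ _), ofReal_norm,
      ENNReal.ofReal_mul (by positivity), ENNReal.ofReal_mul (add_nonneg n1 n2),
      ENNReal.ofReal_add n1 n2, ← hK] at this
    simp only [hG]
    calc _ = (ENNReal.ofReal (jb τ' ^ (3 / 4 : ℝ)) * ‖duhamelKernel T τ' τ‖ₑ) * g τ := by ring
      _ ≤ _ := mul_le_mul' this le_rfl
      _ = _ := by ring
  have m1 : Measurable (fun τ' => ∫⁻ τ, ENNReal.ofReal (T * jb (T * (τ' - τ)) ^ (-3 : ℝ)) * G τ) :=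
    Measurable.lintegral_prod_right' (f := fun p : ℝ × ℝ =>
      ENNReal.ofReal (T * jb (T * (p.1 - p.2)) ^ (-3 : ℝ)) * G p.2) (by fun_prop)
  calc _ ≤ ∫⁻ τ', K ^ 2 * (2 *
        ((∫⁻ τ, ENNReal.ofReal (T * jb (T * (τ' - τ)) ^ (-3 : ℝ)) * G τ) ^ 2 +
        (∫⁻ τ, ENNReal.ofReal (T * jb (T * τ') ^ (-3 : ℝ) * jb (T * τ) ^ (-(3 / 4) : ℝ)) *
          G τ) ^ 2)) := by
        refine lintegral_mono fun τ' => ?_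
        refine (pow_le_pow_left' (step τ') 2).trans ?_
        rw [mul_pow]
        gcongr
        exact add_sq_le_two_mul _ _
    _ ≤ K ^ 2 * (2 * (jbInt 3 ^ 2 * (∫⁻ τ, G τ ^ 2) +
          jbInt 6 * jbInt (3 / 2) * ∫⁻ τ, G τ ^ 2)) := by
        rw [lintegral_const_mul' _ _ (by finiteness), lintegral_const_mul' _ _ (by finiteness),
          lintegral_add_left (m1.pow_const 2)]
        gcongr
        · exact lintegral_sq_conv_le hT hGm
        · exact lintegral_sq_rankOne_le hT hGm
    _ = _ := by rw [hK, ENNReal.ofReal_mul h0]; ring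

/-- Uniformity in `τ` justifies Fubini's theorem in `integral_ex_mul_duh`; the size of the bound in
terms of `T` is irrelevant there. -/
lemma exists_lintegral_duhamelKernel_le {T : ℝ} (hT : 0 < T) : ∃ D : ℝ≥0∞, D < ∞ ∧
    ∀ τ, ∫⁻ τ', ‖duhamelKernel T τ' τ‖ₑ ≤ D := by
  obtain ⟨C, h0, h⟩ := exists_norm_duhamelKernel_le
  have j := jbInt_lt_top (show (1 : ℝ) < 4 by norm_num)
  refine ⟨ENNReal.ofReal (C * T ^ 2) * (ENNReal.ofReal T⁻¹ * jbInt 4 +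
    ENNReal.ofReal T⁻¹ * jbInt 4), by finiteness, fun τ => ?_⟩
  have e : ∫⁻ τ', ENNReal.ofReal (jb (T * (τ' - τ)) ^ (-4 : ℝ)) =
      ENNReal.ofReal T⁻¹ * jbInt 4 := by
    rw [lintegral_sub_right_eq_self (fun x => ENNReal.ofReal (jb (T * x) ^ (-4 : ℝ))) τ,
      lintegral_jb_comp_mul hT]
  rw [← e]
  nth_rw 2 [e]
  rw [← lintegral_jb_comp_mul hT, ← lintegral_add_left (by fun_prop),
    ← lintegral_const_mul' _ _ ENNReal.ofReal_ne_top]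
  refine lintegral_mono fun τ' => ?_
  rw [← ofReal_norm, ← ENNReal.ofReal_add (jb_rpow_nonneg _ _) (jb_rpow_nonneg _ _),
    ← ENNReal.ofReal_mul (by positivity)]
  refine ENNReal.ofReal_le_ofReal ((h T hT τ' τ).trans ?_)
  have := jb_rpow_nonneg (T * (τ' - τ)) (-4 : ℝ)
  have := jb_rpow_nonneg (T * τ') (-4 : ℝ)
  rw [mul_assoc]
  gcongr
  exact mul_le_of_le_one_left (by positivity) (jb_rpow_le_one _ (by norm_num))

lemma integrable_cutoff : Integrable cutoff := by
  obtain ⟨C, h0, h1, h2⟩ := exists_cutoff_le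
  have : Integrable (fun x : ℝ => C * jb x ^ (-4 : ℝ)) :=
    (integrable_one_add_norm (E := ℝ) (μ := volume) (r := 4) (by norm_num)).const_mul C
  exact this.mono' continuous_cutoff.aestronglyMeasurable (ae_of_all _ h1)

/-- The oscillating exponential `e^{iθ}`. -/
def ex (θ : ℝ) : ℂ := Complex.exp (Complex.I * θ)

lemma ex_add (x y : ℝ) : ex (x + y) = ex x * ex y := by
  unfold ex; rw [← Complex.exp_add]; push_cast; ring_nf

@[simp] lemma ex_zero : ex 0 = 1 := by simp [ex]

@[simp] lemma norm_ex (x : ℝ) : ‖ex x‖ = 1 := by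
  unfold ex; rw [mul_comm, Complex.norm_exp_ofReal_mul_I]

@[simp] lemma enorm_ex (x : ℝ) : ‖ex x‖ₑ = 1 := by
  rw [← ofReal_norm, norm_ex, ENNReal.ofReal_one]

@[simp] lemma conj_ex (x : ℝ) : (starRingEnd ℂ) (ex x) = ex (-x) := by
  unfold ex; rw [← Complex.exp_conj]; simp

@[fun_prop] lemma continuous_ex : Continuous ex := by unfold ex; fun_prop

@[fun_prop] lemma measurable_ex : Measurable ex := continuous_ex.measurable

lemma hasDerivAt_ex (x : ℝ) : HasDerivAt ex (Complex.I * ex x) x := by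
  have h : HasDerivAt (fun y : ℝ => Complex.I * (y : ℂ)) (Complex.I * 1) x :=
    (Complex.ofRealCLM.hasDerivAt (x := x)).const_mul Complex.I
  have := h.cexp
  unfold ex
  convert! this using 1
  ring

lemma integral_ex_mul_cutoff_comp {T t : ℝ} (hT : 0 < T) (ht : |t| ≤ T) :
    ∫ τ, ex (t * τ) * (T * cutoff (T * τ)) = 1 := by
  have h := Measure.integral_comp_mul_left (fun x => ex (t / T * x) * (T * cutoff x)) T
  have e : ∀ τ, t / T * (T * τ) = t * τ := fun τ => by field_simp
  simp only [e] at h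
  rw [h, abs_of_pos (inv_pos.2 hT)]
  have h1 : |t / T| ≤ 1 := by
    rw [abs_div, abs_of_pos hT]; exact div_le_one_of_le₀ ht hT.le
  have h2 := integral_exp_mul_cutoff h1
  have : ∫ x, ex (t / T * x) * (T * cutoff x) = T := by
    calc _ = ∫ x, (T : ℂ) * (ex (t / T * x) * cutoff x) := by
          refine integral_congr_ae (ae_of_all _ fun x => ?_)
          simp only; ring
      _ = _ := by
          rw [integral_const_mul]
          unfold ex
          push_cast at h2 ⊢
          rw [h2, mul_one]
  rw [this, Complex.real_smul, ← Complex.ofReal_mul, inv_mul_cancel₀ hT.ne', Complex.ofReal_one]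

lemma integral_ex_intervalIntegral {τ : ℝ} (hτ : τ ≠ 0) (t : ℝ) :
    ∫ r in (0 : ℝ)..t, ex (r * τ) = (ex (t * τ) - 1) / (Complex.I * τ) := by
  have hd : ∀ r ∈ uIcc 0 t, HasDerivAt (fun r => ex (r * τ) / (Complex.I * τ)) (ex (r * τ)) r := by
    intro r _
    have h1 : HasDerivAt (fun r : ℝ => r * τ) τ r := by
      simpa using (hasDerivAt_id r).mul_const τ
    have h2 := ((hasDerivAt_ex (r * τ)).scomp r h1).div_const (Complex.I * τ)
    convert! h2 using 1
    have : (τ : ℂ) ≠ 0 := by exact_mod_cast hτ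
    rw [Complex.real_smul]
    field_simp [Complex.I_ne_zero]
  rw [intervalIntegral.integral_eq_sub_of_hasDerivAt hd
    ((by fun_prop : Continuous fun r => ex (r * τ)).intervalIntegrable _ _), zero_mul, ex_zero]
  ring

/-- For `|t| ≤ T` the two cutoffs in the kernel integrate to `e^{itτ}` and `1`, and the difference
divided by `iτ` is the time integral of the character. -/
lemma integral_ex_mul_duhamelKernel {T t : ℝ} (hT : 0 < T) (ht : |t| ≤ T) {τ : ℝ} (hτ : τ ≠ 0) :
    ∫ τ', ex (t * τ') * duhamelKernel T τ' τ = ∫ r in (0 : ℝ)..t, ex (r * τ) := by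
  rw [integral_ex_intervalIntegral hτ]
  have i1 : Integrable (fun τ' => ex (t * τ') * (T * cutoff (T * τ'))) := by
    have : Integrable (fun τ' => (T : ℂ) * cutoff (T * τ')) :=
      (integrable_cutoff.comp_mul_left' hT.ne').const_mul _
    exact this.bdd_mul (c := 1) (by fun_prop) (ae_of_all _ fun x => (norm_ex _).le)
  have e1 : ∀ τ', ex (t * τ') * duhamelKernel T τ' τ =
      (ex (t * τ) * (ex (t * (τ' - τ)) * (T * cutoff (T * (τ' - τ)))) -
        ex (t * τ') * (T * cutoff (T * τ'))) / (Complex.I * τ) := by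
    intro τ'
    have : ex (t * τ') = ex (t * τ) * ex (t * (τ' - τ)) := by rw [← ex_add]; ring_nf
    unfold duhamelKernel
    rw [this]; ring
  simp only [e1]
  rw [integral_div, integral_sub ((i1.comp_sub_right τ).const_mul _) i1, integral_const_mul,
    integral_sub_right_eq_self (fun x => ex (t * x) * (T * cutoff (T * x))) τ,
    integral_ex_mul_cutoff_comp hT ht, mul_one]

end

/-! ### The nonlinear map on weighted profiles -/

section

/-- The product of three profiles at interacting frequencies. -/
def triC (α β : ℝ) (F₁ F₂ F₃ : ℝ × ℝ → ℂ) (q : ℝ × ℝ) (w : (ℝ × ℝ) × (ℝ × ℝ)) : ℂ :=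
  F₁ w.1 * (starRingEnd ℂ) (F₂ (shp α β q w)) * F₃ w.2

lemma measurable_triC (α β : ℝ) {F₁ F₂ F₃ : ℝ × ℝ → ℂ} (h₁ : Measurable F₁)
    (h₂ : Measurable F₂) (h₃ : Measurable F₃) :
    Measurable (Function.uncurry (triC α β F₁ F₂ F₃)) := by
  have := measurable_shp α β
  have hc : Measurable (starRingEnd ℂ) := Complex.continuous_conj.measurable
  unfold triC Function.uncurry at *
  fun_prop

lemma enorm_triC (α β : ℝ) (F₁ F₂ F₃ : ℝ × ℝ → ℂ) (q w) : ‖triC α β F₁ F₂ F₃ q w‖ₑ =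
    tri α β (fun p => ‖F₁ p‖ₑ) (fun p => ‖F₂ p‖ₑ) (fun p => ‖F₃ p‖ₑ) q w := by
  unfold triC tri
  rw [enorm_mul, enorm_mul, RCLike.enorm_conj]

/-- The space of variables `(τ, (p₁, p₃))` over which the Duhamel term is integrated. -/
abbrev DVar : Type := ℝ × ((ℝ × ℝ) × (ℝ × ℝ))

/-- The integrand of the Duhamel term. -/
def duhIntegrand (α β T : ℝ) (F₁ F₂ F₃ : ℝ × ℝ → ℂ) (q : ℝ × ℝ) (z : DVar) : ℂ :=
  duhamelKernel T q.2 z.1 * triC α β F₁ F₂ F₃ (q.1, z.1) z.2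

lemma measurable_duhIntegrand (α β T : ℝ) {F₁ F₂ F₃ : ℝ × ℝ → ℂ} (h₁ : Measurable F₁)
    (h₂ : Measurable F₂) (h₃ : Measurable F₃) :
    Measurable (Function.uncurry (duhIntegrand α β T F₁ F₂ F₃)) := by
  have h1 := measurable_triC α β h₁ h₂ h₃
  have h2 := measurable_duhamelKernel T
  unfold duhIntegrand
  exact (h2.comp (f := fun p : (ℝ × ℝ) × DVar => (p.1.2, p.2.1)) (by fun_prop)).mul
    (h1.comp (f := fun p : (ℝ × ℝ) × DVar => ((p.1.1, p.2.1), p.2.2)) (by fun_prop))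

/-- The Duhamel term of the cubic nonlinearity on the Fourier side. -/
def duh (α β T : ℝ) (F : ℝ × ℝ → ℂ) (q : ℝ × ℝ) : ℂ := ∫ z, duhIntegrand α β T F F F q z

/-- The absolute version of the Duhamel term. -/
def absDuh (α β T : ℝ) (f₁ f₂ f₃ : ℝ × ℝ → ℝ≥0∞) (q : ℝ × ℝ) : ℝ≥0∞ :=
  ∫⁻ z : DVar, ‖duhamelKernel T q.2 z.1‖ₑ * tri α β f₁ f₂ f₃ (q.1, z.1) z.2

lemma measurable_absDuh_integrand (α β T : ℝ) {f₁ f₂ f₃ : ℝ × ℝ → ℝ≥0∞} (h₁ : Measurable f₁)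
    (h₂ : Measurable f₂) (h₃ : Measurable f₃) :
    Measurable (fun p : (ℝ × ℝ) × DVar =>
      ‖duhamelKernel T p.1.2 p.2.1‖ₑ * tri α β f₁ f₂ f₃ (p.1.1, p.2.1) p.2.2) := by
  have h1 := measurable_tri α β h₁ h₂ h₃
  have h2 := measurable_duhamelKernel T
  exact (h2.comp (f := fun p : (ℝ × ℝ) × DVar => (p.1.2, p.2.1)) (by fun_prop)).enorm.mul
    (h1.comp (f := fun p : (ℝ × ℝ) × DVar => ((p.1.1, p.2.1), p.2.2)) (by fun_prop))

lemma measurable_absDuh (α β T : ℝ) {f₁ f₂ f₃ : ℝ × ℝ → ℝ≥0∞} (h₁ : Measurable f₁)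
    (h₂ : Measurable f₂) (h₃ : Measurable f₃) : Measurable (absDuh α β T f₁ f₂ f₃) :=
  (measurable_absDuh_integrand α β T h₁ h₂ h₃).lintegral_prod_right'

lemma absDuh_eq (α β T : ℝ) {f₁ f₂ f₃ : ℝ × ℝ → ℝ≥0∞} (h₁ : Measurable f₁)
    (h₂ : Measurable f₂) (h₃ : Measurable f₃) (q : ℝ × ℝ) : absDuh α β T f₁ f₂ f₃ q =
      ∫⁻ τ, ‖duhamelKernel T q.2 τ‖ₑ * ∫⁻ w, tri α β f₁ f₂ f₃ (q.1, τ) w := by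
  have m : Measurable (fun z : DVar =>
      ‖duhamelKernel T q.2 z.1‖ₑ * tri α β f₁ f₂ f₃ (q.1, z.1) z.2) :=
    (measurable_absDuh_integrand α β T h₁ h₂ h₃).comp (f := fun z => (q, z)) (by fun_prop)
  unfold absDuh
  rw [Measure.volume_eq_prod, lintegral_prod _ m.aemeasurable]
  refine lintegral_congr fun τ => ?_
  exact lintegral_const_mul' _ _ (enorm_ne_top (x := duhamelKernel T q.2 τ))

lemma lintegral_enorm_duhIntegrand (α β T : ℝ) (F₁ F₂ F₃ : ℝ × ℝ → ℂ) (q : ℝ × ℝ) :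
    ∫⁻ z, ‖duhIntegrand α β T F₁ F₂ F₃ q z‖ₑ =
      absDuh α β T (fun p => ‖F₁ p‖ₑ) (fun p => ‖F₂ p‖ₑ) (fun p => ‖F₃ p‖ₑ) q := by
  unfold duhIntegrand absDuh
  simp only [enorm_mul, enorm_triC]

/-- The squared weighted norm. -/
def wnorm (σ s : ℝ) (f : ℝ × ℝ → ℝ≥0∞) : ℝ≥0∞ := ∫⁻ p, (ENNReal.ofReal (wt σ s p) * f p) ^ 2

/-- The nonlinear estimate. -/
theorem exists_absDuh_le {ρ : ℝ} (h0 : 0 < ρ) (h1 : ρ < 1 / 4) (α : ℝ) {β : ℝ}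
    (hβ : β ≠ 0) : ∃ C : ℝ≥0∞, C < ∞ ∧ ∀ σ s T : ℝ, 0 ≤ σ → -ρ ≤ s → 0 < T → T ≤ 1 →
      ∀ f₁ f₂ f₃ : ℝ × ℝ → ℝ≥0∞, Measurable f₁ → Measurable f₂ → Measurable f₃ →
      wnorm σ s (absDuh α β T f₁ f₂ f₃) ≤ C * ENNReal.ofReal (T ^ (1 / 4 - ρ)) ^ 2 *
        (wnorm σ s f₁ * wnorm σ s f₂ * wnorm σ s f₃) := by
  obtain ⟨C₁, hC₁, ht⟩ := exists_trilinear_le h0 h1 α hβ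
  obtain ⟨C₂, hC₂, hd⟩ := exists_duhamel_le
  refine ⟨C₂ * C₁, by finiteness, fun σ s T hσ hs hT hT1 f₁ f₂ f₃ m₁ m₂ m₃ => ?_⟩
  set N : ℝ × ℝ → ℝ≥0∞ := fun q => ∫⁻ w, tri α β f₁ f₂ f₃ q w with hN
  have hNm : Measurable N := (measurable_tri α β m₁ m₂ m₃).lintegral_prod_right'
  have ma := measurable_absDuh α β T m₁ m₂ m₃
  set D := C₂ * ENNReal.ofReal (T ^ (1 / 4 - ρ)) ^ 2 with hD
  have hDt : D ≠ ∞ := by finiteness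
  calc wnorm σ s (absDuh α β T f₁ f₂ f₃)
      = ∫⁻ ξ, ENNReal.ofReal (gw σ s ξ) ^ 2 * ∫⁻ τ', (ENNReal.ofReal (jb τ' ^ (3 / 4 : ℝ)) *
          ∫⁻ τ, ‖duhamelKernel T τ' τ‖ₑ * N (ξ, τ)) ^ 2 := by
        unfold wnorm
        rw [Measure.volume_eq_prod, lintegral_prod _ (by fun_prop)]
        refine lintegral_congr fun ξ => ?_
        rw [← lintegral_const_mul' _ _ (by finiteness)]
        refine lintegral_congr fun τ' => ?_
        rw [absDuh_eq α β T m₁ m₂ m₃, ← mul_pow, ← mul_assoc, ← ENNReal.ofReal_mul (gw_pos _ _ _).le]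
        rfl
    _ ≤ ∫⁻ ξ, ENNReal.ofReal (gw σ s ξ) ^ 2 * (D *
          ∫⁻ τ, (ENNReal.ofReal (jb τ ^ (-ρ)) * N (ξ, τ)) ^ 2) := by
        gcongr with ξ
        exact hd ρ T h0.le h1.le hT hT1 (fun τ => N (ξ, τ)) (by fun_prop)
    _ = D * ∫⁻ q : ℝ × ℝ, (ENNReal.ofReal (gw σ s q.1 * jb q.2 ^ (-ρ)) * N q) ^ 2 := by
        rw [Measure.volume_eq_prod, lintegral_prod _ (by fun_prop), ← lintegral_const_mul' _ _ hDt]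
        refine lintegral_congr fun ξ => ?_
        rw [mul_left_comm, ← lintegral_const_mul' _ _ (by finiteness)]
        congr 1
        refine lintegral_congr fun τ => ?_
        rw [ENNReal.ofReal_mul (gw_pos _ _ _).le]; ring
    _ ≤ D * (C₁ * (wnorm σ s f₁ * wnorm σ s f₂ * wnorm σ s f₃)) := by
        gcongr
        exact ht σ s hσ hs f₁ f₂ f₃ m₁ m₂ m₃
    _ = _ := by rw [hD]; ring

lemma eLpNorm_two_sq {X E : Type*} [MeasurableSpace X] {μ : Measure X} [NormedAddCommGroup E]
    (f : X → E) : eLpNorm f 2 μ ^ 2 = ∫⁻ x, ‖f x‖ₑ ^ 2 ∂μ := by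
  rw [eLpNorm_eq_lintegral_rpow_enorm_toReal (by norm_num) (by norm_num), ← ENNReal.rpow_natCast,
    ← ENNReal.rpow_mul]
  norm_num

/-- The space in which the equation for the weighted profile is solved. -/
abbrev XSp : Type := Lp ℂ 2 (volume : Measure (ℝ × ℝ))

/-- The profile obtained from the weighted profile. -/
def prof (σ s : ℝ) (x : XSp) (p : ℝ × ℝ) : ℂ := x p / (wt σ s p : ℂ)

lemma measurable_prof (σ s : ℝ) (x : XSp) : Measurable (prof σ s x) := by
  have := (Lp.stronglyMeasurable x).measurable
  unfold prof; fun_prop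

lemma enorm_sq_eq (x : XSp) : ‖x‖ₑ ^ 2 = ∫⁻ p, ‖x p‖ₑ ^ 2 := by
  rw [Lp.enorm_def, eLpNorm_two_sq]

lemma ofReal_wt_mul_enorm_div (σ s : ℝ) (p : ℝ × ℝ) (c : ℂ) :
    ENNReal.ofReal (wt σ s p) * ‖c / (wt σ s p : ℂ)‖ₑ = ‖c‖ₑ := by
  have h := wt_pos σ s p
  have hne : ((wt σ s p : ℝ) : ℂ) ≠ 0 := by exact_mod_cast h.ne'
  have he : ENNReal.ofReal (wt σ s p) = ‖((wt σ s p : ℝ) : ℂ)‖ₑ := by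
    rw [← ofReal_norm, Complex.norm_real, Real.norm_of_nonneg h.le]
  rw [he, ← enorm_mul, mul_div_cancel₀ _ hne]

lemma wnorm_prof (σ s : ℝ) (x : XSp) : wnorm σ s (fun p => ‖prof σ s x p‖ₑ) = ‖x‖ₑ ^ 2 := by
  rw [enorm_sq_eq]
  unfold wnorm prof
  simp only [ofReal_wt_mul_enorm_div]

lemma wnorm_prof_sub (σ s : ℝ) (x y : XSp) :
    wnorm σ s (fun p => ‖prof σ s x p - prof σ s y p‖ₑ) = ‖x - y‖ₑ ^ 2 := by
  rw [enorm_sq_eq]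
  unfold wnorm prof
  refine lintegral_congr_ae ?_
  filter_upwards [Lp.coeFn_sub x y] with p hp
  rw [← sub_div, ofReal_wt_mul_enorm_div, hp]; rfl

lemma ae_lt_top_of_wnorm {σ s : ℝ} {f : ℝ × ℝ → ℝ≥0∞} (hf : Measurable f)
    (h : wnorm σ s f < ∞) : ∀ᵐ q, f q < ∞ := by
  have := ae_lt_top (by fun_prop) h.ne
  filter_upwards [this] with q hq
  have h1 : ENNReal.ofReal (wt σ s q) * f q < ∞ := by
    by_contra hh
    rw [not_lt, top_le_iff] at hh
    simp [hh] at hq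
  by_contra hh
  rw [not_lt, top_le_iff] at hh
  rw [hh, ENNReal.mul_top (by simpa using wt_pos σ s q)] at h1
  exact lt_irrefl _ h1

lemma triC_sub (α β : ℝ) (F G : ℝ × ℝ → ℂ) (q w) :
    triC α β F F F q w - triC α β G G G q w =
      triC α β (F - G) F F q w + triC α β G (F - G) F q w + triC α β G G (F - G) q w := by
  unfold triC
  simp only [Pi.sub_apply, map_sub]; ring

lemma measurable_duh (α β T : ℝ) {F : ℝ × ℝ → ℂ} (hF : Measurable F) :
    StronglyMeasurable (duh α β T F) :=
  (measurable_duhIntegrand α β T hF hF hF).stronglyMeasurable.integral_prod_right'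

section Bound

variable {α β T σ s : ℝ} {K : ℝ≥0∞}

/-- A Bochner integral is `0` by convention where the integrand is not integrable; the finite
weighted norm of the absolute version excludes this for almost every `q`, so that differences of
Duhamel terms may be taken under the integral. -/
lemma integrable_duhIntegrand (hK : ∀ f₁ f₂ f₃ : ℝ × ℝ → ℝ≥0∞, Measurable f₁ → Measurable f₂ →
    Measurable f₃ → wnorm σ s (absDuh α β T f₁ f₂ f₃) ≤
      K * (wnorm σ s f₁ * wnorm σ s f₂ * wnorm σ s f₃)) (hKt : K < ∞) {F : ℝ × ℝ → ℂ}
    (hF : Measurable F) (hn : wnorm σ s (fun p => ‖F p‖ₑ) < ∞) :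
    ∀ᵐ q, Integrable (duhIntegrand α β T F F F q) := by
  have hm : Measurable fun p => ‖F p‖ₑ := hF.enorm
  have h := (hK _ _ _ hm hm hm).trans_lt (by finiteness)
  filter_upwards [ae_lt_top_of_wnorm (measurable_absDuh α β T hm hm hm) h] with q hq
  refine ⟨(measurable_duhIntegrand α β T hF hF hF).of_uncurry_left.aestronglyMeasurable, ?_⟩
  rw [hasFiniteIntegral_iff_enorm, lintegral_enorm_duhIntegrand]
  exact hq

lemma enorm_duh_sub_le {F G : ℝ × ℝ → ℂ} (hF : Measurable F) (hG : Measurable G) {q : ℝ × ℝ}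
    (h1 : Integrable (duhIntegrand α β T F F F q)) (h2 : Integrable (duhIntegrand α β T G G G q)) :
    ‖duh α β T F q - duh α β T G q‖ₑ ≤
      absDuh α β T (fun p => ‖(F - G) p‖ₑ) (fun p => ‖F p‖ₑ) (fun p => ‖F p‖ₑ) q +
      absDuh α β T (fun p => ‖G p‖ₑ) (fun p => ‖(F - G) p‖ₑ) (fun p => ‖F p‖ₑ) q +
      absDuh α β T (fun p => ‖G p‖ₑ) (fun p => ‖G p‖ₑ) (fun p => ‖(F - G) p‖ₑ) q := by
  unfold duh
  rw [← integral_sub h1 h2]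
  refine (enorm_integral_le_lintegral_enorm _).trans ?_
  rw [← lintegral_enorm_duhIntegrand, ← lintegral_enorm_duhIntegrand,
    ← lintegral_enorm_duhIntegrand]
  have n1 : Measurable (duhIntegrand α β T (F - G) F F q) :=
    (measurable_duhIntegrand α β T (hF.sub hG) hF hF).of_uncurry_left
  have n2 : Measurable (duhIntegrand α β T G (F - G) F q) :=
    (measurable_duhIntegrand α β T hG (hF.sub hG) hF).of_uncurry_left
  have n3 : Measurable fun z => ‖duhIntegrand α β T (F - G) F F q z‖ₑ +
      ‖duhIntegrand α β T G (F - G) F q z‖ₑ := n1.enorm.add n2.enorm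
  rw [← lintegral_add_left n1.enorm, ← lintegral_add_left n3]
  refine lintegral_mono fun z => ?_
  have : duhIntegrand α β T F F F q z - duhIntegrand α β T G G G q z =
      duhIntegrand α β T (F - G) F F q z + duhIntegrand α β T G (F - G) F q z +
        duhIntegrand α β T G G (F - G) q z := by
    unfold duhIntegrand
    rw [← mul_sub, triC_sub]; ring
  rw [this]
  exact (enorm_add_le _ _).trans (add_le_add (enorm_add_le _ _) le_rfl)

lemma wnorm_le_add {f a b c : ℝ × ℝ → ℝ≥0∞} (ma : Measurable a) (mb : Measurable b)
    (h : ∀ᵐ q, f q ≤ a q + b q + c q) :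
    wnorm σ s f ≤ 4 * (wnorm σ s a + wnorm σ s b + wnorm σ s c) := by
  have mw := (measurable_wt σ s).ennreal_ofReal
  have na : Measurable fun q => (ENNReal.ofReal (wt σ s q) * a q) ^ 2 := (mw.mul ma).pow_const 2
  have nb : Measurable fun q => (ENNReal.ofReal (wt σ s q) * b q) ^ 2 := (mw.mul mb).pow_const 2
  have nc : Measurable fun q => (ENNReal.ofReal (wt σ s q) * a q) ^ 2 +
      (ENNReal.ofReal (wt σ s q) * b q) ^ 2 := na.add nb
  unfold wnorm
  rw [← lintegral_add_left na, ← lintegral_add_left nc,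
    ← lintegral_const_mul' _ _ (by finiteness)]
  refine lintegral_mono_ae ?_
  filter_upwards [h] with q hq
  generalize ENNReal.ofReal (wt σ s q) = x
  calc _ ≤ (x * (a q + b q + c q)) ^ 2 := by gcongr
    _ = (x * a q + x * b q + x * c q) ^ 2 := by ring
    _ ≤ 2 * ((x * a q + x * b q) ^ 2 + (x * c q) ^ 2) := add_sq_le_two_mul _ _
    _ ≤ 2 * (2 * ((x * a q) ^ 2 + (x * b q) ^ 2) + 2 * (x * c q) ^ 2) := by
        gcongr
        · exact add_sq_le_two_mul _ _
        · exact le_mul_of_one_le_left' (by norm_num)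
    _ = _ := by ring

/-- The estimate `hK` is applied to each of the three terms of the telescoped difference; `12` is
these three times the `4` from squaring a sum of three. -/
lemma wnorm_duh_sub_le (hK : ∀ f₁ f₂ f₃ : ℝ × ℝ → ℝ≥0∞, Measurable f₁ → Measurable f₂ →
    Measurable f₃ → wnorm σ s (absDuh α β T f₁ f₂ f₃) ≤
      K * (wnorm σ s f₁ * wnorm σ s f₂ * wnorm σ s f₃)) (hKt : K < ∞) {F G : ℝ × ℝ → ℂ}
    (hF : Measurable F) (hG : Measurable G) {R : ℝ≥0∞} (hR : R < ∞)
    (hFn : wnorm σ s (fun p => ‖F p‖ₑ) ≤ R) (hGn : wnorm σ s (fun p => ‖G p‖ₑ) ≤ R) :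
    wnorm σ s (fun q => ‖duh α β T F q - duh α β T G q‖ₑ) ≤
      12 * K * R ^ 2 * wnorm σ s (fun p => ‖(F - G) p‖ₑ) := by
  have iF := integrable_duhIntegrand hK hKt hF (hFn.trans_lt hR)
  have iG := integrable_duhIntegrand hK hKt hG (hGn.trans_lt hR)
  have mF : Measurable fun p => ‖F p‖ₑ := hF.enorm
  have mG : Measurable fun p => ‖G p‖ₑ := hG.enorm
  have mD : Measurable fun p => ‖(F - G) p‖ₑ := (hF.sub hG).enorm
  have b1 : ∀ D x y : ℝ≥0∞, x ≤ R → y ≤ R → K * (D * x * y) ≤ K * R ^ 2 * D := by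
    intro D x y hx hy
    calc K * (D * x * y) ≤ K * (D * R * R) := by gcongr
      _ = _ := by ring
  have b2 : ∀ D x y : ℝ≥0∞, x ≤ R → y ≤ R → K * (x * D * y) ≤ K * R ^ 2 * D := by
    intro D x y hx hy
    rw [mul_comm x D]; exact b1 D x y hx hy
  have b3 : ∀ D x y : ℝ≥0∞, x ≤ R → y ≤ R → K * (x * y * D) ≤ K * R ^ 2 * D := by
    intro D x y hx hy
    rw [mul_comm (x * y) D, ← mul_assoc D]; exact b1 D x y hx hy
  have ba := (hK _ _ _ mD mF mF).trans (b1 _ _ _ hFn hFn)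
  have bb := (hK _ _ _ mG mD mF).trans (b2 _ _ _ hGn hFn)
  have bc := (hK _ _ _ mG mG mD).trans (b3 _ _ _ hGn hGn)
  have hpt := (iF.and iG).mono fun q h => enorm_duh_sub_le hF hG h.1 h.2
  refine (wnorm_le_add (measurable_absDuh α β T mD mF mF) (measurable_absDuh α β T mG mD mF)
    hpt).trans ?_
  refine (mul_le_mul_right (add_le_add (add_le_add ba bb) bc) 4).trans (le_of_eq ?_)
  generalize wnorm σ s (fun p => ‖(F - G) p‖ₑ) = D
  ring

lemma duh_zero : duh α β T (0 : ℝ × ℝ → ℂ) = 0 := by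
  funext q; simp [duh, duhIntegrand, triC]

end Bound

lemma wnorm_eq_eLpNorm (σ s : ℝ) (F : ℝ × ℝ → ℂ) :
    eLpNorm (fun p => (wt σ s p : ℂ) * F p) 2 volume ^ 2 = wnorm σ s (fun p => ‖F p‖ₑ) := by
  rw [eLpNorm_two_sq]
  unfold wnorm
  refine lintegral_congr fun p => ?_
  rw [enorm_mul, ← ofReal_norm (wt σ s p : ℂ), Complex.norm_real,
    Real.norm_of_nonneg (wt_pos σ s p).le]

lemma memLp_of_wnorm {σ s : ℝ} {F : ℝ × ℝ → ℂ} (hF : Measurable F)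
    (h : wnorm σ s (fun p => ‖F p‖ₑ) < ∞) :
    MemLp (fun p => (wt σ s p : ℂ) * F p) 2 volume := by
  refine ⟨((Complex.measurable_ofReal.comp (measurable_wt σ s)).mul hF).aestronglyMeasurable, ?_⟩
  rw [← wnorm_eq_eLpNorm] at h
  by_contra hh
  rw [not_lt, top_le_iff] at hh
  simp [hh] at h

open Classical in
/-- The weighted profile belonging to a profile. -/
def toX (σ s : ℝ) (F : ℝ × ℝ → ℂ) : XSp :=
  if h : MemLp (fun p => (wt σ s p : ℂ) * F p) 2 volume then h.toLp else 0

lemma coeFn_toX {σ s : ℝ} {F : ℝ × ℝ → ℂ} (hF : Measurable F)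
    (h : wnorm σ s (fun p => ‖F p‖ₑ) < ∞) : toX σ s F =ᵐ[volume] fun p => (wt σ s p : ℂ) * F p := by
  rw [toX, dif_pos (memLp_of_wnorm hF h)]
  exact MemLp.coeFn_toLp _

lemma prof_toX {σ s : ℝ} {F : ℝ × ℝ → ℂ} (hF : Measurable F)
    (h : wnorm σ s (fun p => ‖F p‖ₑ) < ∞) : prof σ s (toX σ s F) =ᵐ[volume] F := by
  filter_upwards [coeFn_toX hF h] with p hp
  have : ((wt σ s p : ℝ) : ℂ) ≠ 0 := by exact_mod_cast (wt_pos σ s p).ne'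
  rw [prof, hp, mul_div_cancel_left₀ _ this]

lemma wnorm_congr {σ s : ℝ} {f g : ℝ × ℝ → ℝ≥0∞} (h : f =ᵐ[volume] g) :
    wnorm σ s f = wnorm σ s g := by
  unfold wnorm
  refine lintegral_congr_ae ?_
  filter_upwards [h] with p hp
  rw [hp]

lemma enorm_toX_sq {σ s : ℝ} {F : ℝ × ℝ → ℂ} (hF : Measurable F)
    (h : wnorm σ s (fun p => ‖F p‖ₑ) < ∞) : ‖toX σ s F‖ₑ ^ 2 = wnorm σ s (fun p => ‖F p‖ₑ) := by
  rw [← wnorm_prof σ s]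
  refine wnorm_congr ?_
  filter_upwards [prof_toX hF h] with p hp
  rw [hp]

lemma enorm_toX_sub_sq {σ s : ℝ} {F G : ℝ × ℝ → ℂ} (hF : Measurable F) (hG : Measurable G)
    (h : wnorm σ s (fun p => ‖F p‖ₑ) < ∞) (h' : wnorm σ s (fun p => ‖G p‖ₑ) < ∞) :
    ‖toX σ s F - toX σ s G‖ₑ ^ 2 = wnorm σ s (fun p => ‖F p - G p‖ₑ) := by
  rw [← wnorm_prof_sub σ s]
  refine wnorm_congr ?_
  filter_upwards [prof_toX hF h, prof_toX hG h'] with p hp hq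
  rw [hp, hq]

/-- The nonlinear map in the space of weighted profiles. -/
def duhX (α β T σ s : ℝ) (x : XSp) : XSp := toX σ s (duh α β T (prof σ s x))

section Bound

variable {α β T σ s : ℝ} {K : ℝ≥0∞}

lemma wnorm_duh_le (hK : ∀ f₁ f₂ f₃ : ℝ × ℝ → ℝ≥0∞, Measurable f₁ → Measurable f₂ →
    Measurable f₃ → wnorm σ s (absDuh α β T f₁ f₂ f₃) ≤
      K * (wnorm σ s f₁ * wnorm σ s f₂ * wnorm σ s f₃)) (hKt : K < ∞) {F : ℝ × ℝ → ℂ}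
    (hF : Measurable F) {R : ℝ≥0∞} (hR : R < ∞) (hFn : wnorm σ s (fun p => ‖F p‖ₑ) ≤ R) :
    wnorm σ s (fun q => ‖duh α β T F q‖ₑ) ≤ 12 * K * R ^ 2 * wnorm σ s (fun p => ‖F p‖ₑ) := by
  have := wnorm_duh_sub_le hK hKt hF (measurable_zero (α := ℂ)) hR hFn (by simp [wnorm])
  simpa [duh_zero] using this

lemma enorm_duhX_sub_sq_le (hK : ∀ f₁ f₂ f₃ : ℝ × ℝ → ℝ≥0∞, Measurable f₁ → Measurable f₂ →
    Measurable f₃ → wnorm σ s (absDuh α β T f₁ f₂ f₃) ≤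
      K * (wnorm σ s f₁ * wnorm σ s f₂ * wnorm σ s f₃)) (hKt : K < ∞) {x y : XSp} {M : ℝ≥0∞}
    (hM : M < ∞) (hx : ‖x‖ₑ ≤ M) (hy : ‖y‖ₑ ≤ M) :
    ‖duhX α β T σ s x - duhX α β T σ s y‖ₑ ^ 2 ≤ 12 * K * (M ^ 2) ^ 2 * ‖x - y‖ₑ ^ 2 := by
  have mx := measurable_prof σ s x
  have my := measurable_prof σ s y
  have hx' : wnorm σ s (fun p => ‖prof σ s x p‖ₑ) ≤ M ^ 2 := by rw [wnorm_prof]; gcongr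
  have hy' : wnorm σ s (fun p => ‖prof σ s y p‖ₑ) ≤ M ^ 2 := by rw [wnorm_prof]; gcongr
  have hMt : M ^ 2 < ∞ := by finiteness
  unfold duhX
  rw [enorm_toX_sub_sq (measurable_duh α β T mx).measurable (measurable_duh α β T my).measurable,
    ← wnorm_prof_sub σ s]
  · exact wnorm_duh_sub_le hK hKt mx my hMt hx' hy'
  · exact (wnorm_duh_le hK hKt mx hMt hx').trans_lt
      (ENNReal.mul_lt_top (by finiteness) (hx'.trans_lt hMt))
  · exact (wnorm_duh_le hK hKt my hMt hy').trans_lt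
      (ENNReal.mul_lt_top (by finiteness) (hy'.trans_lt hMt))

lemma duhX_zero (hK : ∀ f₁ f₂ f₃ : ℝ × ℝ → ℝ≥0∞, Measurable f₁ → Measurable f₂ →
    Measurable f₃ → wnorm σ s (absDuh α β T f₁ f₂ f₃) ≤
      K * (wnorm σ s f₁ * wnorm σ s f₂ * wnorm σ s f₃)) (hKt : K < ∞) :
    duhX α β T σ s 0 = 0 := by
  have m := measurable_prof σ s 0
  have h0 : wnorm σ s (fun p => ‖prof σ s 0 p‖ₑ) = 0 := by rw [wnorm_prof]; simp
  have h1 : wnorm σ s (fun q => ‖duh α β T (prof σ s 0) q‖ₑ) = 0 := by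
    have := wnorm_duh_le hK hKt m (R := 0) (by simp) h0.le
    simpa using this
  have := enorm_toX_sq (measurable_duh α β T m).measurable (h1.trans_lt (by simp))
  rw [h1] at this
  unfold duhX
  simpa using this

end Bound

/-- The fixed point argument for small Lipschitz perturbations of a constant. -/
lemma exists_fixedPoint {E : Type*} [NormedAddCommGroup E] [CompleteSpace E] {A : E → E} {R : ℝ}
    (hA0 : A 0 = 0) (hA : ∀ x y, ‖x‖ ≤ 2 * R → ‖y‖ ≤ 2 * R → ‖A x - A y‖ ≤ 1 / 2 * ‖x - y‖)
    {g : E} (hg : ‖g‖ ≤ R) : ∃ x, ‖x‖ ≤ 2 * R ∧ x = g - A x := by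
  have hR : 0 ≤ R := (norm_nonneg g).trans hg
  have hmaps : MapsTo (fun x => g - A x) (Metric.closedBall 0 (2 * R))
      (Metric.closedBall 0 (2 * R)) := by
    intro x hx
    rw [mem_closedBall_zero_iff] at hx ⊢
    have := hA x 0 hx (by simpa using hR)
    rw [hA0, sub_zero, sub_zero] at this
    linarith [norm_sub_le g (A x)]
  have hc : ContractingWith (1 / 2) (hmaps.restrict _ _ _) := by
    refine ⟨by norm_num, LipschitzWith.of_dist_le_mul fun x y => ?_⟩
    rw [Subtype.dist_eq, Subtype.dist_eq]
    simp only [MapsTo.val_restrict_apply, dist_eq_norm, sub_sub_sub_cancel_left]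
    rw [norm_sub_rev (x : E)]
    simpa using hA y x (mem_closedBall_zero_iff.1 y.2) (mem_closedBall_zero_iff.1 x.2)
  obtain ⟨x, hx, hfix, -⟩ := hc.exists_fixedPoint' Metric.isClosed_closedBall.isComplete hmaps
    (x := 0) (by simpa using hR) (edist_ne_top _ _)
  exact ⟨x, by simpa using hx, hfix.symm⟩

/-- Subtracting the two equations leaves `½‖x - x'‖` on the right, which is absorbed. -/
lemma norm_sub_le_of_fixedPoint {E : Type*} [NormedAddCommGroup E] {A : E → E} {R : ℝ}
    (hA : ∀ x y, ‖x‖ ≤ 2 * R → ‖y‖ ≤ 2 * R → ‖A x - A y‖ ≤ 1 / 2 * ‖x - y‖)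
    {g g' x x' : E} (hx : ‖x‖ ≤ 2 * R) (hx' : ‖x'‖ ≤ 2 * R) (h : x = g - A x)
    (h' : x' = g' - A x') : ‖x - x'‖ ≤ 2 * ‖g - g'‖ := by
  have h1 : x - x' = (g - g') - (A x - A x') := by
    nth_rw 1 [h, h']; abel
  have := norm_sub_le (g - g') (A x - A x')
  rw [← h1] at this
  linarith [hA x x' hx hx']

end

/-! ### Existence of profiles and Lipschitz dependence on the data -/

section

/-- The profile of the linear evolution, localised in time. -/
def lin (h : ℝ → ℂ) (p : ℝ × ℝ) : ℂ := cutoff p.2 * h p.1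

/-- The squared weighted norm of the initial data on the Fourier side. -/
def hnorm (σ s : ℝ) (h : ℝ → ℂ) : ℝ≥0∞ := ∫⁻ ξ, (ENNReal.ofReal (gw σ s ξ) * ‖h ξ‖ₑ) ^ 2

lemma measurable_lin {h : ℝ → ℂ} (hh : Measurable h) : Measurable (lin h) := by
  have := measurable_cutoff
  unfold lin; fun_prop

/-- The profile is a product of functions of `τ` and of `ξ`, so the norm factors. As the cutoff is
not rescaled, the constant does not depend on the time interval. -/
lemma exists_wnorm_lin : ∃ c : ℝ≥0∞, c < ∞ ∧ ∀ σ s : ℝ, ∀ h : ℝ → ℂ, Measurable h →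
    wnorm σ s (fun p => ‖lin h p‖ₑ) = c * hnorm σ s h := by
  obtain ⟨C, hC0, hC, -⟩ := exists_cutoff_le
  have mc := measurable_cutoff
  have mj := measurable_jb
  refine ⟨∫⁻ τ, (ENNReal.ofReal (jb τ ^ (3 / 4 : ℝ)) * ‖cutoff τ‖ₑ) ^ 2, ?_, fun σ s h hh => ?_⟩
  · calc _ ≤ ∫⁻ τ, ENNReal.ofReal (C ^ 2) * ENNReal.ofReal (jb τ ^ (-(13 / 2) : ℝ)) := by
          refine lintegral_mono fun τ => ?_
          rw [← ofReal_norm, ← ENNReal.ofReal_mul (jb_rpow_nonneg _ _),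
            ← ENNReal.ofReal_pow (by positivity [jb_rpow_nonneg τ (3/4)]), ← ENNReal.ofReal_mul (sq_nonneg _)]
          refine ENNReal.ofReal_le_ofReal ?_
          have := hC τ
          calc (jb τ ^ (3 / 4 : ℝ) * ‖cutoff τ‖) ^ 2
              ≤ (jb τ ^ (3 / 4 : ℝ) * (C * jb τ ^ (-4 : ℝ))) ^ 2 := by
                have := jb_rpow_nonneg τ (3 / 4)
                gcongr
            _ = C ^ 2 * (jb τ ^ (3 / 4 : ℝ) * jb τ ^ (-4 : ℝ)) ^ 2 := by ring
            _ = _ := by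
              rw [← Real.rpow_add (jb_pos τ), ← Real.rpow_natCast (jb τ ^ _),
                ← Real.rpow_mul (jb_nonneg τ)]
              norm_num
      _ < ∞ := by
        rw [lintegral_const_mul' _ _ ENNReal.ofReal_ne_top]
        exact ENNReal.mul_lt_top ENNReal.ofReal_lt_top (jbInt_lt_top (r := 13 / 2) (by norm_num))
  · unfold wnorm hnorm lin wt
    have mg := measurable_gw σ s
    rw [Measure.volume_eq_prod, lintegral_prod _ (by fun_prop), mul_comm,
      ← lintegral_mul_const _ (by fun_prop)]
    refine lintegral_congr fun ξ => ?_
    rw [← lintegral_const_mul _ (by fun_prop)]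
    refine lintegral_congr fun τ => ?_
    simp only [enorm_mul]
    rw [ENNReal.ofReal_mul (gw_pos _ _ _).le]; ring

lemma norm_le_mul_of_enorm_sq_le {E F : Type*} [NormedAddCommGroup E] [NormedAddCommGroup F]
    {a : E} {b : F} {k : ℝ≥0∞} {l : ℝ} (hl : 0 ≤ l) (hk : k ≤ ENNReal.ofReal (l ^ 2))
    (h : ‖a‖ₑ ^ 2 ≤ k * ‖b‖ₑ ^ 2) : ‖a‖ ≤ l * ‖b‖ := by
  have h1 := h.trans (mul_le_mul_left hk _)
  rw [← ofReal_norm, ← ofReal_norm, ← ENNReal.ofReal_pow (norm_nonneg _),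
    ← ENNReal.ofReal_pow (norm_nonneg _), ← ENNReal.ofReal_mul (sq_nonneg _), ← mul_pow,
    ENNReal.ofReal_le_ofReal_iff (sq_nonneg _)] at h1
  exact (sq_le_sq₀ (norm_nonneg _) (by positivity)).1 h1

/-- The profile of the solution of the initial value problem with data `h` on the Fourier
side. -/
structure IsProfile (α β γ σ s T : ℝ) (h : ℝ → ℂ) (F : ℝ × ℝ → ℂ) : Prop where
  measurable : Measurable F
  wnorm_lt : wnorm σ s (fun p => ‖F p‖ₑ) < ∞
  eq : ∀ᵐ q, F q = lin h q - Complex.I * γ * duh α β T F q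

lemma isProfile_of_fixedPoint {α β γ T σ s : ℝ} {K : ℝ≥0∞}
    (hK : ∀ f₁ f₂ f₃ : ℝ × ℝ → ℝ≥0∞, Measurable f₁ → Measurable f₂ →
    Measurable f₃ → wnorm σ s (absDuh α β T f₁ f₂ f₃) ≤
      K * (wnorm σ s f₁ * wnorm σ s f₂ * wnorm σ s f₃)) (hKt : K < ∞) {h : ℝ → ℂ}
    (hh : Measurable h) (hl : wnorm σ s (fun p => ‖lin h p‖ₑ) < ∞) {x : XSp}
    (hx : x = toX σ s (lin h) - (Complex.I * γ : ℂ) • duhX α β T σ s x) :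
    IsProfile α β γ σ s T h (prof σ s x) := by
  have m := measurable_prof σ s x
  have hw : wnorm σ s (fun p => ‖prof σ s x p‖ₑ) < ∞ := by
    rw [wnorm_prof]; exact ENNReal.pow_lt_top enorm_lt_top
  have hd := (wnorm_duh_le hK hKt m hw le_rfl).trans_lt (ENNReal.mul_lt_top (by finiteness) hw)
  refine ⟨m, hw, ?_⟩
  have h1 := coeFn_toX (measurable_lin hh) hl
  have h2 := coeFn_toX (measurable_duh α β T m).measurable hd
  have h3 := Lp.coeFn_sub (toX σ s (lin h)) ((Complex.I * γ : ℂ) • duhX α β T σ s x)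
  rw [← hx] at h3
  filter_upwards [h1, h2, h3, Lp.coeFn_smul (Complex.I * γ : ℂ) (duhX α β T σ s x)]
    with q e1 e2 e3 e4
  have hne : ((wt σ s q : ℝ) : ℂ) ≠ 0 := by exact_mod_cast (wt_pos σ s q).ne'
  have e2' : duhX α β T σ s x q = (wt σ s q : ℂ) * duh α β T (prof σ s x) q := e2
  rw [prof, e3, Pi.sub_apply, e4, Pi.smul_apply, e1, e2', smul_eq_mul]
  field_simp

/-- Contraction in the space of weighted profiles. The ball is sized for data of norm up to `r + 1`:
the extra unit leaves room for a neighbourhood of the given data on the same time interval. The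
Duhamel estimate gains `T^κ` with `κ = 1/4 - ρ > 0`, so a small `T₀ r` makes the Lipschitz constant
at most `1/2`. None of the constants involves `σ` or `s`. -/
theorem exists_profile {ρ : ℝ} (h0 : 0 < ρ) (h1 : ρ < 1 / 4) (α : ℝ) {β : ℝ} (hβ : β ≠ 0)
    (γ : ℝ) : ∃ T₀ : ℝ≥0∞ → ℝ, (∀ r, 0 < T₀ r) ∧ (∀ r, T₀ r ≤ 1) ∧ ∃ c : ℝ≥0∞, c < ∞ ∧
      ∀ (σ s : ℝ) (r : ℝ≥0∞), 0 ≤ σ → -ρ ≤ s → ∃ P : (ℝ → ℂ) → ℝ × ℝ → ℂ,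
        (∀ h, Measurable h → hnorm σ s h ≤ ENNReal.ofReal ((r.toReal + 1) ^ 2) →
          IsProfile α β γ σ s (T₀ r) h (P h)) ∧
        ∀ h h', Measurable h → Measurable h' →
          hnorm σ s h ≤ ENNReal.ofReal ((r.toReal + 1) ^ 2) →
          hnorm σ s h' ≤ ENNReal.ofReal ((r.toReal + 1) ^ 2) →
          wnorm σ s (fun p => ‖P h p - P h' p‖ₑ) ≤ c * hnorm σ s (fun ξ => h ξ - h' ξ) := by
  obtain ⟨C, hC, hd⟩ := exists_absDuh_le h0 h1 α hβ
  obtain ⟨cl, hcl, hl⟩ := exists_wnorm_lin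
  set κ : ℝ := 1 / 4 - ρ with hκ
  have hκ0 : 0 < κ := by linarith
  -- The summand `1` ensures `12 C ≤ C' ≤ C'²`, which avoids a square root in the Lipschitz
  -- constant.
  set C' : ℝ := 12 * C.toReal + 1 with hC'
  have hC'0 : 1 ≤ C' := by rw [hC']; linarith [C.toReal_nonneg]
  set R : ℝ≥0∞ → ℝ := fun r => (cl.toReal + 1) * (r.toReal + 1) with hR
  have hR0 : ∀ r, 0 < R r := fun r => by
    have := cl.toReal_nonneg; have := r.toReal_nonneg; positivity
  set D : ℝ≥0∞ → ℝ := fun r => 2 * |γ| * C' * (2 * R r) ^ 2 + 1 with hD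
  have hD1 : ∀ r, 1 ≤ D r := fun r => by
    have := hR0 r
    have : 0 ≤ 2 * |γ| * C' * (2 * R r) ^ 2 := by positivity
    simp only [hD]; linarith
  -- Chosen so that `T₀^κ = 1/D`; the Lipschitz constant is then `|γ| C' (2R)² / D ≤ 1/2`.
  set T₀ : ℝ≥0∞ → ℝ := fun r => D r ^ (-(1 / κ)) with hT₀
  have hT0 : ∀ r, 0 < T₀ r := fun r => Real.rpow_pos_of_pos (by linarith [hD1 r]) _
  have hT1 : ∀ r, T₀ r ≤ 1 := fun r =>
    Real.rpow_le_one_of_one_le_of_nonpos (hD1 r) (by simp only [one_div, Left.neg_nonpos_iff]; positivity)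
  have hTκ : ∀ r, T₀ r ^ κ = (D r)⁻¹ := fun r => by
    rw [hT₀, ← Real.rpow_mul (by linarith [hD1 r]), ← Real.rpow_neg_one]
    congr 1; field_simp
  refine ⟨T₀, hT0, hT1, 4 * cl, by finiteness, fun σ s r hσ hs => ?_⟩
  set K := C * ENNReal.ofReal (T₀ r ^ κ) ^ 2 with hKdef
  have hKt : K < ∞ := by finiteness
  have hK : ∀ f₁ f₂ f₃ : ℝ × ℝ → ℝ≥0∞, Measurable f₁ → Measurable f₂ →
      Measurable f₃ → wnorm σ s (absDuh α β (T₀ r) f₁ f₂ f₃) ≤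
        K * (wnorm σ s f₁ * wnorm σ s f₂ * wnorm σ s f₃) :=
    fun f₁ f₂ f₃ => hd σ s (T₀ r) hσ hs (hT0 r) (hT1 r) f₁ f₂ f₃
  set A : XSp → XSp := fun x => (Complex.I * γ : ℂ) • duhX α β (T₀ r) σ s x with hA
  have hAL : ∀ x y, ‖x‖ ≤ 2 * R r → ‖y‖ ≤ 2 * R r → ‖A x - A y‖ ≤ 1 / 2 * ‖x - y‖ := by
    intro x y hx hy
    have hx' : ‖x‖ₑ ≤ ENNReal.ofReal (2 * R r) := by
      rw [← ofReal_norm]; exact ENNReal.ofReal_le_ofReal hx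
    have hy' : ‖y‖ₑ ≤ ENNReal.ofReal (2 * R r) := by
      rw [← ofReal_norm]; exact ENNReal.ofReal_le_ofReal hy
    have hRr := hR0 r
    have hDr : 0 < D r := by linarith [hD1 r]
    have := norm_le_mul_of_enorm_sq_le (l := C' * (D r)⁻¹ * (2 * R r) ^ 2) (by positivity) ?_
      (enorm_duhX_sub_sq_le hK hKt ENNReal.ofReal_lt_top hx' hy')
    · simp only [hA]
      rw [← smul_sub, norm_smul, norm_mul, Complex.norm_I, one_mul, Complex.norm_real,
        Real.norm_eq_abs]
      calc |γ| * _ ≤ |γ| * (C' * (D r)⁻¹ * (2 * R r) ^ 2 * ‖x - y‖) := by gcongr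
        _ = (|γ| * C' * (2 * R r) ^ 2 / D r) * ‖x - y‖ := by field_simp
        _ ≤ 1 / 2 * ‖x - y‖ := by
          refine mul_le_mul_of_nonneg_right ?_ (norm_nonneg _)
          rw [div_le_div_iff₀ hDr (by norm_num)]
          simp only [hD]; linarith
    · rw [hKdef, hTκ r, ← ENNReal.ofReal_pow (by positivity), ← ENNReal.ofReal_pow (by positivity),
        ← ENNReal.ofReal_pow (by positivity), ← ENNReal.ofReal_toReal hC.ne,
        show (12 : ℝ≥0∞) = ENNReal.ofReal 12 by norm_num, ← ENNReal.ofReal_mul (by positivity),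
        ← ENNReal.ofReal_mul (by positivity), ← ENNReal.ofReal_mul (by positivity)]
      refine ENNReal.ofReal_le_ofReal ?_
      have hc : 12 * C.toReal ≤ C' ^ 2 := by
        have : C' ≤ C' ^ 2 := by nlinarith
        linarith
      calc _ = (12 * C.toReal) * ((D r)⁻¹ * (2 * R r) ^ 2) ^ 2 := by ring
        _ ≤ C' ^ 2 * ((D r)⁻¹ * (2 * R r) ^ 2) ^ 2 := by gcongr
        _ = _ := by ring
  have hA0 : A 0 = 0 := by simp only [hA]; rw [duhX_zero hK hKt, smul_zero]
  have hlt : ∀ h, Measurable h → hnorm σ s h ≤ ENNReal.ofReal ((r.toReal + 1) ^ 2) →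
      wnorm σ s (fun p => ‖lin h p‖ₑ) < ∞ := fun h hm hh => by
    rw [hl σ s h hm]
    exact ENNReal.mul_lt_top hcl (hh.trans_lt ENNReal.ofReal_lt_top)
  have hg : ∀ h, Measurable h → hnorm σ s h ≤ ENNReal.ofReal ((r.toReal + 1) ^ 2) →
      ‖toX σ s (lin h)‖ ≤ R r := fun h hm hh => by
    have := norm_le_mul_of_enorm_sq_le (a := toX σ s (lin h)) (b := r.toReal + 1)
      (k := cl) (l := cl.toReal + 1) (by positivity) ?_ ?_
    · rwa [Real.norm_of_nonneg (by positivity)] at this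
    · conv_lhs => rw [← ENNReal.ofReal_toReal hcl.ne]
      exact ENNReal.ofReal_le_ofReal (by nlinarith [cl.toReal_nonneg])
    · rw [enorm_toX_sq (measurable_lin hm) (hlt h hm hh), hl σ s h hm,
        Real.enorm_of_nonneg (by positivity), ← ENNReal.ofReal_pow (by positivity)]
      gcongr
  have hfix : ∀ h, ∃ x : XSp, Measurable h → hnorm σ s h ≤ ENNReal.ofReal ((r.toReal + 1) ^ 2) →
      ‖x‖ ≤ 2 * R r ∧ x = toX σ s (lin h) - A x := by
    intro h
    by_cases hh : Measurable h ∧ hnorm σ s h ≤ ENNReal.ofReal ((r.toReal + 1) ^ 2)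
    · obtain ⟨x, hx⟩ := exists_fixedPoint hA0 hAL (hg h hh.1 hh.2)
      exact ⟨x, fun _ _ => hx⟩
    · exact ⟨0, fun a b => absurd ⟨a, b⟩ hh⟩
  choose Q hQ using hfix
  refine ⟨fun h => prof σ s (Q h), fun h hm hh => ?_, fun h h' hm hm' hh hh' => ?_⟩
  · exact isProfile_of_fixedPoint hK hKt hm (hlt h hm hh) (hQ h hm hh).2
  · obtain ⟨b1, e1⟩ := hQ h hm hh
    obtain ⟨b2, e2⟩ := hQ h' hm' hh'
    have := norm_sub_le_of_fixedPoint hAL b1 b2 e1 e2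
    rw [wnorm_prof_sub, mul_assoc, ← hl σ s (fun ξ => h ξ - h' ξ) (hm.sub hm')]
    have e3 := enorm_toX_sub_sq (measurable_lin hm) (measurable_lin hm') (hlt h hm hh)
      (hlt h' hm' hh')
    have e4 : ∀ p, lin (fun ξ => h ξ - h' ξ) p = lin h p - lin h' p := fun p => by
      simp only [lin]; ring
    simp only [e4]
    rw [← e3, ← ofReal_norm, ← ofReal_norm, ← ENNReal.ofReal_pow (norm_nonneg _),
      ← ENNReal.ofReal_pow (norm_nonneg _), show (4 : ℝ≥0∞) = ENNReal.ofReal 4 by norm_num,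
      ← ENNReal.ofReal_mul (by norm_num)]
    refine ENNReal.ofReal_le_ofReal ?_
    calc _ ≤ (2 * ‖toX σ s (lin h) - toX σ s (lin h')‖) ^ 2 := by gcongr
      _ = _ := by ring

end

/-! ### Oscillatory integrals and the Fourier transform on `L²` -/

section

section Bridge

variable {V : Type*} [NormedAddCommGroup V] [InnerProductSpace ℝ V] [MeasurableSpace V]
  [BorelSpace V] [FiniteDimensional ℝ V]

lemma continuous_fourierInv {g : V → ℂ} (h1 : Integrable g) : Continuous (𝓕⁻ g) :=
  VectorFourier.fourierIntegral_continuous Real.continuous_fourierChar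
    (by exact continuous_inner.neg) h1

/-- On integrable functions the `L²` inverse Fourier transform is given by the integral. -/
lemma fourierInv_toLp_ae {g : V → ℂ} (h1 : Integrable g) (h2 : MemLp g 2 volume) :
    ⇑(𝓕⁻ (h2.toLp g) : Lp ℂ 2 (volume : Measure V)) =ᵐ[volume] 𝓕⁻ g := by
  refine ae_eq_of_integral_contDiff_smul_eq
    ((Lp.memLp (𝓕⁻ (h2.toLp g))).locallyIntegrable one_le_two)
    (continuous_fourierInv h1).locallyIntegrable fun φ hφ hc => ?_
  have hg₁ : HasCompactSupport (Complex.ofRealCLM ∘ φ) := hc.comp_left rfl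
  have hg₂ : ContDiff ℝ ((⊤ : ℕ∞) : WithTop ℕ∞) (Complex.ofRealCLM ∘ φ) :=
    Complex.ofRealCLM.contDiff.comp hφ
  set Φ : SchwartzMap V ℂ := hg₁.toSchwartzMap hg₂ with hΦ
  have hΦφ : ∀ x, Φ x = (φ x : ℂ) := fun x => rfl
  -- As a tempered distribution the `L²` transform is moved onto the test function; the symmetry of
  -- the integral transform then moves it back onto `g`.
  have e1 : (∫ x, φ x • (𝓕⁻ (h2.toLp g) : Lp ℂ 2 (volume : Measure V)) x) =
      Lp.toTemperedDistribution (𝓕⁻ (h2.toLp g)) Φ := by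
    rw [Lp.toTemperedDistribution_apply]
    simp only [hΦφ, Complex.real_smul, smul_eq_mul]
  have e2 : (∫ x, (𝓕⁻ Φ) x • (h2.toLp g) x) = ∫ x, (𝓕⁻ Φ) x • g x := by
    refine integral_congr_ae ?_
    filter_upwards [h2.coeFn_toLp] with x hx
    rw [hx]
  have e3 : (∫ x, (𝓕⁻ Φ) x • g x) = ∫ x, Φ x • 𝓕⁻ g x := by
    have := VectorFourier.integral_fourierIntegral_smul_eq_flip (L := -innerₗ V) (μ := volume)
      (ν := volume) (f := Φ) (g := g) Real.continuous_fourierChar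
      (by exact continuous_inner.neg) Φ.integrable h1
    have hfl : (-innerₗ V).flip = -innerₗ V := by
      ext x y; simp [real_inner_comm]
    rw [hfl] at this
    rw [SchwartzMap.fourierInv_coe]
    exact this
  rw [e1, ← Lp.fourierInv_toTemperedDistribution_eq, TemperedDistribution.fourierInv_apply,
    Lp.toTemperedDistribution_apply, e2, e3]
  simp only [hΦφ, Complex.real_smul, smul_eq_mul]

/-- The oscillatory integral `∫ e^{i⟨ξ,x⟩} g(ξ) dξ`. -/
def osc (g : V → ℂ) (x : V) : ℂ := ∫ ξ, ex (inner ℝ ξ x) * g ξ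

/-- The rescaling of a function on the frequency side. -/
def rescale (g : V → ℂ) (η : V) : ℂ :=
  ((2 * Real.pi) ^ Module.finrank ℝ V : ℝ) * g ((2 * Real.pi) • η)

/-- The substitution `ξ = 2πη` passes from angular frequency to the normalised character; its
Jacobian is part of `rescale`. -/
lemma osc_eq_fourierInv (g : V → ℂ) : osc g = 𝓕⁻ (rescale g) := by
  funext x
  rw [Real.fourierInv_eq']
  have := Measure.integral_comp_smul volume (fun ξ : V => ex (inner ℝ ξ x) * g ξ) (2 * Real.pi)
  have hpi : (0 : ℝ) < (2 * Real.pi) ^ Module.finrank ℝ V := by positivity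
  rw [abs_of_pos (inv_pos.2 hpi), eq_comm, inv_smul_eq_iff₀ hpi.ne', ← integral_smul] at this
  unfold osc
  rw [this]
  refine integral_congr_ae (ae_of_all _ fun η => ?_)
  simp only [rescale, Complex.real_smul, smul_eq_mul, ex, inner_smul_left, conj_trivial]
  rw [mul_left_comm, mul_comm Complex.I]

lemma memLp_comp_smul {g : V → ℂ} (hm : Measurable g) (h : MemLp g 2 volume) {R : ℝ}
    (hR : R ≠ 0) : MemLp (fun η => g (R • η)) 2 volume := by
  have hm' : Measurable fun η => g (R • η) := hm.comp (measurable_const_smul R)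
  rw [memLp_two_iff_integrable_sq_norm hm'.aestronglyMeasurable]
  rw [memLp_two_iff_integrable_sq_norm hm.aestronglyMeasurable] at h
  exact h.comp_smul hR

lemma integrable_rescale {g : V → ℂ} (h : Integrable g) : Integrable (rescale g) :=
  (h.comp_smul (by positivity)).const_mul _

lemma memLp_rescale {g : V → ℂ} (hm : Measurable g) (h : MemLp g 2 volume) :
    MemLp (rescale g) 2 volume :=
  (memLp_comp_smul hm h (by positivity)).const_mul _

lemma continuous_osc {g : V → ℂ} (h : Integrable g) : Continuous (osc g) := by
  rw [osc_eq_fourierInv]; exact continuous_fourierInv (integrable_rescale h)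

lemma memLp_osc {g : V → ℂ} (hm : Measurable g) (h1 : Integrable g) (h2 : MemLp g 2 volume) :
    MemLp (osc g) 2 volume := by
  rw [osc_eq_fourierInv, ← memLp_congr_ae (fourierInv_toLp_ae (integrable_rescale h1)
    (memLp_rescale hm h2))]
  exact Lp.memLp _

lemma toLp_osc {g : V → ℂ} (hm : Measurable g) (h1 : Integrable g) (h2 : MemLp g 2 volume) :
    (memLp_osc hm h1 h2).toLp (osc g) = 𝓕⁻ ((memLp_rescale hm h2).toLp (rescale g)) := by
  refine Lp.ext ?_
  filter_upwards [(memLp_osc hm h1 h2).coeFn_toLp, fourierInv_toLp_ae (integrable_rescale h1)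
    (memLp_rescale hm h2)] with x hx hx'
  rw [hx, hx', osc_eq_fourierInv]

lemma fourier_toLp_osc {g : V → ℂ} (hm : Measurable g) (h1 : Integrable g)
    (h2 : MemLp g 2 volume) : ∀ᵐ ξ : V, (𝓕 ((memLp_osc hm h1 h2).toLp (osc g)) :
      Lp ℂ 2 (volume : Measure V)) ((2 * Real.pi)⁻¹ • ξ) =
      ((2 * Real.pi) ^ Module.finrank ℝ V : ℝ) * g ξ := by
  rw [toLp_osc hm h1 h2, FourierTransform.fourier_fourierInv_eq]
  have := (Measure.quasiMeasurePreserving_smul (volume : Measure V)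
    (r := (2 * Real.pi)⁻¹) (by positivity)).ae (memLp_rescale hm h2).coeFn_toLp
  filter_upwards [this] with ξ hξ
  rw [hξ, rescale, smul_inv_smul₀ (by positivity)]

end Bridge

lemma osc_real (g : ℝ → ℂ) (x : ℝ) : osc g x = ∫ ξ, ex (x * ξ) * g ξ := by
  simp [osc]

lemma hat_osc {g : ℝ → ℂ} (hm : Measurable g) (h1 : Integrable g) (h2 : MemLp g 2 volume) :
    ∀ᵐ ξ, hat ((memLp_osc hm h1 h2).toLp (osc g)) ξ = (2 * Real.pi : ℝ) * g ξ := by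
  filter_upwards [fourier_toLp_osc hm h1 h2] with ξ hξ
  rw [hat, div_eq_inv_mul, ← smul_eq_mul (_⁻¹), hξ]
  simp

lemma hat₂_osc {g : Plane → ℂ} (hm : Measurable g) (h1 : Integrable g) (h2 : MemLp g 2 volume) :
    ∀ᵐ p, hat₂ ((memLp_osc hm h1 h2).toLp (osc g)) p = ((2 * Real.pi) ^ 2 : ℝ) * g p := by
  filter_upwards [fourier_toLp_osc hm h1 h2] with p hp
  rw [hat₂, hp]
  simp

lemma measurable_hat (f : Lp ℂ 2 (volume : Measure ℝ)) : Measurable (hat f) := by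
  have := (Lp.stronglyMeasurable (𝓕 f)).measurable
  unfold hat
  fun_prop

lemma memLp_hat (f : Lp ℂ 2 (volume : Measure ℝ)) : MemLp (hat f) 2 volume := by
  have := memLp_comp_smul (Lp.stronglyMeasurable (𝓕 f)).measurable (Lp.memLp (𝓕 f))
    (R := (2 * Real.pi)⁻¹) (by positivity)
  refine this.ae_eq (ae_of_all _ fun ξ => ?_)
  simp [hat, div_eq_inv_mul]

/-- Fourier inversion. -/
lemma osc_hat {f : Lp ℂ 2 (volume : Measure ℝ)} (h1 : Integrable (hat f)) :
    osc (fun ξ => hat f ξ / (2 * Real.pi : ℝ)) =ᵐ[volume] f := by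
  set g := fun ξ => hat f ξ / (2 * Real.pi : ℝ) with hg
  have hm : Measurable g := (measurable_hat f).div_const _
  have h1' : Integrable g := h1.div_const _
  have h2 : MemLp g 2 volume := by
    have := (memLp_hat f).const_mul ((2 * Real.pi : ℝ) : ℂ)⁻¹
    refine this.ae_eq (ae_of_all _ fun ξ => ?_)
    simp only [hg]; ring
  have hr : (memLp_rescale hm h2).toLp (rescale g) = 𝓕 f := by
    refine Lp.ext ?_
    filter_upwards [(memLp_rescale hm h2).coeFn_toLp] with η hη
    rw [hη, rescale, hg]
    simp only [hat, smul_eq_mul, Module.finrank_self, pow_one]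
    have hpi : (2 * Real.pi : ℝ) ≠ 0 := by positivity
    have hpi' : ((2 * Real.pi : ℝ) : ℂ) ≠ 0 := by exact_mod_cast hpi
    rw [mul_div_cancel₀ _ hpi', mul_div_cancel_left₀ _ hpi]
  have := toLp_osc hm h1' h2
  rw [hr, FourierTransform.fourierInv_fourier_eq] at this
  have h3 := (memLp_osc hm h1' h2).coeFn_toLp
  rw [this] at h3
  exact h3.symm

end

/-! ### Regularity from the Gevrey weight -/

section

/-- One term of the exponential series at `σ⟨ξ⟩ = σ + σ|ξ|` bounds `⟨ξ⟩^n` by a multiple of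
`e^{σ|ξ|}`; taking `n ≥ k - s` compensates for the factor `⟨ξ⟩^s`, whatever its sign. -/
lemma exists_jb_pow_le_gw {σ : ℝ} (hσ : 0 < σ) (s : ℝ) (k : ℕ) :
    ∃ C : ℝ, 0 ≤ C ∧ ∀ ξ, jb ξ ^ k ≤ C * gw σ s ξ := by
  obtain ⟨n, hn⟩ := exists_nat_ge ((k : ℝ) - s)
  refine ⟨n.factorial * (σ ^ n)⁻¹ * Real.exp σ, by positivity, fun ξ => ?_⟩
  have h1 := Real.pow_div_factorial_le_exp (σ * jb ξ) (by have := jb_pos ξ; positivity) n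
  have h2 : jb ξ ^ n ≤ n.factorial * (σ ^ n)⁻¹ * Real.exp σ * Real.exp (σ * |ξ|) := by
    rw [div_le_iff₀ (by positivity), mul_pow, jb, mul_add, mul_one, Real.exp_add] at h1
    have hs : 0 < σ ^ n := by positivity
    rw [jb]
    calc (1 + |ξ|) ^ n = (σ ^ n)⁻¹ * (σ ^ n * (1 + |ξ|) ^ n) := by field_simp
      _ ≤ (σ ^ n)⁻¹ * (Real.exp σ * Real.exp (σ * |ξ|) * n.factorial) := by gcongr
      _ = _ := by ring
  have h3 : jb ξ ^ k = jb ξ ^ ((k : ℝ) - s) * jb ξ ^ s := by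
    rw [← Real.rpow_add (jb_pos ξ), sub_add_cancel, Real.rpow_natCast]
  have h4 : jb ξ ^ ((k : ℝ) - s) ≤ jb ξ ^ n := by
    rw [← Real.rpow_natCast]
    exact Real.rpow_le_rpow_of_exponent_le (one_le_jb ξ) hn
  rw [h3, gw, ← mul_assoc]
  exact mul_le_mul_of_nonneg_right (h4.trans h2) (jb_rpow_nonneg _ _)

lemma exists_lintegral_sq_le {σ : ℝ} (hσ : 0 < σ) (s : ℝ) (k : ℕ) : ∃ C : ℝ≥0∞, C < ∞ ∧
    ∀ g : ℝ → ℝ≥0∞, ∫⁻ ξ, (ENNReal.ofReal (jb ξ ^ k) * g ξ) ^ 2 ≤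
      C * ∫⁻ ξ, (ENNReal.ofReal (gw σ s ξ) * g ξ) ^ 2 := by
  obtain ⟨C, hC0, hC⟩ := exists_jb_pow_le_gw hσ s k
  refine ⟨ENNReal.ofReal C ^ 2, by finiteness, fun g => ?_⟩
  rw [← lintegral_const_mul' _ _ (by finiteness)]
  refine lintegral_mono fun ξ => ?_
  rw [← mul_pow, ← mul_assoc, ← ENNReal.ofReal_mul hC0]
  gcongr
  exact hC ξ

/-- Cauchy-Schwarz against `⟨ξ⟩^{-1}`, at the expense of one more power of the bracket. -/
lemma exists_sq_lintegral_le {σ : ℝ} (hσ : 0 < σ) (s : ℝ) (k : ℕ) : ∃ C : ℝ≥0∞, C < ∞ ∧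
    ∀ g : ℝ → ℝ≥0∞, Measurable g → (∫⁻ ξ, ENNReal.ofReal (jb ξ ^ k) * g ξ) ^ 2 ≤
      C * ∫⁻ ξ, (ENNReal.ofReal (gw σ s ξ) * g ξ) ^ 2 := by
  obtain ⟨C, hC, h⟩ := exists_lintegral_sq_le hσ s (k + 1)
  have mj := measurable_jb
  have h3 : ∫⁻ ξ, ENNReal.ofReal (jb ξ)⁻¹ ^ 2 < ∞ := by
    refine lt_of_eq_of_lt (lintegral_congr fun ξ => ?_) (jbInt_lt_top (r := 2) (by norm_num))
    rw [← ENNReal.ofReal_pow (by have := jb_pos ξ; positivity), Real.rpow_neg (jb_nonneg ξ), inv_pow]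
    norm_num
  refine ⟨_, ENNReal.mul_lt_top h3 hC, fun g hg => ?_⟩
  have h2 := sq_lintegral_mul_le (μ := (volume : Measure ℝ))
    (f := fun ξ => ENNReal.ofReal (jb ξ)⁻¹)
    (g := fun ξ => ENNReal.ofReal (jb ξ ^ (k + 1)) * g ξ) (by fun_prop) (by fun_prop)
  have e : ∀ ξ, ENNReal.ofReal (jb ξ)⁻¹ * (ENNReal.ofReal (jb ξ ^ (k + 1)) * g ξ) =
      ENNReal.ofReal (jb ξ ^ k) * g ξ := fun ξ => by
    have hj := jb_pos ξ
    rw [← mul_assoc, ← ENNReal.ofReal_mul (by positivity)]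
    rw [pow_succ', inv_mul_cancel_left₀ hj.ne']
  simp only [e] at h2
  rw [mul_assoc]
  exact h2.trans (mul_le_mul_right (h g) _)

lemma lt_top_of_sq_lt_top {a : ℝ≥0∞} (h : a ^ 2 < ∞) : a < ∞ := by
  by_contra hh
  rw [not_lt, top_le_iff] at hh
  simp [hh] at h

lemma lintegral_jb_pow_mul_lt_top {σ : ℝ} (hσ : 0 < σ) (s : ℝ) {g : ℝ → ℝ≥0∞}
    (hg : Measurable g) (h : ∫⁻ ξ, (ENNReal.ofReal (gw σ s ξ) * g ξ) ^ 2 < ∞) (k : ℕ) :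
    ∫⁻ ξ, ENNReal.ofReal (jb ξ ^ k) * g ξ < ∞ := by
  obtain ⟨C, hC, hb⟩ := exists_sq_lintegral_le hσ s k
  exact lt_top_of_sq_lt_top ((hb g hg).trans_lt (ENNReal.mul_lt_top hC h))

lemma lintegral_sq_lt_top {σ : ℝ} (hσ : 0 < σ) (s : ℝ) {g : ℝ → ℝ≥0∞}
    (h : ∫⁻ ξ, (ENNReal.ofReal (gw σ s ξ) * g ξ) ^ 2 < ∞) : ∫⁻ ξ, g ξ ^ 2 < ∞ := by
  obtain ⟨C, hC, hb⟩ := exists_lintegral_sq_le hσ s 0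
  have := (hb g).trans_lt (ENNReal.mul_lt_top hC h)
  simpa using this

/-- Integrability against all polynomial weights. -/
structure RapidlyIntegrable (g : ℝ → ℂ) : Prop where
  measurable : Measurable g
  lintegral_lt : ∀ k : ℕ, ∫⁻ ξ, ENNReal.ofReal (jb ξ ^ k) * ‖g ξ‖ₑ < ∞

lemma rapidlyIntegrable_of_hnorm {σ : ℝ} (hσ : 0 < σ) {s : ℝ} {g : ℝ → ℂ} (hg : Measurable g)
    (h : hnorm σ s g < ∞) : RapidlyIntegrable g :=
  ⟨hg, lintegral_jb_pow_mul_lt_top hσ s hg.enorm h⟩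

lemma memLp_of_hnorm {σ : ℝ} (hσ : 0 < σ) {s : ℝ} {g : ℝ → ℂ} (hg : Measurable g)
    (h : hnorm σ s g < ∞) : MemLp g 2 volume := by
  refine ⟨hg.aestronglyMeasurable, ?_⟩
  have := lintegral_sq_lt_top hσ s h
  rw [← eLpNorm_two_sq] at this
  exact lt_top_of_sq_lt_top this

lemma RapidlyIntegrable.integrable {g : ℝ → ℂ} (hg : RapidlyIntegrable g) : Integrable g := by
  refine ⟨hg.measurable.aestronglyMeasurable, ?_⟩
  have := hg.lintegral_lt 0
  simpa [hasFiniteIntegral_iff_enorm] using this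

lemma RapidlyIntegrable.mul_of_le {g : ℝ → ℂ} (hg : RapidlyIntegrable g) {m : ℝ → ℂ}
    (hm : Measurable m) {C : ℝ} {n : ℕ} (h : ∀ ξ, ‖m ξ‖ ≤ C * jb ξ ^ n) :
    RapidlyIntegrable (fun ξ => m ξ * g ξ) := by
  refine ⟨hm.mul hg.measurable, fun k => ?_⟩
  have hC : 0 ≤ C := by
    have := (norm_nonneg _).trans (h 0)
    simpa [jb] using this
  calc _ ≤ ∫⁻ ξ, ENNReal.ofReal C * (ENNReal.ofReal (jb ξ ^ (k + n)) * ‖g ξ‖ₑ) := by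
        refine lintegral_mono fun ξ => ?_
        have hj := jb_pos ξ
        rw [enorm_mul, ← mul_assoc, ← mul_assoc, ← ofReal_norm (m ξ),
          ← ENNReal.ofReal_mul (by positivity), ← ENNReal.ofReal_mul hC]
        refine mul_le_mul_left (ENNReal.ofReal_le_ofReal ?_) _
        calc jb ξ ^ k * ‖m ξ‖ ≤ jb ξ ^ k * (C * jb ξ ^ n) := by gcongr; exact h ξ
          _ = C * jb ξ ^ (k + n) := by ring
    _ < ∞ := by
        rw [lintegral_const_mul' _ _ ENNReal.ofReal_ne_top]
        exact ENNReal.mul_lt_top ENNReal.ofReal_lt_top (hg.lintegral_lt _)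

lemma norm_I_mul_le (ξ : ℝ) : ‖Complex.I * (ξ : ℂ)‖ ≤ 1 * jb ξ ^ 1 := by
  simp [jb]

lemma RapidlyIntegrable.I_mul {g : ℝ → ℂ} (hg : RapidlyIntegrable g) :
    RapidlyIntegrable (fun ξ : ℝ => Complex.I * (ξ : ℂ) * g ξ) :=
  hg.mul_of_le (by fun_prop) norm_I_mul_le

lemma hasDerivAt_ex_mul (ξ y : ℝ) :
    HasDerivAt (fun y => ex (y * ξ)) (Complex.I * ξ * ex (y * ξ)) y := by
  have h1 : HasDerivAt (fun r : ℝ => r * ξ) ξ y := by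
    simpa using (hasDerivAt_id y).mul_const ξ
  have h2 : HasDerivAt (fun y => ex (y * ξ)) (ξ • (Complex.I * ex (y * ξ))) y := by
    have h := HasDerivAt.scomp (h := fun r : ℝ => r * ξ) y (hasDerivAt_ex (y * ξ)) h1
    exact h
  exact h2.congr_deriv (by rw [Complex.real_smul]; ring)

lemma hasDerivAt_osc {g : ℝ → ℂ} (hg : RapidlyIntegrable g) (x : ℝ) :
    HasDerivAt (osc g) (osc (fun ξ : ℝ => Complex.I * (ξ : ℂ) * g ξ) x) x := by
  have hm := hg.measurable
  have e1 : osc g = fun x => ∫ ξ, ex (x * ξ) * g ξ := funext (osc_real g)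
  rw [e1, osc_real]
  refine (hasDerivAt_integral_of_dominated_loc_of_deriv_le (μ := volume) (s := univ)
    (F := fun x ξ => ex (x * ξ) * g ξ)
    (F' := fun x ξ => ex (x * ξ) * (Complex.I * (ξ : ℂ) * g ξ))
    (bound := fun ξ : ℝ => ‖Complex.I * (ξ : ℂ) * g ξ‖) univ_mem ?_ ?_ ?_ ?_ ?_ ?_).2
  · exact Eventually.of_forall fun y => (by fun_prop : Measurable _).aestronglyMeasurable
  · refine hg.integrable.norm.mono' (by fun_prop : Measurable _).aestronglyMeasurable
      (ae_of_all _ fun ξ => by simp)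
  · exact (by fun_prop : Measurable _).aestronglyMeasurable
  · exact ae_of_all _ fun ξ y _ => by simp
  · exact hg.I_mul.integrable.norm
  · refine ae_of_all _ fun ξ y _ => ?_
    exact ((hasDerivAt_ex_mul ξ y).mul_const (g ξ)).congr_deriv (by ring)

lemma deriv_osc {g : ℝ → ℂ} (hg : RapidlyIntegrable g) :
    deriv (osc g) = osc (fun ξ : ℝ => Complex.I * (ξ : ℂ) * g ξ) :=
  funext fun x => (hasDerivAt_osc hg x).deriv

lemma contDiff_osc (n : ℕ) : ∀ {g : ℝ → ℂ}, RapidlyIntegrable g → ContDiff ℝ n (osc g) := by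
  induction n with
  | zero => exact fun hg => by simpa using contDiff_zero (𝕜 := ℝ).2 (continuous_osc hg.integrable)
  | succ n ih =>
    intro g hg
    rw [Nat.cast_succ, contDiff_succ_iff_deriv]
    refine ⟨fun x => (hasDerivAt_osc hg x).differentiableAt, by simp, ?_⟩
    rw [deriv_osc hg]
    exact ih hg.I_mul

lemma iteratedDeriv_osc (n : ℕ) : ∀ {g : ℝ → ℂ}, RapidlyIntegrable g →
    iteratedDeriv n (osc g) = osc (fun ξ : ℝ => (Complex.I * (ξ : ℂ)) ^ n * g ξ) := by
  induction n with
  | zero => intro g hg; simp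
  | succ n ih =>
    intro g hg
    rw [iteratedDeriv_succ', deriv_osc hg, ih hg.I_mul]
    congr 1; funext ξ; ring

lemma gevreyNorm_sq {σ s : ℝ} {f : ℝ → ℂ} (hf : MemLp f 2 volume) :
    gevreyNorm σ s f ^ 2 = hnorm σ s (hat (hf.toLp f)) := by
  have : gevreyNorm σ s f = eLpNorm (fun ξ : ℝ ↦
      (Real.exp (σ * |ξ|) * (1 + |ξ|) ^ s) • hat (hf.toLp f) ξ) 2 volume := by
    unfold gevreyNorm; exact ciInf_pos hf
  rw [this, eLpNorm_two_sq]
  unfold hnorm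
  refine lintegral_congr fun ξ => ?_
  rw [enorm_smul, Real.enorm_of_nonneg]
  · rfl
  · exact (gw_pos σ s ξ).le

lemma memLp_of_gevreyNorm {σ s : ℝ} {f : ℝ → ℂ} (h : gevreyNorm σ s f < ∞) :
    MemLp f 2 volume := by
  by_contra hf
  simp [gevreyNorm, hf] at h

lemma hnorm_congr {σ s : ℝ} {g h : ℝ → ℂ} (e : g =ᵐ[volume] h) : hnorm σ s g = hnorm σ s h := by
  unfold hnorm
  refine lintegral_congr_ae ?_
  filter_upwards [e] with ξ hξ
  rw [hξ]

lemma hnorm_const_mul (σ s : ℝ) (c : ℂ) (g : ℝ → ℂ) :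
    hnorm σ s (fun ξ => c * g ξ) = ‖c‖ₑ ^ 2 * hnorm σ s g := by
  unfold hnorm
  rw [← lintegral_const_mul' _ _ (by finiteness)]
  refine lintegral_congr fun ξ => ?_
  rw [enorm_mul]; ring

lemma gevreyNorm_osc {σ s : ℝ} {g : ℝ → ℂ} (hm : Measurable g) (h1 : Integrable g)
    (h2 : MemLp g 2 volume) :
    gevreyNorm σ s (osc g) ^ 2 = ENNReal.ofReal (2 * Real.pi) ^ 2 * hnorm σ s g := by
  rw [gevreyNorm_sq (memLp_osc hm h1 h2), hnorm_congr (hat_osc hm h1 h2), hnorm_const_mul,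
    ← ofReal_norm, Complex.norm_real, Real.norm_of_nonneg (by positivity)]

end

/-! ### From profiles to functions: continuity in time and norms -/

section

/-- The Fourier transform in time of a profile. -/
def amp (F : ℝ × ℝ → ℂ) (t ξ : ℝ) : ℂ := ∫ τ, ex (t * τ) * F (ξ, τ)

/-- The spatial Fourier transform of the function with a given profile. -/
def vhat (α β : ℝ) (F : ℝ × ℝ → ℂ) (t ξ : ℝ) : ℂ := ex (t * phase α β ξ) * amp F t ξ

/-- The function with a given profile. -/
def vsol (α β : ℝ) (F : ℝ × ℝ → ℂ) (t : ℝ) : ℝ → ℂ := osc (vhat α β F t)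

/-- The integral of a profile over the time frequencies. -/
def maj (F : ℝ × ℝ → ℂ) (ξ : ℝ) : ℝ≥0∞ := ∫⁻ τ, ‖F (ξ, τ)‖ₑ

variable {α β σ s : ℝ} {F G : ℝ × ℝ → ℂ}

lemma measurable_amp (hF : Measurable F) : Measurable (Function.uncurry (amp F)) := by
  have : Measurable fun p : (ℝ × ℝ) × ℝ => ex (p.1.1 * p.2) * F (p.1.2, p.2) := by fun_prop
  exact this.stronglyMeasurable.integral_prod_right'.measurable

lemma measurable_vhat (hF : Measurable F) : Measurable (Function.uncurry (vhat α β F)) := by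
  have h1 := measurable_amp hF
  have h2 := measurable_phase α β
  have h3 : Measurable fun p : ℝ × ℝ => ex (p.1 * phase α β p.2) := by fun_prop
  exact h3.mul h1

lemma measurable_vhat_right (hF : Measurable F) (t : ℝ) : Measurable (vhat α β F t) :=
  (measurable_vhat hF).of_uncurry_left

lemma measurable_maj (hF : Measurable F) : Measurable (maj F) := by
  have : Measurable fun p : ℝ × ℝ => ‖F (p.1, p.2)‖ₑ := by fun_prop
  exact this.lintegral_prod_right'

lemma enorm_amp_le (t ξ : ℝ) : ‖amp F t ξ‖ₑ ≤ maj F ξ := by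
  refine (enorm_integral_le_lintegral_enorm _).trans (le_of_eq ?_)
  simp only [enorm_mul, enorm_ex, one_mul, maj]

lemma enorm_vhat_le (t ξ : ℝ) : ‖vhat α β F t ξ‖ₑ ≤ maj F ξ := by
  rw [vhat, enorm_mul, enorm_ex, one_mul]; exact enorm_amp_le t ξ

/-- Cauchy-Schwarz in the time frequency, where `⟨τ⟩^{-3/2}` is integrable because `b = 3/4 > 1/2`.
This is what makes the Bourgain space embed into curves continuous in the Gevrey norm. -/
lemma lintegral_gw_maj_le (hF : Measurable F) : ∫⁻ ξ, (ENNReal.ofReal (gw σ s ξ) * maj F ξ) ^ 2 ≤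
    jbInt (3 / 2) * wnorm σ s (fun p => ‖F p‖ₑ) := by
  have mj := measurable_jb
  have mg := measurable_gw σ s
  have key : ∀ ξ, maj F ξ ^ 2 ≤ jbInt (3 / 2) *
      ∫⁻ τ, (ENNReal.ofReal (jb τ ^ (3 / 4 : ℝ)) * ‖F (ξ, τ)‖ₑ) ^ 2 := by
    intro ξ
    have h := sq_lintegral_mul_le (μ := (volume : Measure ℝ))
      (f := fun τ => ENNReal.ofReal (jb τ ^ (-(3 / 4) : ℝ)))
      (g := fun τ => ENNReal.ofReal (jb τ ^ (3 / 4 : ℝ)) * ‖F (ξ, τ)‖ₑ) (by fun_prop) (by fun_prop)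
    have e1 : ∀ τ, ENNReal.ofReal (jb τ ^ (-(3 / 4) : ℝ)) *
        (ENNReal.ofReal (jb τ ^ (3 / 4 : ℝ)) * ‖F (ξ, τ)‖ₑ) = ‖F (ξ, τ)‖ₑ := fun τ => by
      rw [← mul_assoc, ← ENNReal.ofReal_mul (jb_rpow_nonneg _ _), ← Real.rpow_add (jb_pos τ)]
      simp
    have e2 : ∫⁻ τ, ENNReal.ofReal (jb τ ^ (-(3 / 4) : ℝ)) ^ 2 = jbInt (3 / 2) := by
      refine lintegral_congr fun τ => ?_
      rw [← ENNReal.ofReal_pow (jb_rpow_nonneg _ _), ← Real.rpow_natCast (jb τ ^ _),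
        ← Real.rpow_mul (jb_nonneg τ)]
      norm_num
    simp only [e1, e2] at h
    exact h
  unfold wnorm
  rw [Measure.volume_eq_prod, lintegral_prod _ (by
    have := measurable_wt σ s
    fun_prop), ← lintegral_const_mul' _ _ (jbInt_lt_top (by norm_num)).ne]
  refine lintegral_mono fun ξ => ?_
  rw [mul_pow]
  refine (mul_le_mul_right (key ξ) _).trans (le_of_eq ?_)
  rw [mul_left_comm, ← lintegral_const_mul' _ _ (by finiteness)]
  congr 1
  refine lintegral_congr fun τ => ?_
  simp only [wt]
  rw [ENNReal.ofReal_mul (gw_pos _ _ _).le]; ring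

lemma hnorm_vhat_le (hF : Measurable F) (t : ℝ) : hnorm σ s (vhat α β F t) ≤
    jbInt (3 / 2) * wnorm σ s (fun p => ‖F p‖ₑ) := by
  refine le_trans ?_ (lintegral_gw_maj_le hF)
  unfold hnorm
  gcongr
  exact enorm_vhat_le t _

lemma hnorm_vhat_lt_top (hF : Measurable F)
    (hn : wnorm σ s (fun p => ‖F p‖ₑ) < ∞) (t : ℝ) : hnorm σ s (vhat α β F t) < ∞ :=
  (hnorm_vhat_le hF t).trans_lt (ENNReal.mul_lt_top (jbInt_lt_top (by norm_num)) hn)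

lemma rapidlyIntegrable_vhat (hσ : 0 < σ) (hF : Measurable F)
    (hn : wnorm σ s (fun p => ‖F p‖ₑ) < ∞) (t : ℝ) : RapidlyIntegrable (vhat α β F t) :=
  rapidlyIntegrable_of_hnorm hσ (measurable_vhat_right hF t) (hnorm_vhat_lt_top hF hn t)

lemma memLp_vhat (hσ : 0 < σ) (hF : Measurable F)
    (hn : wnorm σ s (fun p => ‖F p‖ₑ) < ∞) (t : ℝ) : MemLp (vhat α β F t) 2 volume :=
  memLp_of_hnorm hσ (measurable_vhat_right hF t) (hnorm_vhat_lt_top hF hn t)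

lemma lintegral_jb_pow_maj_lt_top (hσ : 0 < σ) (hF : Measurable F)
    (hn : wnorm σ s (fun p => ‖F p‖ₑ) < ∞) (k : ℕ) : ∫⁻ ξ, ENNReal.ofReal (jb ξ ^ k) * maj F ξ < ∞ :=
  lintegral_jb_pow_mul_lt_top hσ s (measurable_maj hF) ((lintegral_gw_maj_le hF).trans_lt
    (ENNReal.mul_lt_top (jbInt_lt_top (by norm_num)) hn)) k

lemma lintegral_jb_pow_profile_lt_top (hσ : 0 < σ) (hF : Measurable F)
    (hn : wnorm σ s (fun p => ‖F p‖ₑ) < ∞) (k : ℕ) :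
    ∫⁻ p : ℝ × ℝ, ENNReal.ofReal (jb p.1 ^ k) * ‖F p‖ₑ < ∞ := by
  have mj := measurable_jb
  rw [Measure.volume_eq_prod, lintegral_prod _ (by fun_prop)]
  refine lt_of_eq_of_lt (lintegral_congr fun ξ => ?_) (lintegral_jb_pow_maj_lt_top hσ hF hn k)
  exact lintegral_const_mul' (ENNReal.ofReal (jb ξ ^ k)) (fun τ => ‖F (ξ, τ)‖ₑ) ENNReal.ofReal_ne_top

lemma integrable_profile (hσ : 0 < σ) (hF : Measurable F)
    (hn : wnorm σ s (fun p => ‖F p‖ₑ) < ∞) : Integrable F := by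
  refine ⟨hF.aestronglyMeasurable, ?_⟩
  have := lintegral_jb_pow_profile_lt_top hσ hF hn 0
  simpa [hasFiniteIntegral_iff_enorm] using this

lemma ae_integrable_profile (hσ : 0 < σ) (hF : Measurable F)
    (hn : wnorm σ s (fun p => ‖F p‖ₑ) < ∞) : ∀ᵐ ξ, Integrable fun τ => F (ξ, τ) := by
  have h := lintegral_jb_pow_maj_lt_top hσ hF hn 0
  simp only [pow_zero, ENNReal.ofReal_one, one_mul] at h
  filter_upwards [ae_lt_top (measurable_maj hF) h.ne] with ξ hξ
  exact ⟨(hF.comp measurable_prodMk_left).aestronglyMeasurable, by rwa [hasFiniteIntegral_iff_enorm]⟩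

/-- The space-time character belonging to a profile variable. -/
def chr (α β t x : ℝ) (p : ℝ × ℝ) : ℂ := ex (x * p.1 + t * (p.2 + phase α β p.1))

@[simp] lemma norm_chr (t x : ℝ) (p : ℝ × ℝ) : ‖chr α β t x p‖ = 1 := norm_ex _

lemma measurable_chr (t x : ℝ) : Measurable (chr α β t x) := by
  have := measurable_phase α β
  unfold chr; fun_prop

lemma integrable_chr_mul (hF : Integrable F) (t x : ℝ) :
    Integrable fun p => chr α β t x p * F p :=
  hF.bdd_mul (c := 1) (measurable_chr t x).aestronglyMeasurable
    (ae_of_all _ fun p => (norm_chr t x p).le)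

lemma vsol_eq (hF : Integrable F) (t x : ℝ) :
    vsol α β F t x = ∫ p, chr α β t x p * F p := by
  rw [Measure.volume_eq_prod, integral_prod _ (integrable_chr_mul hF t x), vsol, osc_real]
  refine integral_congr_ae (ae_of_all _ fun ξ => ?_)
  simp only [vhat, amp]
  rw [← integral_const_mul, ← integral_const_mul]
  refine integral_congr_ae (ae_of_all _ fun τ => ?_)
  simp only [chr]
  rw [mul_add, ex_add, ex_add]; ring

lemma vsol_sub (hF : Integrable F) (hG : Integrable G) (t : ℝ) :
    vsol α β (F - G) t = vsol α β F t - vsol α β G t := by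
  funext x
  rw [Pi.sub_apply, vsol_eq hF, vsol_eq hG, vsol_eq (hF.sub hG),
    ← integral_sub (integrable_chr_mul hF t x) (integrable_chr_mul hG t x)]
  refine integral_congr_ae (ae_of_all _ fun p => ?_)
  simp only [Pi.sub_apply]; ring

lemma osc_sub {V : Type*} [NormedAddCommGroup V] [InnerProductSpace ℝ V] [MeasurableSpace V]
    [BorelSpace V] [FiniteDimensional ℝ V] {g h : V → ℂ} (hg : Integrable g) (hh : Integrable h) :
    osc g - osc h = osc (fun ξ => g ξ - h ξ) := by
  have hi : ∀ {k : V → ℂ}, Integrable k → ∀ x, Integrable fun ξ => ex (inner ℝ ξ x) * k ξ :=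
    fun hk x => hk.bdd_mul (c := 1)
      (by fun_prop : Continuous fun ξ : V => ex (inner ℝ ξ x)).aestronglyMeasurable
      (ae_of_all _ fun p => (norm_ex _).le)
  funext x
  simp only [Pi.sub_apply, osc]
  rw [← integral_sub (hi hg x) (hi hh x)]
  refine integral_congr_ae (ae_of_all _ fun p => ?_)
  simp only; ring

lemma continuous_amp {ξ : ℝ} (h : Integrable fun τ => F (ξ, τ)) :
    Continuous fun t => amp F t ξ := by
  refine continuous_of_dominated (bound := fun τ => ‖F (ξ, τ)‖) (fun t => ?_) (fun t => ?_) h.norm ?_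
  · exact (by fun_prop : Continuous fun τ => ex (t * τ)).aestronglyMeasurable.mul
      h.aestronglyMeasurable
  · exact ae_of_all _ fun τ => by simp
  · exact ae_of_all _ fun τ => by fun_prop

/-- Dominated convergence on the Fourier side: the majorant `2 maj F` does not depend on time and is
square integrable against the Gevrey weight. -/
lemma continuousInGevrey_vsol (hσ : 0 < σ) (hF : Measurable F)
    (hn : wnorm σ s (fun p => ‖F p‖ₑ) < ∞) (T : ℝ) : ContinuousInGevrey σ s T (vsol α β F) := by
  have hv := fun t => rapidlyIntegrable_vhat (α := α) (β := β) hσ hF hn t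
  have hm := fun t => memLp_vhat (α := α) (β := β) hσ hF hn t
  intro t _
  constructor
  · have := gevreyNorm_osc (σ := σ) (s := s) (hv t).measurable (hv t).integrable (hm t)
    have h2 := ENNReal.mul_lt_top (a := ENNReal.ofReal (2 * Real.pi) ^ 2) (by finiteness)
      (hnorm_vhat_lt_top (α := α) (β := β) hF hn t)
    rw [← this] at h2
    by_contra hh
    rw [not_lt, top_le_iff] at hh
    rw [vsol] at hh
    simp [hh] at h2
  · have e : ∀ t', gevreyNorm σ s (vsol α β F t' - vsol α β F t) =
        (ENNReal.ofReal (2 * Real.pi) ^ 2 *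
          hnorm σ s (fun ξ => vhat α β F t' ξ - vhat α β F t ξ)) ^ (1 / 2 : ℝ) := by
      intro t'
      have := gevreyNorm_osc (σ := σ) (s := s) (g := fun ξ => vhat α β F t' ξ - vhat α β F t ξ)
        ((hv t').measurable.sub (hv t).measurable) ((hv t').integrable.sub (hv t).integrable)
        ((hm t').sub (hm t))
      rw [vsol, vsol, osc_sub (hv t').integrable (hv t).integrable, ← this, ← ENNReal.rpow_natCast, ← ENNReal.rpow_mul]
      norm_num
    have hlim : Tendsto (fun t' => hnorm σ s (fun ξ => vhat α β F t' ξ - vhat α β F t ξ)) (𝓝 t)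
        (𝓝 0) := by
      have mg := measurable_gw σ s
      have mM := measurable_maj hF
      have hfin := (lintegral_gw_maj_le (σ := σ) (s := s) hF).trans_lt
        (ENNReal.mul_lt_top (jbInt_lt_top (by norm_num)) hn)
      have := tendsto_lintegral_filter_of_dominated_convergence (μ := volume) (l := 𝓝 t)
        (F := fun t' ξ => (ENNReal.ofReal (gw σ s ξ) * ‖vhat α β F t' ξ - vhat α β F t ξ‖ₑ) ^ 2)
        (f := fun _ => 0) (fun ξ => (ENNReal.ofReal (gw σ s ξ) * (2 * maj F ξ)) ^ 2)
        (Eventually.of_forall fun t' => by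
          have h1 := (hv t').measurable
          have h2 := (hv t).measurable
          fun_prop)
        (Eventually.of_forall fun t' => ae_of_all _ fun ξ => by
          gcongr
          rw [two_mul]
          exact (enorm_sub_le).trans (add_le_add (enorm_vhat_le _ _) (enorm_vhat_le _ _)))
        (by
          have : ∀ ξ, (ENNReal.ofReal (gw σ s ξ) * (2 * maj F ξ)) ^ 2 =
              4 * (ENNReal.ofReal (gw σ s ξ) * maj F ξ) ^ 2 := fun ξ => by ring
          simp only [this]
          rw [lintegral_const_mul' _ _ (by finiteness)]
          exact (ENNReal.mul_lt_top (by finiteness) hfin).ne)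
        (by
          filter_upwards [ae_integrable_profile hσ hF hn] with ξ hξ
          have hc : Continuous fun t' => vhat α β F t' ξ :=
            (by fun_prop : Continuous fun t' => ex (t' * phase α β ξ)).mul (continuous_amp hξ)
          have h0 : Tendsto (fun t' => ‖vhat α β F t' ξ - vhat α β F t ξ‖ₑ) (𝓝 t) (𝓝 0) := by
            have : Tendsto (fun t' => vhat α β F t' ξ - vhat α β F t ξ) (𝓝 t) (𝓝 0) := by
              simpa using (hc.tendsto t).sub_const (vhat α β F t ξ)
            simpa using this.enorm
          have h1 := ENNReal.Tendsto.const_mul (a := ENNReal.ofReal (gw σ s ξ)) h0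
            (Or.inr ENNReal.ofReal_ne_top)
          have h2 := ENNReal.Tendsto.pow (n := 2) h1
          simpa using h2)
      simpa [hnorm] using this
    simp only [e]
    have h1 := ENNReal.Tendsto.const_mul (a := ENNReal.ofReal (2 * Real.pi) ^ 2) hlim
      (Or.inr (by finiteness))
    have h2 := (ENNReal.continuous_rpow_const (y := 1 / 2)).tendsto _ |>.comp h1
    rw [mul_zero, ENNReal.zero_rpow_of_pos (by norm_num)] at h2
    exact h2.mono_left nhdsWithin_le_nhds

lemma gevreyNorm_vsol_sq_le (hσ : 0 < σ) (hF : Measurable F)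
    (hn : wnorm σ s (fun p => ‖F p‖ₑ) < ∞) (t : ℝ) :
    gevreyNorm σ s (vsol α β F t) ^ 2 ≤
      ENNReal.ofReal (2 * Real.pi) ^ 2 * (jbInt (3 / 2) * wnorm σ s (fun p => ‖F p‖ₑ)) := by
  have hv := rapidlyIntegrable_vhat (α := α) (β := β) hσ hF hn t
  rw [vsol, gevreyNorm_osc hv.measurable hv.integrable (memLp_vhat hσ hF hn t)]
  gcongr
  exact hnorm_vhat_le hF t

/-- The profile variable belonging to a frequency in the plane. -/
def shear (α β : ℝ) (p : Plane) : ℝ × ℝ := (p 0, p 1 - phase α β (p 0))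

lemma measurePreserving_shear (α β : ℝ) :
    MeasurePreserving (shear α β) (volume : Measure Plane) volume := by
  have h1 : MeasurePreserving (fun p : Plane => (p 0, p 1)) volume volume :=
    (volume_preserving_finTwoArrow ℝ).comp (PiLp.volume_preserving_ofLp (Fin 2))
  have h2 : MeasurePreserving (fun q : ℝ × ℝ => (q.1, q.2 - phase α β q.1)) volume volume := by
    have := measurable_phase α β
    exact (MeasurePreserving.id (volume : Measure ℝ)).skew_product
      (μc := (volume : Measure ℝ)) (μd := (volume : Measure ℝ))
      (g := fun ξ τ => τ - phase α β ξ) (by fun_prop)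
      (ae_of_all _ fun ξ => (measurePreserving_sub_right (volume : Measure ℝ) _).map_eq)
  exact h2.comp h1

lemma osc_comp_shear (hF : Measurable F) (hi : Integrable F) (p : Plane) :
    osc (fun q => F (shear α β q)) p = vsol α β F (p 1) (p 0) := by
  have hm : Measurable fun q => chr α β (p 1) (p 0) q * F q :=
    (measurable_chr (p 1) (p 0)).mul hF
  rw [vsol_eq hi, ← (measurePreserving_shear α β).map_eq,
    integral_map (measurePreserving_shear α β).measurable.aemeasurable hm.aestronglyMeasurable]
  unfold osc
  refine integral_congr_ae (ae_of_all _ fun q => ?_)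
  simp only [chr, shear, sub_add_cancel]
  congr 2
  simp [PiLp.inner_apply, Fin.sum_univ_two]

/-- The function with profile `F` is defined for all times and serves as its own extension. Its
space-time Fourier transform is `(2π)² F` composed with the shear, which also carries the Bourgain
weight to `wt` and preserves measure. -/
lemma restrictedNorm_vsol_sq_le (hσ : 0 < σ) (hF : Measurable F)
    (hn : wnorm σ s (fun p => ‖F p‖ₑ) < ∞) (T : ℝ) :
    restrictedNorm α β σ s (3 / 4) T (vsol α β F) ^ 2 ≤
      ENNReal.ofReal ((2 * Real.pi) ^ 2) ^ 2 * wnorm σ s (fun p => ‖F p‖ₑ) := by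
  have hi := integrable_profile hσ hF hn
  have mp := measurePreserving_shear α β
  set g : Plane → ℂ := fun q => F (shear α β q) with hg
  have gm : Measurable g := hF.comp mp.measurable
  have g1 : Integrable g := (mp.integrable_comp hF.aestronglyMeasurable).2 hi
  have F2 : MemLp F 2 volume := by
    refine ⟨hF.aestronglyMeasurable, ?_⟩
    obtain ⟨C, hC0, hC⟩ := exists_jb_pow_le_gw hσ s 0
    have : eLpNorm F 2 volume ^ 2 ≤ ENNReal.ofReal C ^ 2 * wnorm σ s (fun p => ‖F p‖ₑ) := by
      unfold wnorm
      rw [eLpNorm_two_sq, ← lintegral_const_mul' _ _ (by finiteness)]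
      refine lintegral_mono fun p => ?_
      rw [← mul_pow, ← mul_assoc, ← ENNReal.ofReal_mul hC0]
      gcongr
      refine le_mul_of_one_le_left' ?_
      rw [ENNReal.one_le_ofReal, wt, ← mul_assoc]
      exact one_le_mul_of_one_le_of_one_le (by simpa using hC p.1) (one_le_jb_rpow _ (by norm_num))
    have h2 := this.trans_lt (ENNReal.mul_lt_top (by finiteness) hn)
    by_contra hh
    rw [not_lt, top_le_iff] at hh
    simp [hh] at h2
  have g2 : MemLp g 2 volume := F2.comp_measurePreserving mp
  have hle : restrictedNorm α β σ s (3 / 4) T (vsol α β F) ≤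
      bourgainNorm α β σ s (3 / 4) ((memLp_osc gm g1 g2).toLp (osc g)) := by
    refine iInf₂_le _ ?_
    filter_upwards [(memLp_osc gm g1 g2).coeFn_toLp] with p hp _
    rw [hp, hg, osc_comp_shear hF hi]
  refine (pow_le_pow_left' hle 2).trans (le_of_eq ?_)
  rw [bourgainNorm, eLpNorm_two_sq, wnorm, ← lintegral_const_mul' _ _ (by finiteness),
    ← mp.lintegral_comp (by have := measurable_wt σ s; fun_prop)]
  refine lintegral_congr_ae ?_
  filter_upwards [hat₂_osc gm g1 g2] with p hp
  have hw : Real.exp (σ * |p 0|) * (1 + |p 0|) ^ s * (1 + |p 1 - phase α β (p 0)|) ^ (3 / 4 : ℝ) =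
      wt σ s (shear α β p) := rfl
  rw [hp, hw, enorm_smul, Real.enorm_of_nonneg (wt_pos _ _ _).le, enorm_mul, ← ofReal_norm
    (((2 * Real.pi) ^ 2 : ℝ) : ℂ), Complex.norm_real, Real.norm_of_nonneg (by positivity)]
  ring

end

/-! ### Duhamel's formula on the Fourier side -/

section

variable {α β γ σ s T : ℝ} {F : ℝ × ℝ → ℂ} {h : ℝ → ℂ}

/-- The cubic product of a profile at the space frequency `ξ`, with the time frequency among the
variables. -/
def cub (α β : ℝ) (F : ℝ × ℝ → ℂ) (ξ : ℝ) (z : DVar) : ℂ := triC α β F F F (ξ, z.1) z.2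

lemma measurable_cub (hF : Measurable F) : Measurable (Function.uncurry (cub α β F)) := by
  have h1 := measurable_triC α β hF hF hF
  exact h1.comp (f := fun p : ℝ × DVar => ((p.1, p.2.1), p.2.2)) (by fun_prop)

lemma measurable_cub_right (hF : Measurable F) (ξ : ℝ) : Measurable (cub α β F ξ) :=
  (measurable_cub hF).of_uncurry_left

/-- The integral of the cubic product. -/
def nbar (α β : ℝ) (F : ℝ × ℝ → ℂ) (ξ : ℝ) : ℝ≥0∞ := ∫⁻ z, ‖cub α β F ξ z‖ₑ

lemma measurable_nbar (hF : Measurable F) : Measurable (nbar α β F) :=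
  (measurable_cub hF).enorm.lintegral_prod_right'

lemma nbar_eq (hF : Measurable F) (ξ : ℝ) : nbar α β F ξ =
    ∫⁻ τ, ∫⁻ w, tri α β (fun p => ‖F p‖ₑ) (fun p => ‖F p‖ₑ) (fun p => ‖F p‖ₑ) (ξ, τ) w := by
  unfold nbar
  rw [Measure.volume_eq_prod, lintegral_prod _ (measurable_cub_right hF ξ).enorm.aemeasurable]
  simp only [cub, enorm_triC]

lemma jb_pow_mul_tri_le (α β : ℝ) (f : ℝ × ℝ → ℝ≥0∞) (k : ℕ) (q : ℝ × ℝ)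
    (z : (ℝ × ℝ) × (ℝ × ℝ)) : ENNReal.ofReal (jb q.1 ^ k) * tri α β f f f q z ≤
      tri α β (fun p => ENNReal.ofReal (jb p.1 ^ k) * f p)
        (fun p => ENNReal.ofReal (jb p.1 ^ k) * f p)
        (fun p => ENNReal.ofReal (jb p.1 ^ k) * f p) q z := by
  unfold tri
  have h1 : jb q.1 ≤ jb z.1.1 * jb (shp α β q z).1 * jb z.2.1 := by
    have e : q.1 = (z.1.1 - (shp α β q z).1) + z.2.1 := by simp only [shp]; ring
    calc jb q.1 = jb ((z.1.1 - (shp α β q z).1) + z.2.1) := by rw [← e]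
      _ ≤ jb (z.1.1 - (shp α β q z).1) * jb z.2.1 := jb_add_le _ _
      _ ≤ _ := mul_le_mul_of_nonneg_right (jb_sub_le _ _) (jb_nonneg _)
  have h2 : jb q.1 ^ k ≤ jb z.1.1 ^ k * jb (shp α β q z).1 ^ k * jb z.2.1 ^ k := by
    rw [← mul_pow, ← mul_pow]; exact pow_le_pow_left₀ (jb_nonneg _) h1 k
  have p1 := jb_nonneg z.1.1
  have p2 := jb_nonneg (shp α β q z).1
  have h3 := ENNReal.ofReal_le_ofReal h2
  rw [ENNReal.ofReal_mul (by positivity), ENNReal.ofReal_mul (by positivity)] at h3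
  refine (mul_le_mul_left h3 _).trans (le_of_eq ?_)
  ring

/-- The bracket of the output frequency is at most the product of those of the inputs, so a moment
of the cubic term is bounded by the cube of the same moment of the profile. -/
lemma lintegral_jb_pow_nbar_lt_top (hσ : 0 < σ) (hF : Measurable F)
    (hn : wnorm σ s (fun p => ‖F p‖ₑ) < ∞) (k : ℕ) :
    ∫⁻ ξ, ENNReal.ofReal (jb ξ ^ k) * nbar α β F ξ < ∞ := by
  have mj := measurable_jb
  have mt := measurable_tri α β hF.enorm hF.enorm hF.enorm
  have mN : Measurable fun q : ℝ × ℝ => ∫⁻ w, tri α β (fun p => ‖F p‖ₑ) (fun p => ‖F p‖ₑ)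
      (fun p => ‖F p‖ₑ) q w := mt.lintegral_prod_right'
  have m1 : Measurable fun p : ℝ × ℝ => ENNReal.ofReal (jb p.1 ^ k) * ‖F p‖ₑ := by fun_prop
  have hfin := lintegral_jb_pow_profile_lt_top hσ hF hn k
  calc ∫⁻ ξ, ENNReal.ofReal (jb ξ ^ k) * nbar α β F ξ
      = ∫⁻ q : ℝ × ℝ, ENNReal.ofReal (jb q.1 ^ k) * ∫⁻ w, tri α β (fun p => ‖F p‖ₑ)
          (fun p => ‖F p‖ₑ) (fun p => ‖F p‖ₑ) q w := by
        rw [Measure.volume_eq_prod, lintegral_prod _ (by fun_prop)]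
        refine lintegral_congr fun ξ => ?_
        rw [nbar_eq hF]
        exact (lintegral_const_mul' (ENNReal.ofReal (jb ξ ^ k)) (fun τ => ∫⁻ w, tri α β
          (fun p => ‖F p‖ₑ) (fun p => ‖F p‖ₑ) (fun p => ‖F p‖ₑ) (ξ, τ) w)
          ENNReal.ofReal_ne_top).symm
    _ ≤ ∫⁻ q, ∫⁻ w, tri α β (fun p => ENNReal.ofReal (jb p.1 ^ k) * ‖F p‖ₑ)
        (fun p => ENNReal.ofReal (jb p.1 ^ k) * ‖F p‖ₑ)
        (fun p => ENNReal.ofReal (jb p.1 ^ k) * ‖F p‖ₑ) q w := by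
        refine lintegral_mono fun q => ?_
        rw [← lintegral_const_mul' _ _ ENNReal.ofReal_ne_top]
        exact lintegral_mono fun z => jb_pow_mul_tri_le α β _ k q z
    _ < ∞ := by
        rw [lintegral_tri α β m1 m1 m1]
        exact ENNReal.mul_lt_top (ENNReal.mul_lt_top hfin hfin) hfin

lemma ae_nbar_lt_top (hσ : 0 < σ) (hF : Measurable F)
    (hn : wnorm σ s (fun p => ‖F p‖ₑ) < ∞) : ∀ᵐ ξ, nbar α β F ξ < ∞ := by
  have h := lintegral_jb_pow_nbar_lt_top (α := α) (β := β) hσ hF hn 0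
  simp only [pow_zero, ENNReal.ofReal_one, one_mul] at h
  exact ae_lt_top (measurable_nbar hF) h.ne

lemma integrable_cub (hF : Measurable F) {ξ : ℝ} (hξ : nbar α β F ξ < ∞) :
    Integrable (cub α β F ξ) :=
  ⟨(measurable_cub_right hF ξ).aestronglyMeasurable, by rwa [hasFiniteIntegral_iff_enorm]⟩

/-- The spatial Fourier transform of the nonlinearity, up to the linear flow. -/
def nl (α β : ℝ) (F : ℝ × ℝ → ℂ) (t ξ : ℝ) : ℂ := ∫ z, ex (t * z.1) * cub α β F ξ z

lemma measurable_nl (hF : Measurable F) (t : ℝ) : Measurable (nl α β F t) := by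
  have h1 := measurable_cub (α := α) (β := β) hF
  have : Measurable fun p : ℝ × DVar => ex (t * p.2.1) * Function.uncurry (cub α β F) p := by
    fun_prop
  exact this.stronglyMeasurable.integral_prod_right'.measurable

lemma enorm_nl_le (t ξ : ℝ) : ‖nl α β F t ξ‖ₑ ≤ nbar α β F ξ := by
  refine (enorm_integral_le_lintegral_enorm _).trans (le_of_eq ?_)
  simp only [enorm_mul, enorm_ex, one_mul, nbar]

/-- The integral of a character over `[0, t]`. -/
def tint (t τ : ℝ) : ℂ := ∫ r in (0 : ℝ)..t, ex (r * τ)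

lemma hasDerivAt_tint (t τ : ℝ) : HasDerivAt (fun t => tint t τ) (ex (t * τ)) t :=
  ((by fun_prop : Continuous fun r => ex (r * τ)).integral_hasStrictDerivAt 0 t).hasDerivAt

lemma norm_tint_le (t τ : ℝ) : ‖tint t τ‖ ≤ |t| := by
  have := intervalIntegral.norm_integral_le_of_norm_le_const (a := 0) (b := t) (C := 1)
    (f := fun r => ex (r * τ)) (fun r _ => (norm_ex _).le)
  simpa [tint] using this

lemma measurable_tint (t : ℝ) : Measurable (tint t) := by
  have : Continuous fun τ : ℝ => ∫ r in (0 : ℝ)..t, ex (r * τ) :=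
    intervalIntegral.continuous_parametric_intervalIntegral_of_continuous' (by
      unfold Function.uncurry; fun_prop) 0 t
  exact this.measurable

/-- The time integral of the nonlinearity. -/
def duhAmp (α β : ℝ) (F : ℝ × ℝ → ℂ) (t ξ : ℝ) : ℂ := ∫ z, tint t z.1 * cub α β F ξ z

lemma measurable_duhAmp (hF : Measurable F) (t : ℝ) : Measurable (duhAmp α β F t) := by
  have h1 := measurable_cub (α := α) (β := β) hF
  have h2 := measurable_tint t
  have : Measurable fun p : ℝ × DVar => tint t p.2.1 * Function.uncurry (cub α β F) p := by
    fun_prop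
  exact this.stronglyMeasurable.integral_prod_right'.measurable

lemma enorm_duhAmp_le (t ξ : ℝ) : ‖duhAmp α β F t ξ‖ₑ ≤ ENNReal.ofReal |t| * nbar α β F ξ := by
  refine (enorm_integral_le_lintegral_enorm _).trans ?_
  rw [nbar, ← lintegral_const_mul' _ _ ENNReal.ofReal_ne_top]
  refine lintegral_mono fun z => ?_
  rw [enorm_mul]
  gcongr
  rw [← ofReal_norm]
  exact ENNReal.ofReal_le_ofReal (norm_tint_le t z.1)

@[simp] lemma duhAmp_zero (ξ : ℝ) : duhAmp α β F 0 ξ = 0 := by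
  simp [duhAmp, tint]

lemma hasDerivAt_duhAmp (hF : Measurable F) {ξ : ℝ} (hξ : nbar α β F ξ < ∞) (t : ℝ) :
    HasDerivAt (fun t => duhAmp α β F t ξ) (nl α β F t ξ) t := by
  have hi := integrable_cub hF hξ
  have hm := measurable_cub_right (α := α) (β := β) hF ξ
  refine (hasDerivAt_integral_of_dominated_loc_of_deriv_le (μ := volume) (s := univ)
    (F := fun t z => tint t z.1 * cub α β F ξ z)
    (F' := fun t z => ex (t * z.1) * cub α β F ξ z)
    (bound := fun z => ‖cub α β F ξ z‖) univ_mem ?_ ?_ ?_ ?_ hi.norm ?_).2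
  · refine Eventually.of_forall fun t => Measurable.aestronglyMeasurable ?_
    have := measurable_tint t
    fun_prop
  · refine hi.bdd_mul (c := |t|) ?_ (ae_of_all _ fun z => norm_tint_le t z.1)
    have := measurable_tint t
    exact (by fun_prop : Measurable fun z : DVar => tint t z.1).aestronglyMeasurable
  · exact (by fun_prop : Measurable fun z : DVar => ex (t * z.1) *
      cub α β F ξ z).aestronglyMeasurable
  · exact ae_of_all _ fun z y _ => by simp
  · exact ae_of_all _ fun z y _ => (hasDerivAt_tint y z.1).mul_const _

/-- Fubini's theorem lets the integral in `τ'` act on the kernel alone, where it produces the time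
integral of a character; the excluded value `τ = 0` is a null set. -/
lemma integral_ex_mul_duh (hF : Measurable F) (hT : 0 < T) {t : ℝ} (ht : |t| ≤ T) {ξ : ℝ}
    (hξ : nbar α β F ξ < ∞) :
    Integrable (fun τ' => ex (t * τ') * duh α β T F (ξ, τ')) ∧
      ∫ τ', ex (t * τ') * duh α β T F (ξ, τ') = duhAmp α β F t ξ := by
  obtain ⟨D, hD, hk⟩ := exists_lintegral_duhamelKernel_le hT
  have mk := measurable_duhamelKernel T
  have mc := measurable_cub_right (α := α) (β := β) hF ξ
  have mk' : Measurable fun p : ℝ × DVar => duhamelKernel T p.1 p.2.1 :=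
    mk.comp (f := fun p : ℝ × DVar => (p.1, p.2.1)) (by fun_prop)
  have hm : Measurable fun p : ℝ × DVar =>
      ex (t * p.1) * (duhamelKernel T p.1 p.2.1 * cub α β F ξ p.2) := by fun_prop
  have hi : Integrable (fun p : ℝ × DVar =>
      ex (t * p.1) * (duhamelKernel T p.1 p.2.1 * cub α β F ξ p.2)) (volume.prod volume) := by
    refine ⟨hm.aestronglyMeasurable, ?_⟩
    rw [hasFiniteIntegral_iff_enorm, lintegral_prod_symm _ hm.enorm.aemeasurable]
    refine lt_of_le_of_lt ?_ (ENNReal.mul_lt_top hD hξ)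
    rw [nbar, ← lintegral_const_mul' _ _ hD.ne]
    refine lintegral_mono fun z => ?_
    simp only [enorm_mul, enorm_ex, one_mul]
    rw [lintegral_mul_const' _ _ enorm_ne_top]
    gcongr
    exact hk z.1
  have e : ∀ τ', ex (t * τ') * duh α β T F (ξ, τ') =
      ∫ z, ex (t * τ') * (duhamelKernel T τ' z.1 * cub α β F ξ z) := by
    intro τ'
    rw [integral_const_mul]; rfl
  simp only [e]
  refine ⟨hi.integral_prod_left, ?_⟩
  rw [integral_integral_swap hi]
  refine integral_congr_ae ?_
  have h0 : ∀ᵐ z : DVar, z.1 ≠ 0 :=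
    Measure.quasiMeasurePreserving_fst.ae (Measure.ae_ne volume 0)
  filter_upwards [h0] with z hz
  have e2 : ∀ τ', ex (t * τ') * (duhamelKernel T τ' z.1 * cub α β F ξ z) =
      (ex (t * τ') * duhamelKernel T τ' z.1) * cub α β F ξ z := fun τ' => by ring
  simp only [e2]
  rw [integral_mul_const, integral_ex_mul_duhamelKernel hT ht hz]
  rfl

/-- Integrating the fixed point equation in the time frequency gives Duhamel's formula for `|t| ≤
T`. The linear part carries the cutoff at scale one, which is why `T ≤ 1` is needed. -/
lemma amp_eq (hσ : 0 < σ) (hP : IsProfile α β γ σ s T h F) (hT : 0 < T) (hT1 : T ≤ 1) {t : ℝ}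
    (ht : |t| ≤ T) : ∀ᵐ ξ, amp F t ξ = h ξ - Complex.I * γ * duhAmp α β F t ξ := by
  have h1 := Measure.ae_ae_of_ae_prod hP.eq
  filter_upwards [h1, ae_nbar_lt_top (α := α) (β := β) hσ hP.measurable hP.wnorm_lt] with ξ hξ hN
  obtain ⟨i1, e1⟩ := integral_ex_mul_duh hP.measurable hT ht hN
  have i2 : Integrable fun τ' => ex (t * τ') * cutoff τ' :=
    integrable_cutoff.bdd_mul (c := 1) (by fun_prop) (ae_of_all _ fun x => (norm_ex _).le)
  have e2 : ∫ τ', ex (t * τ') * cutoff τ' = 1 := by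
    have := integral_exp_mul_cutoff (ht.trans hT1)
    simpa [ex] using this
  rw [← e1, ← integral_const_mul, amp, show h ξ = (∫ τ', ex (t * τ') * cutoff τ') * h ξ by
    rw [e2, one_mul], ← integral_mul_const, ← integral_sub (i2.mul_const _) (i1.const_mul _)]
  refine integral_congr_ae ?_
  filter_upwards [hξ] with τ' hτ
  rw [hτ, lin]; ring

end

/-! ### Profiles solve the equation pointwise -/

section

variable {α β γ σ s T : ℝ} {F : ℝ × ℝ → ℂ} {h : ℝ → ℂ}

lemma abs_phase_le (α β ξ : ℝ) : |phase α β ξ| ≤ (|α| + |β|) * jb ξ ^ 3 := by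
  have h1 := one_le_jb ξ
  have h2 : |ξ| ≤ jb ξ := abs_le_jb ξ
  have h3 : jb ξ ^ 2 ≤ jb ξ ^ 3 := pow_le_pow_right₀ h1 (by norm_num)
  have h4 : |ξ| ^ 2 ≤ jb ξ ^ 2 := by gcongr
  have h5 : |ξ| ^ 3 ≤ jb ξ ^ 3 := by gcongr
  calc |phase α β ξ| ≤ |α * ξ ^ 2| + |β * ξ ^ 3| := abs_add_le _ _
    _ = |α| * |ξ| ^ 2 + |β| * |ξ| ^ 3 := by rw [abs_mul, abs_mul, abs_pow, abs_pow]
    _ ≤ |α| * jb ξ ^ 3 + |β| * jb ξ ^ 3 := by gcongr; exact h4.trans h3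
    _ = _ := by ring

/-- The spatial Fourier transform of the solution in terms of the Duhamel formula. -/
def vduh (α β γ : ℝ) (F : ℝ × ℝ → ℂ) (h : ℝ → ℂ) (t ξ : ℝ) : ℂ :=
  ex (t * phase α β ξ) * (h ξ - Complex.I * γ * duhAmp α β F t ξ)

/-- The time derivative of `vduh`. -/
def vduhDeriv (α β γ : ℝ) (F : ℝ × ℝ → ℂ) (h : ℝ → ℂ) (t ξ : ℝ) : ℂ :=
  Complex.I * phase α β ξ * vduh α β γ F h t ξ -
    Complex.I * γ * (ex (t * phase α β ξ) * nl α β F t ξ)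

lemma measurable_vduh (hF : Measurable F) (hh : Measurable h) (t : ℝ) :
    Measurable (vduh α β γ F h t) := by
  have h1 := measurable_duhAmp (α := α) (β := β) hF t
  have h2 := measurable_phase α β
  unfold vduh; fun_prop

lemma measurable_vduhDeriv (hF : Measurable F) (hh : Measurable h) (t : ℝ) :
    Measurable (vduhDeriv α β γ F h t) := by
  have h1 := measurable_vduh (α := α) (β := β) (γ := γ) hF hh t
  have h2 := measurable_phase α β
  have h3 := measurable_nl (α := α) (β := β) hF t
  unfold vduhDeriv; fun_prop

lemma hasDerivAt_vduh (hF : Measurable F) {ξ : ℝ} (hξ : nbar α β F ξ < ∞) (t : ℝ) :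
    HasDerivAt (fun t => vduh α β γ F h t ξ) (vduhDeriv α β γ F h t ξ) t := by
  have h1 := hasDerivAt_ex_mul (phase α β ξ) t
  have h2 := ((hasDerivAt_duhAmp hF hξ t).const_mul (Complex.I * γ)).const_sub (h ξ)
  exact (h1.mul h2).congr_deriv (by unfold vduhDeriv vduh; ring)

lemma norm_vduh_le {ξ : ℝ} (hξ : nbar α β F ξ < ∞) {R : ℝ} {t : ℝ} (ht : |t| ≤ R) :
    ‖vduh α β γ F h t ξ‖ ≤ ‖h ξ‖ + |γ| * (R * (nbar α β F ξ).toReal) := by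
  have h1 : ‖duhAmp α β F t ξ‖ ≤ R * (nbar α β F ξ).toReal := by
    have := ENNReal.toReal_mono (by finiteness) (enorm_duhAmp_le (α := α) (β := β) (F := F) t ξ)
    rw [toReal_enorm, ENNReal.toReal_mul, ENNReal.toReal_ofReal (abs_nonneg t)] at this
    exact this.trans (by gcongr)
  rw [vduh, norm_mul, norm_ex, one_mul]
  refine (norm_sub_le _ _).trans ?_
  rw [norm_mul, norm_mul, Complex.norm_I, one_mul, Complex.norm_real, Real.norm_eq_abs]
  gcongr

lemma norm_vduhDeriv_le {ξ : ℝ} (hξ : nbar α β F ξ < ∞) {R : ℝ} {t : ℝ} (ht : |t| ≤ R) :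
    ‖vduhDeriv α β γ F h t ξ‖ ≤ (|α| + |β|) * (jb ξ ^ 3 * ‖h ξ‖) +
      ((|α| + |β|) * |γ| * R + |γ|) * (jb ξ ^ 3 * (nbar α β F ξ).toReal) := by
  have h1 := norm_vduh_le (γ := γ) (h := h) hξ ht
  have h2 : ‖nl α β F t ξ‖ ≤ (nbar α β F ξ).toReal := by
    have := ENNReal.toReal_mono hξ.ne (enorm_nl_le (α := α) (β := β) (F := F) t ξ)
    rwa [toReal_enorm] at this
  have h3 := abs_phase_le α β ξ
  have h4 : 1 ≤ jb ξ ^ 3 := one_le_pow₀ (one_le_jb ξ)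
  have hN := (nbar α β F ξ).toReal_nonneg
  refine (norm_sub_le _ _).trans ?_
  simp only [norm_mul, Complex.norm_I, one_mul, Complex.norm_real, Real.norm_eq_abs, norm_ex]
  calc _ ≤ (|α| + |β|) * jb ξ ^ 3 * (‖h ξ‖ + |γ| * (R * (nbar α β F ξ).toReal)) +
        |γ| * (jb ξ ^ 3 * (nbar α β F ξ).toReal) := by
        gcongr
        exact h2.trans (le_mul_of_one_le_left hN h4)
    _ = _ := by ring

lemma integrable_jb_pow_mul_norm (hh : RapidlyIntegrable h) (k : ℕ) :
    Integrable fun ξ => jb ξ ^ k * ‖h ξ‖ := by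
  have hm := hh.measurable
  have mj := measurable_jb
  refine ⟨(by fun_prop : Measurable _).aestronglyMeasurable, ?_⟩
  rw [hasFiniteIntegral_iff_enorm]
  refine lt_of_eq_of_lt (lintegral_congr fun ξ => ?_) (hh.lintegral_lt k)
  have := jb_nonneg ξ
  rw [enorm_mul, enorm_norm, Real.enorm_of_nonneg (by positivity)]

lemma integrable_jb_pow_mul_nbar (hσ : 0 < σ) (hF : Measurable F)
    (hn : wnorm σ s (fun p => ‖F p‖ₑ) < ∞) (k : ℕ) :
    Integrable fun ξ => jb ξ ^ k * (nbar α β F ξ).toReal := by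
  have mj := measurable_jb
  have mN := measurable_nbar (α := α) (β := β) hF
  refine ⟨(by fun_prop : Measurable _).aestronglyMeasurable, ?_⟩
  rw [hasFiniteIntegral_iff_enorm]
  refine lt_of_eq_of_lt (lintegral_congr_ae ?_) (lintegral_jb_pow_nbar_lt_top (α := α) (β := β)
    hσ hF hn k)
  filter_upwards [ae_nbar_lt_top (α := α) (β := β) hσ hF hn] with ξ hξ
  have := jb_nonneg ξ
  rw [enorm_mul, Real.enorm_of_nonneg (by positivity), Real.enorm_of_nonneg ENNReal.toReal_nonneg,
    ENNReal.ofReal_toReal hξ.ne]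

/-- Unlike `vhat`, the Duhamel expression is visibly differentiable in time, and at every `t`. The
derivative costs three powers of `⟨ξ⟩`, supplied by the decay of `h` and the moments of the cubic
term. -/
lemma hasDerivAt_osc_vduh (hσ : 0 < σ) (hF : Measurable F)
    (hn : wnorm σ s (fun p => ‖F p‖ₑ) < ∞) (hh : RapidlyIntegrable h) (t x : ℝ) :
    Integrable (vduh α β γ F h t) ∧ Integrable (vduhDeriv α β γ F h t) ∧
      HasDerivAt (fun t => osc (vduh α β γ F h t) x) (osc (vduhDeriv α β γ F h t) x) t := by
  have hN := ae_nbar_lt_top (α := α) (β := β) hσ hF hn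
  have iN := fun k => integrable_jb_pow_mul_nbar (α := α) (β := β) hσ hF hn k
  have ih := fun k => integrable_jb_pow_mul_norm hh k
  have mv := measurable_vduh (α := α) (β := β) (γ := γ) hF hh.measurable
  have md := measurable_vduhDeriv (α := α) (β := β) (γ := γ) hF hh.measurable
  have i1 : ∀ t, Integrable (vduh α β γ F h t) := fun t => by
    refine Integrable.mono' (hh.integrable.norm.add (((iN 0).const_mul (|t|)).const_mul |γ|))
      (mv t).aestronglyMeasurable ?_
    filter_upwards [hN] with ξ hξ
    simpa using norm_vduh_le (γ := γ) (h := h) hξ le_rfl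
  have i2 : ∀ R, Integrable fun ξ => (|α| + |β|) * (jb ξ ^ 3 * ‖h ξ‖) +
      ((|α| + |β|) * |γ| * R + |γ|) * (jb ξ ^ 3 * (nbar α β F ξ).toReal) := fun R =>
    ((ih 3).const_mul _).add ((iN 3).const_mul _)
  refine ⟨i1 t, ?_, ?_⟩
  · refine Integrable.mono' (i2 |t|) (md t).aestronglyMeasurable ?_
    filter_upwards [hN] with ξ hξ
    exact norm_vduhDeriv_le hξ le_rfl
  simp only [osc_real]
  refine (hasDerivAt_integral_of_dominated_loc_of_deriv_le (μ := volume)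
    (s := Metric.ball t 1) (F := fun t ξ => ex (x * ξ) * vduh α β γ F h t ξ)
    (F' := fun t ξ => ex (x * ξ) * vduhDeriv α β γ F h t ξ)
    (Metric.ball_mem_nhds t one_pos) ?_ ?_ ?_ ?_ (i2 (|t| + 1)) ?_).2
  · refine Eventually.of_forall fun t => Measurable.aestronglyMeasurable ?_
    have := mv t
    fun_prop
  · exact (i1 t).bdd_mul (c := 1)
      (by fun_prop : Measurable fun ξ : ℝ => ex (x * ξ)).aestronglyMeasurable
      (ae_of_all _ fun p => (norm_ex _).le)
  · have := md t
    exact (by fun_prop : Measurable fun ξ : ℝ => ex (x * ξ) *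
      vduhDeriv α β γ F h t ξ).aestronglyMeasurable
  · filter_upwards [hN] with ξ hξ t' ht'
    rw [norm_mul, norm_ex, one_mul]
    refine norm_vduhDeriv_le hξ ?_
    rw [Metric.mem_ball, Real.dist_eq] at ht'
    have := abs_sub_abs_le_abs_sub t' t
    linarith
  · filter_upwards [hN] with ξ hξ t' _
    exact (hasDerivAt_vduh hF hξ t').const_mul _

/-- The resonance in the time component of `shp` is exactly what makes the three characters multiply
to that of the output. -/
lemma chr_mul_triC (α β t x : ℝ) (F : ℝ × ℝ → ℂ) (q : ℝ × ℝ) (z : (ℝ × ℝ) × (ℝ × ℝ)) :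
    chr α β t x z.1 * F z.1 * (chr α β t x z.2 * F z.2) *
      (starRingEnd ℂ) (chr α β t x (shp α β q z) * F (shp α β q z)) =
    chr α β t x q * triC α β F F F q z := by
  have : chr α β t x q = chr α β t x z.1 * chr α β t x z.2 *
      (starRingEnd ℂ) (chr α β t x (shp α β q z)) := by
    simp only [chr, conj_ex, ← ex_add, shp, resonance]
    congr 1; ring
  rw [this, map_mul, triC]; ring

/-- The cubic nonlinearity on the Fourier side. -/
lemma vsol_cubed (hσ : 0 < σ) (hF : Measurable F) (hn : wnorm σ s (fun p => ‖F p‖ₑ) < ∞)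
    (t x : ℝ) : (‖vsol α β F t x‖ : ℂ) ^ 2 * vsol α β F t x =
      osc (fun ξ => ex (t * phase α β ξ) * nl α β F t ξ) x := by
  have hi := integrable_profile hσ hF hn
  have mt := measurable_triC α β hF hF hF
  have mE := measurable_chr (α := α) (β := β) t x
  have hG : Integrable (fun p : (ℝ × ℝ) × ((ℝ × ℝ) × (ℝ × ℝ)) =>
      chr α β t x p.1 * triC α β F F F p.1 p.2) (volume.prod volume) := by
    have hm : Measurable fun p : (ℝ × ℝ) × ((ℝ × ℝ) × (ℝ × ℝ)) =>
        chr α β t x p.1 * triC α β F F F p.1 p.2 := (mE.comp measurable_fst).mul mt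
    refine ⟨hm.aestronglyMeasurable, ?_⟩
    rw [hasFiniteIntegral_iff_enorm, lintegral_prod _ hm.enorm.aemeasurable]
    have h0 := lintegral_jb_pow_profile_lt_top hσ hF hn 0
    simp only [pow_zero, ENNReal.ofReal_one, one_mul] at h0
    have h1 := lintegral_tri α β hF.enorm hF.enorm hF.enorm
    have h2 : ∀ q w, ‖chr α β t x q * triC α β F F F q w‖ₑ =
        tri α β (fun p => ‖F p‖ₑ) (fun p => ‖F p‖ₑ) (fun p => ‖F p‖ₑ) q w := fun q w => by
      rw [enorm_mul, enorm_triC, chr, enorm_ex, one_mul]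
    simp only [h2]
    rw [h1]
    exact ENNReal.mul_lt_top (ENNReal.mul_lt_top h0 h0) h0
  have e1 : (‖vsol α β F t x‖ : ℂ) ^ 2 * vsol α β F t x =
      vsol α β F t x * vsol α β F t x * (starRingEnd ℂ) (vsol α β F t x) := by
    rw [← Complex.mul_conj']; ring
  -- For each fixed pair of inputs the conjugated factor is rewritten as an integral over the output
  -- `q`, since `shp` preserves measure in `q`.
  have e2 : ∀ z : (ℝ × ℝ) × (ℝ × ℝ), (starRingEnd ℂ) (vsol α β F t x) =
      ∫ q, (starRingEnd ℂ) (chr α β t x (shp α β q z) * F (shp α β q z)) := fun z => by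
    have mp := measurePreserving_shp α β z
    have hm : Measurable fun q => (starRingEnd ℂ) (chr α β t x q * F q) :=
      Complex.continuous_conj.measurable.comp (mE.mul hF)
    rw [vsol_eq hi, ← integral_conj]
    conv_lhs => rw [← mp.map_eq]
    exact integral_map mp.measurable.aemeasurable hm.aestronglyMeasurable
  have e3 : vsol α β F t x * vsol α β F t x * (starRingEnd ℂ) (vsol α β F t x) =
      ∫ z : (ℝ × ℝ) × (ℝ × ℝ), ∫ q, chr α β t x q * triC α β F F F q z := by
    have := integral_prod_mul (μ := (volume : Measure (ℝ × ℝ))) (ν := (volume : Measure (ℝ × ℝ)))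
      (fun p => chr α β t x p * F p) (fun p => chr α β t x p * F p)
    rw [← vsol_eq hi] at this
    rw [← this, ← integral_mul_const]
    refine integral_congr_ae (ae_of_all _ fun z => ?_)
    simp only
    rw [e2 z, ← integral_const_mul]
    simp only [chr_mul_triC]
  have e4 : (∫ z : (ℝ × ℝ) × (ℝ × ℝ), ∫ q, chr α β t x q * triC α β F F F q z) =
      ∫ q, ∫ z : (ℝ × ℝ) × (ℝ × ℝ), chr α β t x q * triC α β F F F q z :=
    (integral_integral_swap hG).symm
  rw [e1, e3, e4, Measure.volume_eq_prod, integral_prod _ hG.integral_prod_left, osc_real]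
  refine integral_congr_ae ?_
  filter_upwards [ae_nbar_lt_top (α := α) (β := β) hσ hF hn] with ξ hξ
  have hc := integrable_cub hF hξ
  have hc' : Integrable (fun z : DVar => ex (t * z.1) * cub α β F ξ z) :=
    hc.bdd_mul (c := 1) (by fun_prop : Measurable fun z : DVar =>
      ex (t * z.1)).aestronglyMeasurable (ae_of_all _ fun x => (norm_ex _).le)
  have hnl : nl α β F t ξ = ∫ τ, ∫ w, ex (t * τ) * cub α β F ξ (τ, w) := integral_prod _ hc'
  rw [hnl, ← integral_const_mul, ← integral_const_mul]
  refine integral_congr_ae (ae_of_all _ fun τ => ?_)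
  simp only
  rw [integral_const_mul, integral_const_mul, chr]
  simp only [cub]
  rw [mul_add, ex_add, ex_add]; ring

lemma osc_congr {g k : ℝ → ℂ} (e : g =ᵐ[volume] k) : osc g = osc k := by
  funext x
  refine integral_congr_ae ?_
  filter_upwards [e] with ξ hξ
  rw [hξ]

lemma vhat_eq_vduh (hσ : 0 < σ) (hP : IsProfile α β γ σ s T h F) (hT : 0 < T) (hT1 : T ≤ 1)
    {t : ℝ} (ht : |t| ≤ T) : vhat α β F t =ᵐ[volume] vduh α β γ F h t := by
  filter_upwards [amp_eq hσ hP hT hT1 ht] with ξ hξ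
  rw [vhat, hξ, vduh]

/-- A profile gives a pointwise solution of the equation. -/
theorem hasDerivWithinAt_vsol (hσ : 0 < σ) (hP : IsProfile α β γ σ s T h F) (hT : 0 < T)
    (hT1 : T ≤ 1) (hh : RapidlyIntegrable h) {t : ℝ} (ht : t ∈ Icc (-T) T) (x : ℝ) :
    HasDerivWithinAt (fun t' => vsol α β F t' x)
      (-(Complex.I * α * iteratedDeriv 2 (vsol α β F t) x + β * iteratedDeriv 3 (vsol α β F t) x
        + Complex.I * γ * (‖vsol α β F t x‖ : ℂ) ^ 2 * vsol α β F t x)) (Icc (-T) T) t := by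
  have hF := hP.measurable
  have hn := hP.wnorm_lt
  -- On `[-T, T]` the function agrees with one that is differentiable at all times, which also
  -- settles the one-sided derivatives at the end points.
  have e : ∀ t' ∈ Icc (-T) T, vsol α β F t' x = osc (vduh α β γ F h t') x := fun t' ht' => by
    rw [vsol, osc_congr (vhat_eq_vduh hσ hP hT hT1 (abs_le.2 ht'))]
  obtain ⟨i1, i2, hd⟩ := hasDerivAt_osc_vduh (α := α) (β := β) (γ := γ) hσ hF hn hh t x
  refine (hd.hasDerivWithinAt.congr e (e t ht)).congr_deriv ?_
  have hv := rapidlyIntegrable_vhat (α := α) (β := β) hσ hF hn t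
  have c3 := vsol_cubed (α := α) (β := β) hσ hF hn t x
  have mn := measurable_nl (α := α) (β := β) hF t
  have mp := measurable_phase α β
  have iN := integrable_jb_pow_mul_nbar (α := α) (β := β) hσ hF hn 0
  have i3 : Integrable fun ξ => ex (t * phase α β ξ) * nl α β F t ξ := by
    refine Integrable.mono' iN (by fun_prop : Measurable _).aestronglyMeasurable ?_
    filter_upwards [ae_nbar_lt_top (α := α) (β := β) hσ hF hn] with ξ hξ
    rw [norm_mul, norm_ex, one_mul, pow_zero, one_mul, ← toReal_enorm]
    exact ENNReal.toReal_mono hξ.ne (enorm_nl_le t ξ)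
  have hv2 := hv.I_mul.I_mul
  have hv3 := hv2.I_mul
  have j : ∀ {k : ℝ → ℂ}, Integrable k → Integrable fun ξ => ex (x * ξ) * k ξ := fun hk =>
    hk.bdd_mul (c := 1) (by fun_prop : Measurable fun ξ : ℝ => ex (x * ξ)).aestronglyMeasurable
      (ae_of_all _ fun p => (norm_ex _).le)
  have k2 := (j hv2.integrable).const_mul (Complex.I * α)
  have k3 := (j hv3.integrable).const_mul (β : ℂ)
  have kn := (j i3).const_mul (Complex.I * γ)
  have k23 : Integrable fun ξ : ℝ =>
      Complex.I * α * (ex (x * ξ) * (Complex.I * (ξ : ℂ) * (Complex.I * (ξ : ℂ) *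
        vhat α β F t ξ))) +
      β * (ex (x * ξ) * (Complex.I * (ξ : ℂ) * (Complex.I * (ξ : ℂ) *
        (Complex.I * (ξ : ℂ) * vhat α β F t ξ)))) := k2.add k3
  rw [mul_assoc (Complex.I * γ), c3, vsol, iteratedDeriv_osc 2 hv, iteratedDeriv_osc 3 hv]
  simp only [osc_real]
  have e2 : ∀ ξ : ℝ, ex (x * ξ) * ((Complex.I * (ξ : ℂ)) ^ 2 * vhat α β F t ξ) =
      ex (x * ξ) * (Complex.I * (ξ : ℂ) * (Complex.I * (ξ : ℂ) * vhat α β F t ξ)) := fun ξ => by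
    ring
  have e3 : ∀ ξ : ℝ, ex (x * ξ) * ((Complex.I * (ξ : ℂ)) ^ 3 * vhat α β F t ξ) =
      ex (x * ξ) * (Complex.I * (ξ : ℂ) * (Complex.I * (ξ : ℂ) *
        (Complex.I * (ξ : ℂ) * vhat α β F t ξ))) := fun ξ => by ring
  simp only [e2, e3]
  rw [← integral_const_mul, ← integral_const_mul, ← integral_const_mul, ← integral_add k2 k3,
    ← integral_add k23 kn, ← integral_neg]
  refine integral_congr_ae ?_
  filter_upwards [vhat_eq_vduh hσ hP hT hT1 (abs_le.2 ht)] with ξ hξ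
  simp only [vduhDeriv]
  rw [hξ, phase]
  push_cast
  linear_combination (ex (x * ξ) * vduh α β γ F h t ξ * (Complex.I * α * ξ ^ 2 +
    Complex.I * β * ξ ^ 3)) * Complex.I_sq

theorem vsol_zero (hσ : 0 < σ) (hP : IsProfile α β γ σ s T h F) (hT : 0 < T) (hT1 : T ≤ 1) :
    vsol α β F 0 = osc h := by
  rw [vsol, osc_congr (vhat_eq_vduh hσ hP hT hT1 (by simpa using hT.le))]
  congr 1; funext ξ
  simp [vduh]

/-- A profile gives a solution in the space `C([-T, T]; G^{σ,s}) ∩ Z_T^{σ,s,3/4}`. -/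
theorem isSolution_vsol (hσ : 0 < σ) (hP : IsProfile α β γ σ s T h F) (hT : 0 < T)
    (hT1 : T ≤ 1) (hh : RapidlyIntegrable h) {v₀ : ℝ → ℂ} (hv : osc h =ᵐ[volume] v₀) :
    IsSolution α β γ σ s (3 / 4) T v₀ (vsol α β F) := by
  refine ⟨continuousInGevrey_vsol hσ hP.measurable hP.wnorm_lt T, ?_, fun t _ => ?_,
    fun t ht x => hasDerivWithinAt_vsol hσ hP hT hT1 hh ht x, ?_⟩
  · have := (restrictedNorm_vsol_sq_le (α := α) (β := β) hσ hP.measurable hP.wnorm_lt T).trans_lt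
      (ENNReal.mul_lt_top (by finiteness) hP.wnorm_lt)
    by_contra hh
    rw [not_lt, top_le_iff] at hh
    simp [hh] at this
  · exact contDiff_osc 3 (rapidlyIntegrable_vhat hσ hP.measurable hP.wnorm_lt t)
  · rw [vsol_zero hσ hP hT hT1]; exact hv

end

/-! ### The initial data on the Fourier side -/

section

open Classical in
/-- The Fourier transform normalised so that `osc` is its inverse. -/
def spec (f : ℝ → ℂ) (ξ : ℝ) : ℂ :=
  if h : MemLp f 2 (volume : Measure ℝ) then hat (h.toLp f) ξ / (2 * Real.pi : ℝ) else 0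

lemma spec_eq {f : ℝ → ℂ} (h : MemLp f 2 volume) :
    spec f = fun ξ => ((2 * Real.pi : ℝ) : ℂ)⁻¹ * hat (h.toLp f) ξ := by
  funext ξ; rw [spec, dif_pos h]; ring

lemma measurable_spec (f : ℝ → ℂ) : Measurable (spec f) := by
  by_cases h : MemLp f 2 volume
  · rw [spec_eq h]; exact (measurable_hat _).const_mul _
  · have : spec f = fun _ => 0 := by funext ξ; rw [spec, dif_neg h]
    rw [this]; exact measurable_const

lemma enorm_two_pi_inv_sq_le : ‖((2 * Real.pi : ℝ) : ℂ)⁻¹‖ₑ ^ 2 ≤ 1 := by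
  refine pow_le_one' ?_ 2
  rw [← ofReal_norm, norm_inv, Complex.norm_real, Real.norm_of_nonneg (by positivity)]
  refine (ENNReal.ofReal_le_ofReal ?_).trans_eq ENNReal.ofReal_one
  exact inv_le_one_of_one_le₀ (by linarith [Real.pi_gt_three])

lemma hnorm_spec_le {σ s : ℝ} {f : ℝ → ℂ} (h : MemLp f 2 volume) :
    hnorm σ s (spec f) ≤ gevreyNorm σ s f ^ 2 := by
  rw [spec_eq h, hnorm_const_mul, gevreyNorm_sq h]
  exact mul_le_of_le_one_left' enorm_two_pi_inv_sq_le

lemma hat_sub (f g : Lp ℂ 2 (volume : Measure ℝ)) :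
    hat (f - g) =ᵐ[volume] fun ξ => hat f ξ - hat g ξ := by
  have e : 𝓕 (f - g) = 𝓕 f - 𝓕 g := (Lp.fourierTransformₗᵢ ℝ ℂ).map_sub f g
  have := (Measure.quasiMeasurePreserving_smul (volume : Measure ℝ)
    (r := (2 * Real.pi)⁻¹) (by positivity)).ae (Lp.coeFn_sub (𝓕 f) (𝓕 g))
  filter_upwards [this] with ξ hξ
  rw [← e, smul_eq_mul, inv_mul_eq_div] at hξ
  exact hξ

lemma spec_sub {f g : ℝ → ℂ} (hf : MemLp f 2 volume) (hg : MemLp g 2 volume) :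
    spec (f - g) =ᵐ[volume] fun ξ => spec f ξ - spec g ξ := by
  rw [spec_eq hf, spec_eq hg, spec_eq (hf.sub hg)]
  have : (hf.sub hg).toLp (f - g) = hf.toLp f - hg.toLp g := rfl
  rw [this]
  filter_upwards [hat_sub (hf.toLp f) (hg.toLp g)] with ξ hξ
  rw [hξ]; ring

lemma hnorm_spec_sub_le {σ s : ℝ} {f g : ℝ → ℂ} (hf : MemLp f 2 volume) (hg : MemLp g 2 volume) :
    hnorm σ s (fun ξ => spec f ξ - spec g ξ) ≤ gevreyNorm σ s (f - g) ^ 2 := by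
  rw [← hnorm_congr (spec_sub hf hg)]
  exact hnorm_spec_le (hf.sub hg)

lemma rapidlyIntegrable_spec {σ s : ℝ} (hσ : 0 < σ) {f : ℝ → ℂ} (h : gevreyNorm σ s f < ∞) :
    RapidlyIntegrable (spec f) :=
  rapidlyIntegrable_of_hnorm hσ (measurable_spec f)
    ((hnorm_spec_le (memLp_of_gevreyNorm h)).trans_lt (by finiteness))

lemma osc_spec {σ s : ℝ} (hσ : 0 < σ) {f : ℝ → ℂ} (h : gevreyNorm σ s f < ∞) :
    osc (spec f) =ᵐ[volume] f := by
  have hf := memLp_of_gevreyNorm h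
  have hi : Integrable (hat (hf.toLp f)) := by
    have h2 : hnorm σ s (hat (hf.toLp f)) < ∞ := by rw [← gevreyNorm_sq hf]; finiteness
    exact (rapidlyIntegrable_of_hnorm hσ (measurable_hat _) h2).integrable
  have e : spec f = fun ξ => hat (hf.toLp f) ξ / (2 * Real.pi : ℝ) := by
    funext ξ; rw [spec, dif_pos hf]
  rw [e]
  exact (osc_hat hi).trans hf.coeFn_toLp

/-- Both sides are continuous, so equality almost everywhere is equality. Derivatives of an
arbitrary solution can thus be computed from its Fourier integral. -/
lemma osc_spec_eq {σ s : ℝ} (hσ : 0 < σ) {f : ℝ → ℂ} (h : gevreyNorm σ s f < ∞)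
    (hc : Continuous f) : osc (spec f) = f :=
  (continuous_osc (rapidlyIntegrable_spec hσ h).integrable).ae_eq_iff_eq volume hc |>.1
    (osc_spec hσ h)

lemma gevreyNorm_eq {σ s : ℝ} {f : ℝ → ℂ} (hf : MemLp f 2 volume) :
    gevreyNorm σ s f = eLpNorm (fun ξ => gw σ s ξ • hat (hf.toLp f) ξ) 2 volume := by
  unfold gevreyNorm; exact ciInf_pos hf

lemma gevreyNorm_le_add {σ s : ℝ} {f g : ℝ → ℂ} (hf : MemLp f 2 volume) (hg : MemLp g 2 volume) :
    gevreyNorm σ s f ≤ gevreyNorm σ s (f - g) + gevreyNorm σ s g := by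
  rw [gevreyNorm_eq hf, gevreyNorm_eq hg, gevreyNorm_eq (hf.sub hg)]
  have m := fun k : Lp ℂ 2 (volume : Measure ℝ) =>
    ((measurable_gw σ s).smul (measurable_hat k)).aestronglyMeasurable (μ := volume)
  refine le_trans (le_of_eq (eLpNorm_congr_ae ?_)) (eLpNorm_add_le (m _) (m _) one_le_two)
  have : (hf.sub hg).toLp (f - g) = hf.toLp f - hg.toLp g := rfl
  rw [this]
  filter_upwards [hat_sub (hf.toLp f) (hg.toLp g)] with ξ hξ
  simp only [Pi.add_apply, hξ, smul_sub, sub_add_cancel]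

lemma memLp_of_gevreyNorm_sub {σ s : ℝ} {f g : ℝ → ℂ} (h : gevreyNorm σ s (f - g) < ∞)
    (hg : MemLp g 2 volume) : MemLp f 2 volume := by
  simpa using (memLp_of_gevreyNorm h).add hg

/-- Plancherel's theorem for oscillatory integrals. -/
lemma eLpNorm_osc_sq {g : ℝ → ℂ} (hm : Measurable g) (h1 : Integrable g) (h2 : MemLp g 2 volume) :
    eLpNorm (osc g) 2 volume ^ 2 = ENNReal.ofReal (2 * Real.pi) * ∫⁻ ξ, ‖g ξ‖ₑ ^ 2 := by
  have hpi : (0 : ℝ) < 2 * Real.pi := by positivity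
  have e1 : eLpNorm (osc g) 2 volume = eLpNorm (rescale g) 2 volume := by
    have : ‖(memLp_osc hm h1 h2).toLp (osc g)‖ₑ = ‖(memLp_rescale hm h2).toLp (rescale g)‖ₑ := by
      have e := toLp_osc hm h1 h2
      have e' := Lp.norm_fourier_eq (𝓕⁻ ((memLp_rescale hm h2).toLp (rescale g)))
      rw [FourierTransform.fourier_fourierInv_eq] at e'
      rw [e, ← ofReal_norm, ← ofReal_norm, e']
    rwa [Lp.enorm_toLp, Lp.enorm_toLp] at this
  rw [e1, eLpNorm_two_sq]
  have e2 : ∀ η, ‖rescale g η‖ₑ ^ 2 = ENNReal.ofReal (2 * Real.pi) ^ 2 *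
      ‖g (2 * Real.pi * η)‖ₑ ^ 2 := fun η => by
    simp only [rescale, Module.finrank_self, pow_one, smul_eq_mul]
    rw [enorm_mul, ← ofReal_norm ((2 * Real.pi : ℝ) : ℂ), Complex.norm_real,
      Real.norm_of_nonneg hpi.le, mul_pow]
  simp only [e2]
  rw [lintegral_const_mul' _ _ (by finiteness),
    lintegral_comp_mul_left' (fun ξ => ‖g ξ‖ₑ ^ 2) (by fun_prop) hpi.ne', abs_of_pos (inv_pos.2 hpi),
    ENNReal.ofReal_inv_of_pos hpi, ← mul_assoc, sq, mul_assoc (ENNReal.ofReal _),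
    ENNReal.mul_inv_cancel (by simpa using hpi) (by finiteness), mul_one]

end

/-! ### Differentiability in `L²` and the energy argument -/

section

lemma Lp_ext_of_integral {f g : Lp ℂ 2 (volume : Measure ℝ)}
    (h : ∀ ψ : ℝ → ℝ, Continuous ψ → HasCompactSupport ψ → ∫ x, ψ x • f x = ∫ x, ψ x • g x) :
    f = g :=
  Lp.ext (ae_eq_of_integral_contDiff_smul_eq ((Lp.memLp f).locallyIntegrable one_le_two)
    ((Lp.memLp g).locallyIntegrable one_le_two) fun ψ hψ hc => h ψ hψ.continuous hc)

/-- Two families in `L²` with the same weak derivative agree when they agree at one time. -/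
lemma Lp_eq_of_weak_derivative {a b : ℝ} {z g : ℝ → ℝ → ℂ}
    {Z G W : ℝ → Lp ℂ 2 (volume : Measure ℝ)} (hZ : ∀ t ∈ Ioo a b, Z t =ᵐ[volume] z t)
    (hG : ∀ t ∈ Ioo a b, G t =ᵐ[volume] g t)
    (hd : ∀ t ∈ Ioo a b, ∀ x, HasDerivAt (fun t => z t x) (g t x) t) {B : ℝ}
    (hB : ∀ t ∈ Ioo a b, ∀ x, ‖g t x‖ ≤ B) (hW : ∀ t ∈ Ioo a b, HasDerivAt W (G t) t)
    {t : ℝ} (ht : t ∈ Ioo a b) (hZW : Z t = W t) {r : ℝ} (hr : r ∈ Ioo a b) : Z r = W r := by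
  have hmZ : ∀ r ∈ Ioo a b, MemLp (z r) 2 volume := fun r hr => (Lp.memLp (Z r)).ae_eq (hZ r hr)
  have hmG : ∀ r ∈ Ioo a b, MemLp (g r) 2 volume := fun r hr => (Lp.memLp (G r)).ae_eq (hG r hr)
  -- Paired with a test function, both families become scalar functions of time with the same
  -- derivative: for `Z` by differentiation under the integral, dominated by `B|ψ|`, and for `W` by
  -- linearity of the inner product.
  refine Lp_ext_of_integral fun ψ hψ hc => ?_
  have hψc : Continuous fun x => (ψ x : ℂ) := Complex.continuous_ofReal.comp hψ
  have hcs : HasCompactSupport fun x => (ψ x : ℂ) :=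
    hc.comp_left (g := fun r : ℝ => (r : ℂ)) Complex.ofReal_zero
  have hψ2 : MemLp (fun x => (ψ x : ℂ)) 2 volume := hψc.memLp_of_hasCompactSupport hcs
  have hψ1 : Integrable fun x => (ψ x : ℂ) := hψc.integrable_of_hasCompactSupport hcs
  have hin : ∀ f : Lp ℂ 2 (volume : Measure ℝ),
      inner ℂ (hψ2.toLp _) f = ∫ x, ψ x • f x := fun f => by
    rw [L2.inner_def]
    refine integral_congr_ae ?_
    filter_upwards [hψ2.coeFn_toLp] with x hx
    rw [hx, RCLike.inner_apply, Complex.conj_ofReal, Complex.real_smul, mul_comm]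
  have hf : ∀ r ∈ Ioo a b, HasDerivAt (fun r => ∫ x, (ψ x : ℂ) * z r x)
      (∫ x, (ψ x : ℂ) * g r x) r := by
    intro r hr
    refine (hasDerivAt_integral_of_dominated_loc_of_deriv_le (μ := volume) (s := Ioo a b)
      (F := fun r x => (ψ x : ℂ) * z r x) (F' := fun r x => (ψ x : ℂ) * g r x)
      (bound := fun x => ‖(ψ x : ℂ)‖ * B) (isOpen_Ioo.mem_nhds hr) ?_ ?_ ?_ ?_ ?_ ?_).2
    · filter_upwards [isOpen_Ioo.mem_nhds hr] with r' hr'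
      exact hψ1.aestronglyMeasurable.mul (hmZ r' hr').aestronglyMeasurable
    · exact MemLp.integrable_mul hψ2 (hmZ r hr)
    · exact hψ1.aestronglyMeasurable.mul (hmG r hr).aestronglyMeasurable
    · refine ae_of_all _ fun x r' hr' => ?_
      rw [norm_mul]
      exact mul_le_mul_of_nonneg_left (hB r' hr' x) (norm_nonneg _)
    · exact hψ1.norm.mul_const B
    · exact ae_of_all _ fun x r' hr' => (hd r' hr' x).const_mul _
  have hg : ∀ r ∈ Ioo a b, HasDerivAt (fun r => inner ℂ (hψ2.toLp _) (W r))
      (∫ x, (ψ x : ℂ) * g r x) r := by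
    intro r hr
    have h1 := (hasDerivAt_const r (hψ2.toLp (fun x => (ψ x : ℂ)))).inner ℂ (hW r hr)
    refine h1.congr_deriv ?_
    rw [inner_zero_left, add_zero, hin]
    refine integral_congr_ae ?_
    filter_upwards [hG r hr] with x hx
    rw [hx, Complex.real_smul]
  have hfz : ∀ r ∈ Ioo a b, ∫ x, (ψ x : ℂ) * z r x = ∫ x, ψ x • Z r x := fun r hr => by
    refine integral_congr_ae ?_
    filter_upwards [hZ r hr] with x hx
    rw [hx, Complex.real_smul]
  have := isOpen_Ioo.eqOn_of_deriv_eq (isPreconnected_Ioo)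
    (fun r hr => (hf r hr).differentiableAt.differentiableWithinAt)
    (fun r hr => (hg r hr).differentiableAt.differentiableWithinAt)
    (fun r hr => by rw [(hf r hr).deriv, (hg r hr).deriv]) ht (by rw [hin, hfz t ht, hZW])
  have h2 := this hr
  simp only at h2
  rw [← hfz r hr, h2, hin]

/-- A family of functions that is differentiable in the parameter at every point, with a bounded
derivative that is continuous in `L²`, is differentiable in `L²`. -/
theorem hasDerivAt_Lp_of_pointwise {a b : ℝ} {z g : ℝ → ℝ → ℂ}
    {Z G : ℝ → Lp ℂ 2 (volume : Measure ℝ)} (hZ : ∀ t ∈ Ioo a b, Z t =ᵐ[volume] z t)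
    (hG : ∀ t ∈ Ioo a b, G t =ᵐ[volume] g t) (hGc : ContinuousOn G (Ioo a b))
    (hd : ∀ t ∈ Ioo a b, ∀ x, HasDerivAt (fun t => z t x) (g t x) t) {B : ℝ}
    (hB : ∀ t ∈ Ioo a b, ∀ x, ‖g t x‖ ≤ B) {t : ℝ} (ht : t ∈ Ioo a b) :
    HasDerivAt Z (G t) t := by
  -- The primitive of `G` in `L²` with value `Z t` at time `t` is differentiable by continuity of
  -- `G`; it has the same weak derivative as `Z` and hence coincides with it.
  have hWd : ∀ r ∈ Ioo a b, HasDerivAt (fun r => Z t + ∫ ρ in t..r, G ρ) (G r) r := by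
    intro r hr
    have hsub : uIcc t r ⊆ Ioo a b := OrdConnected.uIcc_subset inferInstance ht hr
    exact (intervalIntegral.integral_hasDerivAt_right ((hGc.mono hsub).intervalIntegrable)
      (hGc.stronglyMeasurableAtFilter isOpen_Ioo r hr)
      (hGc.continuousAt (isOpen_Ioo.mem_nhds hr))).const_add (Z t)
  refine (hWd t ht).congr_of_eventuallyEq ?_
  filter_upwards [isOpen_Ioo.mem_nhds ht] with r hr
  exact Lp_eq_of_weak_derivative hZ hG hd hB hWd ht (by simp) hr

/-- An energy argument: the derivative is the sum of a part that is orthogonal to the function and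
a part that is controlled by it. -/
lemma eq_zero_of_energy {H : Type*} [NormedAddCommGroup H] [InnerProductSpace ℂ H] {T K : ℝ}
    (hT : 0 < T) {Z P Q : ℝ → H} (hc : ContinuousOn Z (Icc (-T) T)) (h0 : Z 0 = 0)
    (hd : ∀ t ∈ Ioo (-T) T, HasDerivAt Z (P t + Q t) t)
    (hP : ∀ t ∈ Ioo (-T) T, inner ℂ (Z t) (P t) + inner ℂ (P t) (Z t) = 0)
    (hQ : ∀ t ∈ Ioo (-T) T, ‖Q t‖ ≤ K * ‖Z t‖) : ∀ t ∈ Icc (-T) T, Z t = 0 := by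
  set E : ℝ → ℂ := fun t => inner ℂ (Z t) (Z t) with hE
  have hEn : ∀ t, ‖E t‖ = ‖Z t‖ ^ 2 := fun t => by
    simp only [hE, inner_self_eq_norm_sq_to_K]; simp
  have hEc : ContinuousOn E (Icc (-T) T) := hc.inner hc
  have hEd : ∀ t ∈ Ioo (-T) T, ∃ e, HasDerivAt E e t ∧ ‖e‖ ≤ 2 * K * ‖E t‖ := by
    intro t ht
    refine ⟨_, (hd t ht).inner ℂ (hd t ht), ?_⟩
    -- The skew part `P` drops out of the derivative of the squared norm.
    have e : inner ℂ (Z t) (P t + Q t) + inner ℂ (P t + Q t) (Z t) =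
        inner ℂ (Z t) (Q t) + inner ℂ (Q t) (Z t) := by
      rw [inner_add_left, inner_add_right]
      linear_combination hP t ht
    rw [e, hEn]
    calc _ ≤ ‖inner ℂ (Z t) (Q t)‖ + ‖inner ℂ (Q t) (Z t)‖ := norm_add_le _ _
      _ ≤ ‖Z t‖ * ‖Q t‖ + ‖Q t‖ * ‖Z t‖ := by
        gcongr <;> exact norm_inner_le_norm _ _
      _ = 2 * (‖Q t‖ * ‖Z t‖) := by ring
      _ ≤ 2 * (K * ‖Z t‖ * ‖Z t‖) := by gcongr; exact hQ t ht
      _ = _ := by ring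
  choose! e he hb using hEd
  have hE0 : E 0 = 0 := by simp [hE, h0]
  -- Grönwall's inequality works forward from time `0`; negative times are reached by reflection.
  have key : ∀ t ∈ Icc (0 : ℝ) T, E t = 0 ∧ E (-t) = 0 := by
    intro t ht
    constructor
    · refine eq_zero_of_abs_deriv_le_mul_abs_self_of_eq_zero_right (f := E) (f' := e)
        (K := 2 * K) (hEc.mono (Icc_subset_Icc_left (by linarith))) (fun x hx => ?_) hE0
        (fun x hx => ?_) t ht
      · exact (he x ⟨by linarith [hx.1], hx.2⟩).hasDerivWithinAt
      · exact hb x ⟨by linarith [hx.1], hx.2⟩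
    · have hc' : ContinuousOn (fun t => E (-t)) (Icc 0 T) :=
        hEc.comp continuous_neg.continuousOn fun x hx => ⟨by linarith [hx.2], by linarith [hx.1]⟩
      refine eq_zero_of_abs_deriv_le_mul_abs_self_of_eq_zero_right (f := fun t => E (-t))
        (f' := fun t => -e (-t)) (K := 2 * K) hc' (fun x hx => ?_) (by simpa using hE0)
        (fun x hx => ?_) t ht
      · have h1 := HasDerivAt.scomp (h := fun t : ℝ => -t) x
          (he (-x) ⟨by linarith [hx.2], by linarith [hx.1]⟩) (hasDerivAt_neg x)
        have h2 : HasDerivAt (fun t => E (-t)) ((-1 : ℝ) • e (-x)) x := h1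
        exact (h2.congr_deriv (by simp)).hasDerivWithinAt
      · rw [norm_neg]
        exact hb (-x) ⟨by linarith [hx.2], by linarith [hx.1]⟩
  intro t ht
  have hz : E t = 0 := by
    rcases le_total 0 t with h | h
    · exact (key t ⟨h, ht.2⟩).1
    · simpa using (key (-t) ⟨by linarith, by linarith [ht.1]⟩).2
  exact inner_self_eq_zero.1 hz

end

/-! ### Fourier multipliers on Gevrey functions -/

section

open Classical in
/-- The class of a function in `L²`, which is `0` if the function is not in `L²`. -/
def toL2 (f : ℝ → ℂ) : Lp ℂ 2 (volume : Measure ℝ) :=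
  if h : MemLp f 2 volume then h.toLp f else 0

lemma toL2_eq {f : ℝ → ℂ} (h : MemLp f 2 volume) : toL2 f = h.toLp f := dif_pos h

lemma toL2_ae {f : ℝ → ℂ} (h : MemLp f 2 volume) : toL2 f =ᵐ[volume] f := by
  rw [toL2_eq h]; exact h.coeFn_toLp

lemma toL2_congr {f g : ℝ → ℂ} (h : MemLp f 2 volume) (e : f =ᵐ[volume] g) : toL2 f = toL2 g := by
  rw [toL2_eq h, toL2_eq (h.ae_eq e)]
  exact (MemLp.toLp_eq_toLp_iff _ _).2 e

lemma toL2_sub {f g : ℝ → ℂ} (hf : MemLp f 2 volume) (hg : MemLp g 2 volume) :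
    toL2 (f - g) = toL2 f - toL2 g := by
  rw [toL2_eq hf, toL2_eq hg, toL2_eq (hf.sub hg)]; rfl

lemma enorm_toL2 {f : ℝ → ℂ} (hf : MemLp f 2 volume) : ‖toL2 f‖ₑ = eLpNorm f 2 volume := by
  rw [toL2_eq hf, Lp.enorm_toLp]

/-- The Fourier multiplier with symbol `m`. -/
def multiplier (m : ℝ → ℂ) (f : ℝ → ℂ) : ℝ → ℂ := osc (fun ξ => m ξ * spec f ξ)

section Multiplier

variable {σ s : ℝ} {m : ℝ → ℂ} {c : ℝ}

/-- Cubic growth of the symbol covers both the dispersion and the constant `1`. The two bounds are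
for the `L²` norm and the supremum norm of the multiplier. -/
lemma exists_hnorm_bound (hσ : 0 < σ) (s : ℝ) (hb : ∀ ξ, ‖m ξ‖ ≤ c * jb ξ ^ 3) :
    ∃ C : ℝ≥0∞, C < ∞ ∧ ∀ f, gevreyNorm σ s f < ∞ →
      ∫⁻ ξ, ‖m ξ * spec f ξ‖ₑ ^ 2 ≤ C * gevreyNorm σ s f ^ 2 ∧
      (∫⁻ ξ, ‖m ξ * spec f ξ‖ₑ) ^ 2 ≤ C * gevreyNorm σ s f ^ 2 := by
  obtain ⟨C₁, h₁, H₁⟩ := exists_lintegral_sq_le hσ s 3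
  obtain ⟨C₂, h₂, H₂⟩ := exists_sq_lintegral_le hσ s 3
  have hc : 0 ≤ c := by simpa [jb] using (norm_nonneg _).trans (hb 0)
  have hp : ∀ (f : ℝ → ℂ) ξ, ‖m ξ * spec f ξ‖ₑ ≤
      ENNReal.ofReal c * (ENNReal.ofReal (jb ξ ^ 3) * ‖spec f ξ‖ₑ) := fun f ξ => by
    rw [enorm_mul, ← mul_assoc, ← ENNReal.ofReal_mul hc, ← ofReal_norm (m ξ)]
    gcongr
    exact hb ξ
  refine ⟨ENNReal.ofReal c ^ 2 * (C₁ + C₂), ENNReal.mul_lt_top (by finiteness)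
    (ENNReal.add_lt_top.2 ⟨h₁, h₂⟩), fun f hf => ?_⟩
  have hn := hnorm_spec_le (σ := σ) (s := s) (memLp_of_gevreyNorm hf)
  unfold hnorm at hn
  rw [mul_assoc]
  constructor
  · calc _ ≤ ∫⁻ ξ, ENNReal.ofReal c ^ 2 * (ENNReal.ofReal (jb ξ ^ 3) * ‖spec f ξ‖ₑ) ^ 2 :=
          lintegral_mono fun ξ => by rw [← mul_pow]; gcongr; exact hp f ξ
      _ ≤ ENNReal.ofReal c ^ 2 * (C₁ * gevreyNorm σ s f ^ 2) := by
          rw [lintegral_const_mul' _ _ (by finiteness)]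
          gcongr
          exact (H₁ _).trans (mul_le_mul_right hn _)
      _ ≤ _ := by gcongr; exact le_self_add
  · calc _ ≤ (∫⁻ ξ, ENNReal.ofReal c * (ENNReal.ofReal (jb ξ ^ 3) * ‖spec f ξ‖ₑ)) ^ 2 := by
          gcongr; exact hp f _
      _ ≤ ENNReal.ofReal c ^ 2 * (C₂ * gevreyNorm σ s f ^ 2) := by
          rw [lintegral_const_mul' _ _ (by finiteness), mul_pow]
          gcongr
          exact (H₂ _ (measurable_spec f).enorm).trans (mul_le_mul_right hn _)
      _ ≤ _ := by gcongr; exact le_add_self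

lemma enorm_osc_le (g : ℝ → ℂ) (x : ℝ) : ‖osc g x‖ₑ ≤ ∫⁻ ξ, ‖g ξ‖ₑ := by
  refine (enorm_integral_le_lintegral_enorm _).trans (le_of_eq ?_)
  simp only [enorm_mul, enorm_ex, one_mul]

lemma measurable_symbol_mul (hm : Measurable m) (f : ℝ → ℂ) :
    Measurable fun ξ => m ξ * spec f ξ :=
  hm.mul (measurable_spec f)

lemma memLp_symbol_mul (hσ : 0 < σ) (hm : Measurable m) (hb : ∀ ξ, ‖m ξ‖ ≤ c * jb ξ ^ 3)
    {f : ℝ → ℂ} (hf : gevreyNorm σ s f < ∞) : MemLp (fun ξ => m ξ * spec f ξ) 2 volume := by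
  obtain ⟨C, hC, H⟩ := exists_hnorm_bound hσ s hb
  refine ⟨(hm.mul (measurable_spec f)).aestronglyMeasurable, lt_top_of_sq_lt_top ?_⟩
  rw [eLpNorm_two_sq]
  exact (H f hf).1.trans_lt (ENNReal.mul_lt_top hC (by finiteness))

lemma integrable_symbol_mul (hσ : 0 < σ) (hm : Measurable m) (hb : ∀ ξ, ‖m ξ‖ ≤ c * jb ξ ^ 3)
    {f : ℝ → ℂ} (hf : gevreyNorm σ s f < ∞) : Integrable (fun ξ => m ξ * spec f ξ) :=
  ((rapidlyIntegrable_spec hσ hf).mul_of_le hm hb).integrable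

lemma memLp_multiplier (hσ : 0 < σ) (hm : Measurable m) (hb : ∀ ξ, ‖m ξ‖ ≤ c * jb ξ ^ 3)
    {f : ℝ → ℂ} (hf : gevreyNorm σ s f < ∞) : MemLp (multiplier m f) 2 volume :=
  memLp_osc (hm.mul (measurable_spec f)) (integrable_symbol_mul hσ hm hb hf)
    (memLp_symbol_mul hσ hm hb hf)

lemma exists_multiplier_bound (hσ : 0 < σ) (s : ℝ) (hm : Measurable m)
    (hb : ∀ ξ, ‖m ξ‖ ≤ c * jb ξ ^ 3) : ∃ C : ℝ≥0∞, C < ∞ ∧ ∀ f, gevreyNorm σ s f < ∞ →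
      eLpNorm (multiplier m f) 2 volume ^ 2 ≤ C * gevreyNorm σ s f ^ 2 ∧
      ∀ x, ‖multiplier m f x‖ₑ ^ 2 ≤ C * gevreyNorm σ s f ^ 2 := by
  obtain ⟨C, hC, H⟩ := exists_hnorm_bound hσ s hb
  refine ⟨(ENNReal.ofReal (2 * Real.pi) + 1) * C, ENNReal.mul_lt_top (by finiteness) hC,
    fun f hf => ⟨?_, fun x => ?_⟩⟩
  · rw [multiplier, eLpNorm_osc_sq (measurable_symbol_mul hm f)
      (integrable_symbol_mul hσ hm hb hf) (memLp_symbol_mul hσ hm hb hf), mul_assoc]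
    exact mul_le_mul' le_self_add (H f hf).1
  · calc _ ≤ (∫⁻ ξ, ‖m ξ * spec f ξ‖ₑ) ^ 2 := by gcongr; exact enorm_osc_le _ x
      _ ≤ 1 * (C * gevreyNorm σ s f ^ 2) := by rw [one_mul]; exact (H f hf).2
      _ ≤ _ := by rw [mul_assoc]; gcongr; exact le_add_self

lemma multiplier_sub (hσ : 0 < σ) (hm : Measurable m) (hb : ∀ ξ, ‖m ξ‖ ≤ c * jb ξ ^ 3)
    {f g : ℝ → ℂ} (hf : gevreyNorm σ s f < ∞) (hg : gevreyNorm σ s g < ∞) :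
    multiplier m (f - g) = multiplier m f - multiplier m g := by
  rw [multiplier, multiplier, multiplier, osc_sub (integrable_symbol_mul hσ hm hb hf)
    (integrable_symbol_mul hσ hm hb hg)]
  refine osc_congr ?_
  filter_upwards [spec_sub (memLp_of_gevreyNorm hf) (memLp_of_gevreyNorm hg)] with ξ hξ
  rw [hξ]; ring

lemma multiplier_one (f : ℝ → ℂ) : multiplier (fun _ => 1) f = osc (spec f) := by
  simp only [multiplier, one_mul]

/-- A multiplier with imaginary symbol is skew-adjoint. -/
lemma inner_multiplier_add (hσ : 0 < σ) {φ : ℝ → ℝ} (hφ : Measurable φ)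
    (hb : ∀ ξ, ‖Complex.I * (φ ξ : ℂ)‖ ≤ c * jb ξ ^ 3) {f : ℝ → ℂ} (hf : gevreyNorm σ s f < ∞) :
    inner ℂ (toL2 f) (toL2 (multiplier (fun ξ => Complex.I * φ ξ) f)) +
      inner ℂ (toL2 (multiplier (fun ξ => Complex.I * φ ξ) f)) (toL2 f) = 0 := by
  have hm : Measurable fun ξ => Complex.I * (φ ξ : ℂ) := by fun_prop
  have hr := rapidlyIntegrable_spec hσ hf
  have h2 : MemLp (spec f) 2 volume := by
    have hn := (hnorm_spec_le (memLp_of_gevreyNorm hf)).trans_lt (by finiteness)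
    exact memLp_of_hnorm hσ (measurable_spec f) hn
  have e1 : toL2 f = 𝓕⁻ ((memLp_rescale hr.measurable h2).toLp (rescale (spec f))) := by
    rw [← toLp_osc hr.measurable hr.integrable h2, ← toL2_eq]
    exact toL2_congr (memLp_of_gevreyNorm hf) (osc_spec hσ hf).symm
  have k2 := memLp_symbol_mul hσ hm hb hf
  have km := measurable_symbol_mul hm f
  have e2 : toL2 (multiplier (fun ξ => Complex.I * φ ξ) f) =
      𝓕⁻ ((memLp_rescale km k2).toLp (rescale (fun ξ => Complex.I * φ ξ * spec f ξ))) := by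
    rw [← toLp_osc km (integrable_symbol_mul hσ hm hb hf) k2]
    exact toL2_eq _
  -- By Plancherel the inner products may be taken on the Fourier side, where the imaginary symbol
  -- cancels against its conjugate.
  have e3 : ∀ a b : Lp ℂ 2 (volume : Measure ℝ), inner ℂ (𝓕⁻ a) (𝓕⁻ b) = inner ℂ a b := fun a b => by
    rw [← Lp.inner_fourier_eq (𝓕⁻ a) (𝓕⁻ b), FourierTransform.fourier_fourierInv_eq,
      FourierTransform.fourier_fourierInv_eq]
  rw [e1, e2, e3, e3, L2.inner_def, L2.inner_def,
    ← integral_add (L2.integrable_inner _ _) (L2.integrable_inner _ _)]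
  refine integral_eq_zero_of_ae ?_
  filter_upwards [(memLp_rescale hr.measurable h2).coeFn_toLp,
    (memLp_rescale km k2).coeFn_toLp] with η h1 h2
  rw [h1, h2]
  simp only [rescale, RCLike.inner_apply, map_mul, Complex.conj_I, Complex.conj_ofReal,
    Pi.zero_apply]
  ring

end Multiplier

/-- A curve that is continuous in the Gevrey norm is bounded. -/
lemma ContinuousInGevrey.exists_bound {σ s T : ℝ} {u : ℝ → ℝ → ℂ}
    (hu : ContinuousInGevrey σ s T u) :
    ∃ M : ℝ≥0∞, M < ∞ ∧ ∀ t ∈ Icc (-T) T, gevreyNorm σ s (u t) ≤ M := by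
  suffices ∃ M : ℝ≥0∞, M < ∞ ∧ ∀ t ∈ Icc (-T) T, t ∈ Icc (-T) T → gevreyNorm σ s (u t) ≤ M by
    obtain ⟨M, hM, h⟩ := this
    exact ⟨M, hM, fun t ht => h t ht ht⟩
  refine isCompact_Icc.induction_on (p := fun S => ∃ M : ℝ≥0∞, M < ∞ ∧ ∀ t ∈ S, t ∈ Icc (-T) T →
    gevreyNorm σ s (u t) ≤ M) ⟨0, ENNReal.zero_lt_top, fun t ht => ht.elim⟩ ?_ ?_ ?_
  · rintro S S' hS ⟨M, hM, h⟩
    exact ⟨M, hM, fun t ht => h t (hS ht)⟩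
  · rintro S S' ⟨M, hM, h⟩ ⟨M', hM', h'⟩
    refine ⟨M + M', ENNReal.add_lt_top.2 ⟨hM, hM'⟩, fun t ht hT => ?_⟩
    rcases ht with ht | ht
    · exact (h t ht hT).trans le_self_add
    · exact (h' t ht hT).trans le_add_self
  · intro t ht
    obtain ⟨h1, h2⟩ := hu t ht
    refine ⟨{t' | t' ∈ Icc (-T) T → gevreyNorm σ s (u t') ≤ 1 + gevreyNorm σ s (u t)}, ?_,
      1 + gevreyNorm σ s (u t), by finiteness, fun t' h hT => h hT⟩
    have := h2.eventually (eventually_lt_nhds (b := (1 : ℝ≥0∞)) zero_lt_one)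
    filter_upwards [this, self_mem_nhdsWithin] with t' h hT _
    exact (gevreyNorm_le_add (memLp_of_gevreyNorm (hu t' hT).1) (memLp_of_gevreyNorm h1)).trans
      (by gcongr)

/-- A Lipschitz bound from the Gevrey norm to `L²` along the curve transfers continuity. It serves
for the curve itself, its dispersive part and its cubic term. -/
lemma continuousOn_toL2 {T : ℝ} {σ s : ℝ} {u : ℝ → ℝ → ℂ} (hu : ContinuousInGevrey σ s T u)
    {f : ℝ → ℝ → ℂ} (hf : ∀ t ∈ Icc (-T) T, MemLp (f t) 2 volume) {C : ℝ≥0∞} (hC : C < ∞)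
    (h : ∀ t ∈ Icc (-T) T, ∀ t' ∈ Icc (-T) T, gevreyNorm σ s (u t' - u t) < ∞ →
      eLpNorm (f t' - f t) 2 volume ^ 2 ≤ C * gevreyNorm σ s (u t' - u t) ^ 2) :
    ContinuousOn (fun t => toL2 (f t)) (Icc (-T) T) := by
  intro t ht
  have h1 : Tendsto (fun t' => C * gevreyNorm σ s (u t' - u t) ^ 2) (𝓝[Icc (-T) T] t) (𝓝 0) := by
    have := ENNReal.Tendsto.const_mul (a := C) (ENNReal.Tendsto.pow (n := 2) (hu t ht).2)
      (Or.inr hC.ne)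
    simpa using this
  have h2 : Tendsto (fun t' => ‖toL2 (f t') - toL2 (f t)‖ₑ ^ 2) (𝓝[Icc (-T) T] t) (𝓝 0) := by
    refine tendsto_of_tendsto_of_tendsto_of_le_of_le' tendsto_const_nhds h1
      (Eventually.of_forall fun _ => zero_le) ?_
    filter_upwards [(hu t ht).2.eventually (eventually_lt_nhds (b := (1 : ℝ≥0∞)) zero_lt_one),
      self_mem_nhdsWithin] with t' h' ht'
    rw [← toL2_sub (hf t' ht') (hf t ht), enorm_toL2 ((hf t' ht').sub (hf t ht))]
    exact h t ht t' ht' (h'.trans ENNReal.one_lt_top)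
  have h3 := (ENNReal.continuous_rpow_const (y := 1 / 2)).tendsto _ |>.comp h2
  rw [ENNReal.zero_rpow_of_pos (by norm_num)] at h3
  have e : ∀ a : ℝ≥0∞, (a ^ 2) ^ (1 / 2 : ℝ) = a := fun a => by
    rw [← ENNReal.rpow_natCast, ← ENNReal.rpow_mul]; norm_num
  simp only [Function.comp_def, e] at h3
  rw [ContinuousWithinAt, tendsto_iff_edist_tendsto_0]
  simpa [edist_eq_enorm_sub] using h3

end

/-! ### Uniqueness of solutions -/

section

lemma norm_phase_symbol_le (α β ξ : ℝ) :
    ‖Complex.I * (phase α β ξ : ℂ)‖ ≤ (|α| + |β|) * jb ξ ^ 3 := by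
  rw [norm_mul, Complex.norm_I, one_mul, Complex.norm_real, Real.norm_eq_abs]
  exact abs_phase_le α β ξ

lemma norm_one_symbol_le (ξ : ℝ) : ‖(1 : ℂ)‖ ≤ 1 * jb ξ ^ 3 := by
  rw [norm_one, one_mul]; exact one_le_pow₀ (one_le_jb ξ)

/-- The dispersive part `-iα∂²f - β∂³f` of the equation, as a Fourier multiplier. -/
def dispersion (α β : ℝ) (f : ℝ → ℂ) : ℝ → ℂ := multiplier (fun ξ => Complex.I * phase α β ξ) f

/-- The cubic nonlinearity `|f|²f`. -/
def cubic (f : ℝ → ℂ) (x : ℝ) : ℂ := (‖f x‖ : ℂ) ^ 2 * f x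

lemma measurable_phase_symbol (α β : ℝ) : Measurable fun ξ => Complex.I * (phase α β ξ : ℂ) := by
  have := measurable_phase α β
  fun_prop

variable {α β γ σ s T : ℝ}

/-- The function equals its Fourier integral everywhere, and `-iα(iξ)² - β(iξ)³ = iφ(ξ)`. -/
lemma equation_eq (hσ : 0 < σ) {f : ℝ → ℂ} (hf : gevreyNorm σ s f < ∞) (hc : Continuous f) (x : ℝ) :
    -(Complex.I * α * iteratedDeriv 2 f x + β * iteratedDeriv 3 f x
        + Complex.I * γ * (‖f x‖ : ℂ) ^ 2 * f x) =
      dispersion α β f x - Complex.I * γ * cubic f x := by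
  have hr := rapidlyIntegrable_spec hσ hf
  have e := osc_spec_eq hσ hf hc
  have e2 : iteratedDeriv 2 f = osc (fun ξ : ℝ => (Complex.I * (ξ : ℂ)) ^ 2 * spec f ξ) := by
    rw [← iteratedDeriv_osc 2 hr, e]
  have e3 : iteratedDeriv 3 f = osc (fun ξ : ℝ => (Complex.I * (ξ : ℂ)) ^ 3 * spec f ξ) := by
    rw [← iteratedDeriv_osc 3 hr, e]
  have i : ∀ n : ℕ, Integrable fun ξ : ℝ => ex (x * ξ) * ((Complex.I * (ξ : ℂ)) ^ n * spec f ξ) :=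
    fun n => ((hr.mul_of_le (m := fun ξ : ℝ => (Complex.I * (ξ : ℂ)) ^ n) (C := 1) (n := n)
      (by fun_prop) fun ξ => by
        rw [norm_pow, one_mul]
        exact pow_le_pow_left₀ (norm_nonneg _) (by simpa using norm_I_mul_le ξ) n).integrable).bdd_mul
      (c := 1) (by fun_prop : Measurable fun ξ : ℝ => ex (x * ξ)).aestronglyMeasurable
      (ae_of_all _ fun p => (norm_ex _).le)
  have key : dispersion α β f x = -(Complex.I * α * iteratedDeriv 2 f x
      + β * iteratedDeriv 3 f x) := by
    rw [e2, e3, dispersion, multiplier, osc_real, osc_real, osc_real, ← integral_const_mul,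
      ← integral_const_mul, ← integral_add ((i 2).const_mul _) ((i 3).const_mul _), ← integral_neg]
    refine integral_congr_ae (ae_of_all _ fun ξ => ?_)
    simp only [phase]
    push_cast
    linear_combination (ex (x * ξ) * spec f ξ * (Complex.I * α * ξ ^ 2 +
      Complex.I * β * ξ ^ 3)) * Complex.I_sq
  rw [key, cubic]; ring

lemma norm_cubic_le {f : ℝ → ℂ} {B : ℝ} (x : ℝ) (h : ‖f x‖ ≤ B) :
    ‖cubic f x‖ ≤ B ^ 2 * ‖f x‖ := by
  rw [cubic, norm_mul, norm_pow, Complex.norm_real, norm_norm]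
  gcongr

/-- In `|f|²f - |g|²g = |f|²(f - g) + (|f| - |g|)(|f| + |g|)g` the summands contribute `B²` and
`2B²`. -/
lemma norm_cubic_sub_le {f g : ℝ → ℂ} {B : ℝ} (x : ℝ) (hf : ‖f x‖ ≤ B) (hg : ‖g x‖ ≤ B) :
    ‖cubic f x - cubic g x‖ ≤ 3 * B ^ 2 * ‖f x - g x‖ := by
  have hB : 0 ≤ B := (norm_nonneg _).trans hf
  have e : cubic f x - cubic g x = (‖f x‖ : ℂ) ^ 2 * (f x - g x) +
      ((‖f x‖ - ‖g x‖ : ℝ) : ℂ) * ((‖f x‖ + ‖g x‖ : ℝ) : ℂ) * g x := by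
    rw [cubic, cubic]; push_cast; ring
  rw [e]
  refine (norm_add_le _ _).trans ?_
  rw [norm_mul, norm_mul, norm_mul, norm_pow, Complex.norm_real, Complex.norm_real,
    Complex.norm_real, norm_norm, Real.norm_eq_abs, Real.norm_of_nonneg (by positivity)]
  calc _ ≤ B ^ 2 * ‖f x - g x‖ + ‖f x - g x‖ * (B + B) * B := by
        gcongr; exact abs_norm_sub_norm_le _ _
    _ = _ := by ring

lemma memLp_cubic {f : ℝ → ℂ} {B : ℝ} (h2 : MemLp f 2 volume) (h : ∀ x, ‖f x‖ ≤ B) :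
    MemLp (cubic f) 2 volume := by
  refine h2.of_le_mul (c := B ^ 2) ?_ (ae_of_all _ fun x => norm_cubic_le x (h x))
  exact ((Complex.continuous_ofReal.comp_aestronglyMeasurable h2.1.norm).pow 2).mul h2.1

lemma eLpNorm_cubic_sub_le {f g : ℝ → ℂ} {B : ℝ} (hf : ∀ x, ‖f x‖ ≤ B) (hg : ∀ x, ‖g x‖ ≤ B) :
    eLpNorm (cubic f - cubic g) 2 volume ≤
      ENNReal.ofReal (3 * B ^ 2) * eLpNorm (f - g) 2 volume :=
  eLpNorm_le_mul_eLpNorm_of_ae_le_mul (ae_of_all _ fun x => norm_cubic_sub_le x (hf x) (hg x)) 2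

lemma exists_eLpNorm_sq_le (hσ : 0 < σ) (s : ℝ) : ∃ C : ℝ≥0∞, C < ∞ ∧ ∀ f, gevreyNorm σ s f < ∞ →
    eLpNorm f 2 volume ^ 2 ≤ C * gevreyNorm σ s f ^ 2 := by
  obtain ⟨C, hC, h⟩ := exists_multiplier_bound hσ s (measurable_const (a := (1 : ℂ)))
    norm_one_symbol_le
  refine ⟨C, hC, fun f hf => ?_⟩
  rw [← eLpNorm_congr_ae (osc_spec hσ hf), ← multiplier_one]
  exact (h f hf).1

lemma ContinuousInGevrey.exists_multiplier_bound {u : ℝ → ℝ → ℂ} (hσ : 0 < σ)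
    (hu : ContinuousInGevrey σ s T u) {m : ℝ → ℂ} {c : ℝ} (hm : Measurable m)
    (hb : ∀ ξ, ‖m ξ‖ ≤ c * jb ξ ^ 3) :
    ∃ B : ℝ, ∀ t ∈ Icc (-T) T, ∀ x, ‖multiplier m (u t) x‖ ≤ B := by
  obtain ⟨C, hC, h⟩ := TNLS.exists_multiplier_bound hσ s hm hb
  obtain ⟨M, hM, hu'⟩ := hu.exists_bound
  have hCM : C * M ^ 2 < ∞ := ENNReal.mul_lt_top hC (by finiteness)
  refine ⟨(C * M ^ 2).toReal + 1, fun t ht x => ?_⟩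
  have h1 : ‖multiplier m (u t) x‖ₑ ^ 2 ≤ C * M ^ 2 :=
    ((h _ (hu t ht).1).2 x).trans (by gcongr; exact hu' t ht)
  have h2 := ENNReal.toReal_mono hCM.ne h1
  rw [ENNReal.toReal_pow, toReal_enorm] at h2
  nlinarith [sq_nonneg (‖multiplier m (u t) x‖ - 1), norm_nonneg (multiplier m (u t) x)]

lemma ContinuousInGevrey.exists_norm_bound {u : ℝ → ℝ → ℂ} (hσ : 0 < σ)
    (hu : ContinuousInGevrey σ s T u) (hc : ∀ t ∈ Icc (-T) T, Continuous (u t)) :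
    ∃ B : ℝ, ∀ t ∈ Icc (-T) T, ∀ x, ‖u t x‖ ≤ B := by
  obtain ⟨B, hB⟩ := hu.exists_multiplier_bound hσ (measurable_const (a := (1 : ℂ)))
    norm_one_symbol_le
  refine ⟨B, fun t ht x => ?_⟩
  have := hB t ht x
  rwa [multiplier_one, osc_spec_eq hσ (hu t ht).1 (hc t ht)] at this

lemma memLp_dispersion (hσ : 0 < σ) {f : ℝ → ℂ} (hf : gevreyNorm σ s f < ∞) :
    MemLp (dispersion α β f) 2 volume :=
  memLp_multiplier hσ (measurable_phase_symbol α β) (norm_phase_symbol_le α β) hf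

/-- The time derivative of a solution, as a curve in `L²`. -/
def velocity (α β γ : ℝ) (u : ℝ → ℝ → ℂ) (t : ℝ) : Lp ℂ 2 (volume : Measure ℝ) :=
  toL2 (dispersion α β (u t)) - (Complex.I * γ) • toL2 (cubic (u t))

lemma continuousOn_velocity {u : ℝ → ℝ → ℂ} (hσ : 0 < σ) (hu : ContinuousInGevrey σ s T u)
    (hc : ∀ t ∈ Icc (-T) T, Continuous (u t)) : ContinuousOn (velocity α β γ u) (Icc (-T) T) := by
  obtain ⟨B, hB⟩ := hu.exists_norm_bound hσ hc
  obtain ⟨C, hC, hC'⟩ := exists_eLpNorm_sq_le hσ s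
  obtain ⟨C₁, hC₁, hC₁'⟩ := exists_multiplier_bound hσ s (measurable_phase_symbol α β)
    (norm_phase_symbol_le α β)
  have cc : ContinuousOn (fun t => toL2 (cubic (u t))) (Icc (-T) T) := by
    refine continuousOn_toL2 hu
      (fun t ht => memLp_cubic (memLp_of_gevreyNorm (hu t ht).1) (hB t ht))
      (C := ENNReal.ofReal (3 * B ^ 2) ^ 2 * C)
      (ENNReal.mul_lt_top (by finiteness) hC) fun t ht t' ht' hlt => ?_
    calc _ ≤ (ENNReal.ofReal (3 * B ^ 2) * eLpNorm (u t' - u t) 2 volume) ^ 2 := by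
          gcongr; exact eLpNorm_cubic_sub_le (hB t' ht') (hB t ht)
      _ ≤ _ := by rw [mul_pow, mul_assoc]; gcongr; exact hC' _ hlt
  have cd : ContinuousOn (fun t => toL2 (dispersion α β (u t))) (Icc (-T) T) := by
    refine continuousOn_toL2 hu (fun t ht => memLp_dispersion hσ (hu t ht).1) hC₁
      fun t ht t' ht' hlt => ?_
    rw [dispersion, dispersion, ← multiplier_sub hσ (measurable_phase_symbol α β)
      (norm_phase_symbol_le α β) (hu t' ht').1 (hu t ht).1]
    exact (hC₁' _ hlt).1
  have ck : Continuous fun z : Lp ℂ 2 (volume : Measure ℝ) => (Complex.I * (γ : ℂ)) • z :=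
    continuous_const_smul _
  exact cd.sub (ck.comp_continuousOn cc)

lemma velocity_ae {u : ℝ → ℝ → ℂ} {t : ℝ} (h₁ : MemLp (dispersion α β (u t)) 2 volume)
    (h₂ : MemLp (cubic (u t)) 2 volume) : velocity α β γ u t =ᵐ[volume]
      fun x => dispersion α β (u t) x - Complex.I * γ * cubic (u t) x := by
  filter_upwards [Lp.coeFn_sub (toL2 (dispersion α β (u t)))
    ((Complex.I * γ) • toL2 (cubic (u t))), Lp.coeFn_smul (Complex.I * (γ : ℂ))
    (toL2 (cubic (u t))), toL2_ae h₁, toL2_ae h₂] with x e1 e2 e3 e4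
  rw [velocity, e1, Pi.sub_apply, e2, Pi.smul_apply, e3, e4, smul_eq_mul]

/-- The equation only provides time derivatives at each point `x`. Its right-hand side is bounded
uniformly and continuous into `L²`, so these combine to a derivative in `L²`. -/
lemma hasDerivAt_toL2 {u : ℝ → ℝ → ℂ} {v₀ : ℝ → ℂ} (hσ : 0 < σ) (hu : ContinuousInGevrey σ s T u)
    (h : SolvesIVP α β γ T v₀ u) {t : ℝ} (ht : t ∈ Ioo (-T) T) :
    HasDerivAt (fun t => toL2 (u t)) (velocity α β γ u t) t := by
  have hc : ∀ t ∈ Icc (-T) T, Continuous (u t) := fun t ht => (h.1 t ht).continuous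
  have hI : ∀ t ∈ Ioo (-T) T, t ∈ Icc (-T) T := fun t ht => Ioo_subset_Icc_self ht
  obtain ⟨B, hB⟩ := hu.exists_norm_bound hσ hc
  obtain ⟨B', hB'⟩ := hu.exists_multiplier_bound hσ (measurable_phase_symbol α β)
    (norm_phase_symbol_le α β)
  have m2 : ∀ t ∈ Icc (-T) T, MemLp (u t) 2 volume := fun t ht => memLp_of_gevreyNorm (hu t ht).1
  have hd : ∀ t ∈ Ioo (-T) T, ∀ x, HasDerivAt (fun t => u t x)
      (dispersion α β (u t) x - Complex.I * γ * cubic (u t) x) t := fun t ht x => by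
    have := (h.2.1 t (hI t ht) x).hasDerivAt (Icc_mem_nhds ht.1 ht.2)
    rwa [equation_eq hσ (hu t (hI t ht)).1 (hc t (hI t ht))] at this
  have hb : ∀ t ∈ Ioo (-T) T, ∀ x,
      ‖dispersion α β (u t) x - Complex.I * γ * cubic (u t) x‖ ≤ B' + |γ| * (B ^ 2 * B) := by
    intro t ht x
    refine (norm_sub_le _ _).trans (add_le_add (hB' t (hI t ht) x) ?_)
    rw [norm_mul, norm_mul, Complex.norm_I, one_mul, Complex.norm_real, Real.norm_eq_abs]
    have hx := hB t (hI t ht) x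
    gcongr
    exact (norm_cubic_le x hx).trans (by gcongr)
  exact hasDerivAt_Lp_of_pointwise (fun t ht => toL2_ae (m2 t (hI t ht)))
    (fun t ht => velocity_ae (memLp_dispersion hσ (hu t (hI t ht)).1)
      (memLp_cubic (m2 t (hI t ht)) (hB t (hI t ht))))
    ((continuousOn_velocity hσ hu hc).mono Ioo_subset_Icc_self) hd hb ht

lemma gevreyNorm_sub_le {f g : ℝ → ℂ} (hf : MemLp f 2 volume) (hg : MemLp g 2 volume) :
    gevreyNorm σ s (f - g) ≤ gevreyNorm σ s f + gevreyNorm σ s g := by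
  rw [gevreyNorm_eq hf, gevreyNorm_eq hg, gevreyNorm_eq (hf.sub hg)]
  have m := fun k : Lp ℂ 2 (volume : Measure ℝ) =>
    ((measurable_gw σ s).smul (measurable_hat k)).aestronglyMeasurable (μ := volume)
  refine le_trans (le_of_eq (eLpNorm_congr_ae ?_)) (eLpNorm_sub_le (m _) (m _) one_le_two)
  have : (hf.sub hg).toLp (f - g) = hf.toLp f - hg.toLp g := rfl
  rw [this]
  filter_upwards [hat_sub (hf.toLp f) (hg.toLp g)] with ξ hξ
  simp only [Pi.sub_apply, hξ, smul_sub]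

/-- Solutions of the initial value problem are unique in the class of curves that are continuous in
the Gevrey norm. -/
theorem SolvesIVP.unique {u w : ℝ → ℝ → ℂ} {v₀ : ℝ → ℂ} (hσ : 0 < σ) (hT : 0 < T)
    (hu : ContinuousInGevrey σ s T u) (hw : ContinuousInGevrey σ s T w)
    (su : SolvesIVP α β γ T v₀ u) (sw : SolvesIVP α β γ T v₀ w) :
    ∀ t ∈ Icc (-T) T, ∀ x, u t x = w t x := by
  have cu : ∀ t ∈ Icc (-T) T, Continuous (u t) := fun t ht => (su.1 t ht).continuous
  have cw : ∀ t ∈ Icc (-T) T, Continuous (w t) := fun t ht => (sw.1 t ht).continuous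
  have mu : ∀ t ∈ Icc (-T) T, MemLp (u t) 2 volume := fun t ht => memLp_of_gevreyNorm (hu t ht).1
  have mw : ∀ t ∈ Icc (-T) T, MemLp (w t) 2 volume := fun t ht => memLp_of_gevreyNorm (hw t ht).1
  have hI : ∀ t ∈ Ioo (-T) T, t ∈ Icc (-T) T := fun t ht => Ioo_subset_Icc_self ht
  obtain ⟨B₁, hB₁⟩ := hu.exists_norm_bound hσ cu
  obtain ⟨B₂, hB₂⟩ := hw.exists_norm_bound hσ cw
  set B := max B₁ B₂
  have hBu : ∀ t ∈ Icc (-T) T, ∀ x, ‖u t x‖ ≤ B := fun t ht x => (hB₁ t ht x).trans (le_max_left _ _)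
  have hBw : ∀ t ∈ Icc (-T) T, ∀ x, ‖w t x‖ ≤ B := fun t ht x =>
    (hB₂ t ht x).trans (le_max_right _ _)
  obtain ⟨C, hC, hC'⟩ := exists_eLpNorm_sq_le hσ s
  have h0 : (0 : ℝ) ∈ Icc (-T) T := ⟨by linarith, hT.le⟩
  -- The energy argument for the difference: `P` is its dispersive part, and `Q` is the difference
  -- of the cubic terms, Lipschitz with constant `3B²` since `B` bounds both solutions. The Bourgain
  -- norm plays no role.
  have key := eq_zero_of_energy hT (Z := fun t => toL2 (u t) - toL2 (w t))
    (P := fun t => toL2 (dispersion α β (u t)) - toL2 (dispersion α β (w t)))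
    (Q := fun t => -((Complex.I * γ) • (toL2 (cubic (u t)) - toL2 (cubic (w t)))))
    (K := |γ| * (3 * B ^ 2))
    ((continuousOn_toL2 hu mu hC fun t _ t' _ h => hC' _ h).sub
      (continuousOn_toL2 hw mw hC fun t _ t' _ h => hC' _ h))
    (by rw [sub_eq_zero]; exact toL2_congr (mu 0 h0) (su.2.2.trans sw.2.2.symm))
    (fun t ht => by
      refine ((hasDerivAt_toL2 hσ hu su ht).sub (hasDerivAt_toL2 hσ hw sw ht)).congr_deriv ?_
      rw [velocity, velocity, smul_sub]; abel)
    (fun t ht => by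
      have hlt : gevreyNorm σ s (u t - w t) < ∞ :=
        (gevreyNorm_sub_le (mu t (hI t ht)) (mw t (hI t ht))).trans_lt
          (ENNReal.add_lt_top.2 ⟨(hu t (hI t ht)).1, (hw t (hI t ht)).1⟩)
      rw [← toL2_sub (mu t (hI t ht)) (mw t (hI t ht)),
        ← toL2_sub (memLp_dispersion hσ (hu t (hI t ht)).1)
          (memLp_dispersion hσ (hw t (hI t ht)).1), dispersion, dispersion,
        ← multiplier_sub hσ (measurable_phase_symbol α β)
          (norm_phase_symbol_le α β) (hu t (hI t ht)).1 (hw t (hI t ht)).1]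
      exact inner_multiplier_add hσ (measurable_phase α β) (norm_phase_symbol_le α β) hlt)
    (fun t ht => by
      rw [norm_neg, norm_smul, norm_mul, Complex.norm_I, one_mul, Complex.norm_real,
        Real.norm_eq_abs, mul_assoc]
      gcongr
      have mcu := memLp_cubic (mu t (hI t ht)) (hBu t (hI t ht))
      have mcw := memLp_cubic (mw t (hI t ht)) (hBw t (hI t ht))
      rw [← toL2_sub (mu t (hI t ht)) (mw t (hI t ht)), ← toL2_sub mcu mcw]
      refine Lp.norm_le_mul_norm_of_ae_le_mul ?_
      filter_upwards [toL2_ae (mcu.sub mcw),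
        toL2_ae ((mu t (hI t ht)).sub (mw t (hI t ht)))] with x h1 h2
      rw [h1, h2]
      exact norm_cubic_sub_le x (hBu t (hI t ht) x) (hBw t (hI t ht) x))
  intro t ht x
  have h1 := sub_eq_zero.1 (key t ht)
  have h2 : u t =ᵐ[volume] w t :=
    (toL2_ae (mu t ht)).symm.trans (by rw [h1]; exact toL2_ae (mw t ht))
  exact congrFun ((Continuous.ae_eq_iff_eq volume (cu t ht) (cw t ht)).1 h2) x

end

/-! ### Conclusion -/

section

lemma restrictedNorm_congr {α β σ s b T : ℝ} {u v : ℝ → ℝ → ℂ}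
    (h : ∀ t ∈ Icc (-T) T, ∀ x, u t x = v t x) :
    restrictedNorm α β σ s b T u = restrictedNorm α β σ s b T v := by
  unfold restrictedNorm
  refine iInf_congr fun w => iInf_congr_Prop (Filter.eventually_congr (ae_of_all _ fun p => ?_))
    fun _ => rfl
  refine imp_congr_right fun hp => ?_
  rw [h _ (Ioo_subset_Icc_self hp)]

/-- For `L ≥ 1` one has `K ≤ L ≤ L²`, which avoids taking a square root of the constant. -/
lemma le_mul_of_sq_le {a K N : ℝ≥0∞} {L : ℝ≥0} (h : a ^ 2 ≤ K * N ^ 2) (hK : K ≤ L)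
    (hL : 1 ≤ L) : a ≤ L * N := by
  refine le_of_not_gt fun hlt => ?_
  have h1 : ((L : ℝ≥0∞) * N) ^ 2 < a ^ 2 := ENNReal.pow_lt_pow_left two_ne_zero hlt
  refine absurd (h1.trans_le h) (not_lt.2 ?_)
  rw [mul_pow]
  gcongr
  exact hK.trans (le_self_pow (by exact_mod_cast hL) two_ne_zero)

/-- The solutions of the initial value problem are those that are given by a profile. -/
lemma existsUniqueSolution_of_isProfile {α β γ σ s T : ℝ} {F : ℝ × ℝ → ℂ} {v₀ : ℝ → ℂ}
    (hσ : 0 < σ) (hT : 0 < T) (hT1 : T ≤ 1) (hv : gevreyNorm σ s v₀ < ∞)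
    (hF : IsProfile α β γ σ s T (spec v₀) F) :
    IsSolution α β γ σ s (3 / 4) T v₀ (vsol α β F) ∧
      ∀ w, IsSolution α β γ σ s (3 / 4) T v₀ w → ∀ t ∈ Icc (-T) T, ∀ x, w t x = vsol α β F t x := by
  have h := isSolution_vsol hσ hF hT hT1 (rapidlyIntegrable_spec hσ hv) (osc_spec hσ hv)
  exact ⟨h, fun w hw => hw.solves.unique hσ hT hw.continuous h.continuous h.solves⟩

end

end TNLS

end

theorem mainTheorem2 (s : ℝ) (hs : -(1 / 4) < s) :
    ∃ b : ℝ, 1 / 2 < b ∧ b < 1 ∧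
      ∀ α β γ : ℝ, β ≠ 0 →
        ∃ T₀ : ℝ≥0∞ → ℝ, (∀ r, 0 < T₀ r) ∧
          ∀ σ : ℝ, 0 < σ → ∀ v₀ : ℝ → ℂ, TNLS.gevreyNorm σ s v₀ < ∞ →
            -- existence and uniqueness, with a lifespan that depends on the data through its norm
            TNLS.ExistsUniqueSolution α β γ σ s b (T₀ (TNLS.gevreyNorm σ s v₀)) v₀ ∧
            -- the data-to-solution map is Lipschitz on a neighbourhood of `v₀`
            ∃ δ > (0 : ℝ≥0∞), ∃ L : ℝ≥0,
              (∀ u₀ : ℝ → ℂ, TNLS.gevreyNorm σ s (u₀ - v₀) < δ →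
                TNLS.ExistsUniqueSolution α β γ σ s b (T₀ (TNLS.gevreyNorm σ s v₀)) u₀) ∧
              ∀ u₀ w₀ : ℝ → ℂ,
                TNLS.gevreyNorm σ s (u₀ - v₀) < δ → TNLS.gevreyNorm σ s (w₀ - v₀) < δ →
                ∀ u w : ℝ → ℝ → ℂ,
                  TNLS.IsSolution α β γ σ s b (T₀ (TNLS.gevreyNorm σ s v₀)) u₀ u →
                  TNLS.IsSolution α β γ σ s b (T₀ (TNLS.gevreyNorm σ s v₀)) w₀ w →
                  (∀ t ∈ Icc (-(T₀ (TNLS.gevreyNorm σ s v₀))) (T₀ (TNLS.gevreyNorm σ s v₀)),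
                    TNLS.gevreyNorm σ s (u t - w t) ≤ L * TNLS.gevreyNorm σ s (u₀ - w₀)) ∧
                  TNLS.restrictedNorm α β σ s b (T₀ (TNLS.gevreyNorm σ s v₀)) (u - w)
                    ≤ L * TNLS.gevreyNorm σ s (u₀ - w₀) := by

  -- The only use of `s > -1/4`: `ρ` has to be at least `-s` and still lie in `(0, 1/4)`.
  obtain ⟨ρ, hρ0, hρ1, hρs⟩ : ∃ ρ : ℝ, 0 < ρ ∧ ρ < 1 / 4 ∧ -ρ ≤ s :=
    ⟨max (1 / 8) (-s), lt_max_of_lt_left (by norm_num), max_lt (by norm_num) (by linarith),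
      by linarith [le_max_right (1 / 8) (-s)]⟩
  refine ⟨3 / 4, by norm_num, by norm_num, fun α β γ hβ => ?_⟩
  obtain ⟨T₀, hT, hT1, c, hc, H⟩ := TNLS.exists_profile hρ0 hρ1 α hβ γ
  refine ⟨T₀, hT, fun σ hσ v₀ hv => ?_⟩
  set r := TNLS.gevreyNorm σ s v₀ with hr
  obtain ⟨P, hP, hPL⟩ := H σ s r hσ.le hρs
  have hsmall : ∀ u₀, TNLS.gevreyNorm σ s u₀ ≤ 1 + r →
      TNLS.hnorm σ s (TNLS.spec u₀) ≤ ENNReal.ofReal ((r.toReal + 1) ^ 2) := fun u₀ hu => by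
    refine (TNLS.hnorm_spec_le
      (TNLS.memLp_of_gevreyNorm (hu.trans_lt (by finiteness)))).trans ?_
    rw [ENNReal.ofReal_pow (by positivity), ENNReal.ofReal_add (by positivity) zero_le_one,
      ENNReal.ofReal_toReal hv.ne, ENNReal.ofReal_one, add_comm r]
    gcongr
  have hsol : ∀ u₀, TNLS.gevreyNorm σ s u₀ ≤ 1 + r → _ := fun u₀ hu =>
    TNLS.existsUniqueSolution_of_isProfile hσ (hT r) (hT1 r) (hu.trans_lt (by finiteness))
      (hP _ (TNLS.measurable_spec u₀) (hsmall u₀ hu))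
  have hnear : ∀ u₀, TNLS.gevreyNorm σ s (u₀ - v₀) < 1 → TNLS.gevreyNorm σ s u₀ ≤ 1 + r :=
    fun u₀ hu => by
      have mv := TNLS.memLp_of_gevreyNorm hv
      exact (TNLS.gevreyNorm_le_add (TNLS.memLp_of_gevreyNorm_sub (hu.trans ENNReal.one_lt_top) mv)
        mv).trans (by gcongr)
  set K₁ := ENNReal.ofReal (2 * Real.pi) ^ 2 * (TNLS.jbInt (3 / 2) * c) with hK₁
  set K₂ := ENNReal.ofReal ((2 * Real.pi) ^ 2) ^ 2 * c with hK₂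
  have hj := TNLS.jbInt_lt_top (r := 3 / 2) (by norm_num)
  have hK : K₁ + K₂ + 1 < ∞ := by finiteness
  have hL : ((K₁ + K₂ + 1).toNNReal : ℝ≥0∞) = K₁ + K₂ + 1 := ENNReal.coe_toNNReal hK.ne
  have hL1 : 1 ≤ (K₁ + K₂ + 1).toNNReal := by
    rw [← ENNReal.coe_le_coe, hL, ENNReal.coe_one]; exact le_add_self
  -- The radius `δ = 1` is the margin built into `T₀ r`, which serves all data of norm at most `r +
  -- 1`.
  refine ⟨⟨_, hsol v₀ le_add_self⟩, 1, zero_lt_one, (K₁ + K₂ + 1).toNNReal,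
    fun u₀ hu => ⟨_, hsol u₀ (hnear u₀ hu)⟩, fun u₀ w₀ hu hw u w su sw => ?_⟩
  have hu' := hnear u₀ hu
  have hw' := hnear w₀ hw
  have lu := hu'.trans_lt (by finiteness : 1 + r < ∞)
  have lw := hw'.trans_lt (by finiteness : 1 + r < ∞)
  have mu := TNLS.memLp_of_gevreyNorm lu
  have mw := TNLS.memLp_of_gevreyNorm lw
  have pF := hP _ (TNLS.measurable_spec u₀) (hsmall u₀ hu')
  have pG := hP _ (TNLS.measurable_spec w₀) (hsmall w₀ hw')
  set F := P (TNLS.spec u₀)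
  set G := P (TNLS.spec w₀)
  have hFG : TNLS.wnorm σ s (fun p => ‖(F - G) p‖ₑ) ≤ c * TNLS.gevreyNorm σ s (u₀ - w₀) ^ 2 :=
    (hPL _ _ (TNLS.measurable_spec u₀) (TNLS.measurable_spec w₀) (hsmall u₀ hu')
      (hsmall w₀ hw')).trans (mul_le_mul_right (TNLS.hnorm_spec_sub_le mu mw) _)
  have hlt : TNLS.wnorm σ s (fun p => ‖(F - G) p‖ₑ) < ∞ := by
    have := (TNLS.gevreyNorm_sub_le (σ := σ) (s := s) mu mw).trans_lt
      (ENNReal.add_lt_top.2 ⟨lu, lw⟩)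
    exact hFG.trans_lt (by finiteness)
  have hm : Measurable (F - G) := pF.measurable.sub pG.measurable
  -- By uniqueness `u` and `w` are the solutions given by `F` and `G`, so their difference has the
  -- profile `F - G`, which `hFG` controls.
  have e : ∀ t ∈ Icc (-(T₀ r)) (T₀ r), u t - w t = TNLS.vsol α β (F - G) t := fun t ht => by
    rw [TNLS.vsol_sub (TNLS.integrable_profile hσ pF.measurable pF.wnorm_lt)
      (TNLS.integrable_profile hσ pG.measurable pG.wnorm_lt)]
    funext x
    rw [Pi.sub_apply, Pi.sub_apply, (hsol u₀ hu').2 u su t ht x, (hsol w₀ hw').2 w sw t ht x]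
  constructor
  · intro t ht
    rw [e t ht]
    refine TNLS.le_mul_of_sq_le (K := K₁) ?_ (by rw [hL, add_assoc]; exact le_self_add) hL1
    refine (TNLS.gevreyNorm_vsol_sq_le hσ hm hlt t).trans ?_
    rw [hK₁, mul_assoc, mul_assoc]
    gcongr
  · rw [TNLS.restrictedNorm_congr (u := u - w) (v := TNLS.vsol α β (F - G))
      fun t ht x => congrFun (e t ht) x]
    refine TNLS.le_mul_of_sq_le (K := K₂)
      ?_ (by rw [hL, add_right_comm]; exact le_add_self) hL1
    refine (TNLS.restrictedNorm_vsol_sq_le hσ hm hlt _).trans ?_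
    rw [hK₂, mul_assoc]
    gcongr
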